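/- **Setting.** Let $\Omega\subset\mathbb R^2$ be a bounded polygonal domain with Lipschitz boundary $\partial\Omega=\overline{\Gamma_D}\cup\overline{\Gamma_N}$, $\Gamma_D\cap\Gamma_N=\emptyset$, $\mathrm{meas}_1(\Gamma_D)\ne0$, and let $\mathcal T_h$ be a conforming triangulation of $\overline\Omega$ with vertex set $\mathcal N$ and edge set $\mathcal E=\mathcal E_I\cup\mathcal E_D\cup\mathcal E_N$ (interior, Dirichlet and Neumann edges), where the interior of every boundary edge lies in $\Gamma_D$ or in $\Gamma_N$. Each edge $F$ carries a fixed unit normal $\mathbf n_F$, outward if $F\subset\partial\Omega$; $K_F^-$ is the triangle with edge $F$ for which $\mathbf n_F$ is outward and $K_F^+$ is the other one. On interior edges put $[\![v]\!]=v^--v^+$ and $\{v\}_w=w^+v^++w^-v^-$ with $w^\pm=\alpha^\mp/(\alpha^-+\alpha^+)$, where $\alpha^\pm$ is the maximal eigenvalue of $A|_{K_F^\pm}$; on boundary edges put $[\![v]\!]=\{v\}_w=v^-$. The coefficient $A$ is symmetric positive definite and constant on each triangle, $f\in L^2(\Omega)$, $g|_F\in\mathbb P_{k-1}(F)$ for $F\in\mathcal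 E_N$, and $0\le s\le k-1$. Let $DG(\mathcal T_h,m)$ be the space of piecewise polynomials of degree at most $m$, and $RT(\mathcal T_h,m)\subset H(\mathrm{div};\Omega)$ the Raviart–Thomas space with local space $\mathbb P_m(K)^2+\boldsymbol x\,\mathbb P_m(K)$. Let $\mathring{RT}(\mathcal T_h,s)$ be the space of all $\boldsymbol\tau\in RT(\mathcal T_h,s)$ with $\boldsymbol\tau\cdot\mathbf n_F=0$ for $F\in\mathcal E_N$ and, if $s\ge1$, $(\boldsymbol\tau,\boldsymbol\psi)_K=0$ for all $\boldsymbol\psi\in\mathbb P_{s-1}(K)^2$, $K\in\mathcal T_h$. Let $u$ be the conforming finite element solution of order $k$: $u$ belongs to the space $V_k$ of the functions in $H^1(\Omega)\cap DG(\mathcal T_h,k)$ that vanish on $\Gamma_D$, and $(A\nabla u,\nabla v)=(f,v)-\langle g,v\rangle_{\Gamma_N}$ for all $v\in V_k$. For $0\le m\le k$ let $\tilde{\boldsymbol\sigma}_m\in RT(\mathcal T_h,m)$ be the averaged flux of $u$: for all $\phi\in\mathbb P_m(F)$, $\int_F\tilde{\boldsymbol\sigma}_m\cdot\mathbf n_F\,\phi$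 equals $-\int_F\{A\nabla u\cdot\mathbf n_F\}_w\,\phi$ for $F\in\mathcal E\setminus\mathcal E_N$ and $\int_F g\,\phi$ for $F\in\mathcal E_N$; and, if $m\ge1$, $(\tilde{\boldsymbol\sigma}_m,\boldsymbol\psi)_K=-(A\nabla u,\boldsymbol\psi)_K$ for all $\boldsymbol\psi\in\mathbb P_{m-1}(K)^2$, $K\in\mathcal T_h$. Put $$r_m(v)=(f-\nabla\cdot\tilde{\boldsymbol\sigma}_m,v)_\Omega,\qquad r=r_{k-1},\qquad \mathcal A(\boldsymbol\tau,v)=\sum_{F\in\mathcal E\setminus\mathcal E_N}\int_F\boldsymbol\tau\cdot\mathbf n_F\,[\![v]\!]\,ds .$$ For $z\in\mathcal N$ let $\omega_z$ be the star patch of $z$, $\mathcal E_z$ the set of edges containing $z$, $\lambda_z$ the continuous piecewise linear nodal function of $z$, $DG(\omega_z,s)$ the space of piecewise polynomials of degree at most $s$ on $\omega_z$ (extended by zero), and $X_z$ the space of those $\boldsymbol\tau\in\mathring{RT}(\mathcal T_h,s)$ that vanish outside $\omega_z$ and satisfy $\boldsymbol\tau\cdot\mathbf n_F=0$ on all edges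 $F\notin\mathcal E_z$. Fix $\ell\in\{k-1,k\}$. The patch problem at $z$ is to find $\boldsymbol\sigma_z\in X_z$ with $$\mathcal A_z(\boldsymbol\sigma_z,v):=\sum_{F\in\mathcal E_z\setminus\mathcal E_N}\int_F\boldsymbol\sigma_z\cdot\mathbf n_F\,[\![v]\!]\,ds=r_\ell(v\lambda_z)\qquad\forall v\in DG(\omega_z,s).$$ Let $\mathcal N^*\subset\mathcal N$ be the set of the interior vertices and of the boundary vertices shared by two Dirichlet edges. **Theorem.** 1. The kernel of the patch problem at $z$ (the solutions in $X_z$ of the problem with right-hand side $0$) is one-dimensional for $z\in\mathcal N^*$ and trivial for $z\in\mathcal N\setminus\mathcal N^*$. 2. If $s\le\ell-1$, then the patch problem is solvable at every $z\in\mathcal N$. 3. For every $z\in\mathcal N$ let $\boldsymbol\sigma_z^\Delta$ be a solution of the patch problem, and for every $z\in\mathcal N^*$ let $\boldsymbol\sigma_z^\#$ be an element of its kernel with $\|A^{-1/2}\boldsymbol\sigma_z^\#\|_{\omega_z}=1$. Put $\lambda_z^*=(A^{-1}\boldsymbol\sigma_z^\Delta,\boldsymbol\sigma_z^\#)_{\omega_z}$,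 $\boldsymbol\sigma_z^{\Delta,*}=\boldsymbol\sigma_z^\Delta-\lambda_z^*\boldsymbol\sigma_z^\#$ for $z\in\mathcal N^*$, and $$\boldsymbol\sigma^{\Delta,*}=\sum_{z\in\mathcal N^*}\boldsymbol\sigma_z^{\Delta,*}+\sum_{z\in\mathcal N\setminus\mathcal N^*}\boldsymbol\sigma_z^\Delta .$$ Then $\lambda_z^*$ is the unique minimizer of $\lambda\mapsto\|A^{-1/2}(\boldsymbol\sigma_z^\Delta-\lambda\boldsymbol\sigma_z^\#)\|_{\omega_z}$ over $\mathbb R$ for each $z\in\mathcal N^*$; moreover $\boldsymbol\sigma^{\Delta,*}\in\mathring{RT}(\mathcal T_h,s)$ and $$\mathcal A(\boldsymbol\sigma^{\Delta,*},v)=r(v)\qquad\forall v\in DG(\mathcal T_h,s);$$ and $\hat{\boldsymbol\sigma}=\tilde{\boldsymbol\sigma}_{k-1}+\boldsymbol\sigma^{\Delta,*}$ is locally conservative: $\hat{\boldsymbol\sigma}\in RT(\mathcal T_h,k-1)$, $\hat{\boldsymbol\sigma}\cdot\mathbf n_F=g$ on every $F\in\mathcal E_N$, and $(\nabla\cdot\hat{\boldsymbol\sigma},v)=(f,v)$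 for all $v\in DG(\mathcal T_h,s)$. -/

import Mathlib

open MeasureTheory MvPolynomial
open scoped ContDiff NNReal Matrix RealInnerProductSpace

noncomputable section

namespace EARM

/-- The Euclidean plane. -/
abbrev Plane := EuclideanSpace ℝ (Fin 2)

/-- Lipschitz boundary: near each boundary point, and in suitable Cartesian coordinates centred at
it, the set is the part of a rectangle above the graph of a Lipschitz function. -/
def HasLipschitzBoundary (Ω : Set Plane) : Prop :=
  ∀ x ∈ frontier Ω, ∃ (e : Plane ≃ᵃⁱ[ℝ] Plane) (φ : ℝ → ℝ) (L : ℝ≥0) (r h : ℝ),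
    0 < r ∧ 0 < h ∧ LipschitzWith L φ ∧ e x = 0 ∧
      ∀ y : Plane, |e y 0| < r → |e y 1| < h → (y ∈ Ω ↔ φ (e y 0) < e y 1)

/-- The closed segment, triangle, … spanned by a finite set of points. -/
abbrev hull (S : Finset Plane) : Set Plane := convexHull ℝ (S : Set Plane)

/-- The affine function `l` as a polynomial in the Cartesian coordinates. -/
def affinePoly (l : Plane →ᵃ[ℝ] ℝ) : MvPolynomial (Fin 2) ℝ :=
  C (l 0) + ∑ i : Fin 2, C (l (EuclideanSpace.single i 1) - l 0) * X i

theorem eval_affinePoly (l : Plane →ᵃ[ℝ] ℝ) (x : Plane) :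
    eval x.ofLp (affinePoly l) = l x := by
  have hx : x = x 0 • EuclideanSpace.single (0 : Fin 2) (1 : ℝ)
      + x 1 • EuclideanSpace.single (1 : Fin 2) (1 : ℝ) := by
    ext i; fin_cases i <;> simp
  have hl : ∀ y : Plane, l y = l.linear y + l 0 := fun y => by
    have := l.map_vadd 0 y
    simpa using this
  have h2 : l.linear x = x 0 * l.linear (EuclideanSpace.single (0 : Fin 2) (1 : ℝ))
      + x 1 * l.linear (EuclideanSpace.single (1 : Fin 2) (1 : ℝ)) := by
    conv_lhs => rw [hx]
    simp only [map_add, map_smul, smul_eq_mul]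
  rw [hl x, h2]
  simp only [affinePoly, Fin.sum_univ_two, map_add, map_mul, eval_C, eval_X,
    hl (EuclideanSpace.single (0 : Fin 2) (1 : ℝ)), hl (EuclideanSpace.single (1 : Fin 2) (1 : ℝ))]
  ring

/-- A bounded planar polygonal Lipschitz domain `Ω` with a splitting of its boundary into a
Dirichlet part `ΓD` and a Neumann part `ΓN`, a conforming triangulation of the closure of `Ω` by
finitely many triangles whose boundary edges resolve `ΓD` and `ΓN`, and a choice of a unit normal
on each edge that points outwards on the boundary. -/
structure Mesh where
  Ω : Set Plane
  isOpen : IsOpen Ω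
  isConnected : IsConnected Ω
  lipschitz : HasLipschitzBoundary Ω
  ΓD : Set Plane
  ΓN : Set Plane
  frontier_eq : frontier Ω = closure ΓD ∪ closure ΓN
  disjoint : Disjoint ΓD ΓN
  measure_ΓD : Measure.hausdorffMeasure 1 ΓD ≠ 0
  complex : Geometry.SimplicialComplex ℝ Plane
  finite : complex.faces.Finite
  pure : ∀ F ∈ complex.faces, ∃ K ∈ complex.faces, F ⊆ K ∧ K.card = 3
  space_eq : complex.space = closure Ω
  resolves : ∀ F ∈ complex.faces, F.card = 2 → hull F ⊆ frontier Ω →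
    intrinsicInterior ℝ (hull F) ⊆ ΓD ∨ intrinsicInterior ℝ (hull F) ⊆ ΓN
  normal : Finset Plane → Plane
  norm_normal : ∀ F ∈ complex.faces, F.card = 2 → ‖normal F‖ = 1
  normal_perp : ∀ F ∈ complex.faces, F.card = 2 → ∀ a ∈ F, ∀ b ∈ F, ⟪normal F, a - b⟫ = 0
  normal_outward : ∀ F ∈ complex.faces, F.card = 2 → hull F ⊆ frontier Ω →
    ∀ K ∈ complex.faces, F ⊆ K → ∀ x ∈ K, ∀ a ∈ F, ⟪normal F, x - a⟫ ≤ 0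

namespace Mesh

variable (T : Mesh)

/-! ### Triangles, edges, vertices -/

def triangles : Finset (Finset Plane) := T.finite.toFinset.filter fun K => K.card = 3

def edges : Finset (Finset Plane) := T.finite.toFinset.filter fun F => F.card = 2

open Classical in
def vertices : Finset Plane := T.triangles.biUnion id

def IsBoundaryEdge (F : Finset Plane) : Prop := hull F ⊆ frontier T.Ω

open Classical in
def dirichletEdges : Finset (Finset Plane) :=
  T.edges.filter fun F => T.IsBoundaryEdge F ∧ intrinsicInterior ℝ (hull F) ⊆ T.ΓD

open Classical in
def neumannEdges : Finset (Finset Plane) :=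
  T.edges.filter fun F => T.IsBoundaryEdge F ∧ intrinsicInterior ℝ (hull F) ⊆ T.ΓN

open Classical in
/-- All edges that are not Neumann edges. -/
def activeEdges : Finset (Finset Plane) := T.edges \ T.neumannEdges

open Classical in
/-- The vertices in the interior of the domain, and the vertices shared by two Dirichlet edges. -/
def starVertices : Finset Plane :=
  T.vertices.filter fun z => z ∈ T.Ω ∨
    ∃ F ∈ T.dirichletEdges, ∃ F' ∈ T.dirichletEdges, F ≠ F' ∧ z ∈ F ∧ z ∈ F'

theorem card_triangle (K : T.triangles) : K.1.card = 3 := (Finset.mem_filter.1 K.2).2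

theorem triangle_mem (K : T.triangles) : K.1 ∈ T.complex.faces :=
  T.finite.mem_toFinset.1 (Finset.mem_filter.1 K.2).1

/-! ### Piecewise polynomial functions and vector fields -/

/-- Piecewise polynomial functions: one polynomial for each triangle. -/
abbrev Broken := T.triangles → MvPolynomial (Fin 2) ℝ

/-- Piecewise polynomial vector fields. -/
abbrev VectorField := T.triangles → Fin 2 → MvPolynomial (Fin 2) ℝ

variable {T} in
/-- The piecewise gradient. -/
def grad (v : T.Broken) : T.VectorField := fun K i => pderiv i (v K)

variable {T} in
/-- The piecewise divergence. -/
def div (τ : T.VectorField) : T.Broken := fun K => ∑ i, pderiv i (τ K i)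

/-- `DG(T_h, k)`. -/
def DG (k : ℕ) (v : T.Broken) : Prop := ∀ K, v K ∈ restrictTotalDegree (Fin 2) ℝ k

/-- The test functions `C_c^∞(Ω)`. -/
def IsTest (φ : Plane → ℝ) : Prop :=
  ContDiff ℝ ∞ φ ∧ HasCompactSupport φ ∧ tsupport φ ⊆ T.Ω

/-- Membership in `H¹(Ω)` of a piecewise polynomial function. Inside a triangle its distributional
gradient is the classical one; so the distributional gradient on `Ω` is square integrable if and
only if it is the piecewise gradient. -/
def IsH1 (v : T.Broken) : Prop :=
  ∀ φ, T.IsTest φ → ∀ i : Fin 2,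
    ∑ K : T.triangles, ∫ x in hull K.1,
        eval x.ofLp (v K) * fderiv ℝ φ x (EuclideanSpace.single i 1)
      = -∑ K : T.triangles, ∫ x in hull K.1, eval x.ofLp (grad v K i) * φ x

/-- Membership in `H(div; Ω)` of a piecewise polynomial vector field. Inside a triangle its
distributional divergence is the classical one; so the distributional divergence on `Ω` is square
integrable if and only if it is the piecewise divergence. -/
def IsHdiv (τ : T.VectorField) : Prop :=
  ∀ φ, T.IsTest φ →
    ∑ K : T.triangles, ∫ x in hull K.1,
        ∑ i, eval x.ofLp (τ K i) * fderiv ℝ φ x (EuclideanSpace.single i 1)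
      = -∑ K : T.triangles, ∫ x in hull K.1, eval x.ofLp (div τ K) * φ x

/-- The Raviart-Thomas space `RT(T_h, k)`. -/
def RT (k : ℕ) (τ : T.VectorField) : Prop :=
  T.IsHdiv τ ∧ ∀ K, ∃ (p : Fin 2 → MvPolynomial (Fin 2) ℝ) (q : MvPolynomial (Fin 2) ℝ),
    (∀ i, p i ∈ restrictTotalDegree (Fin 2) ℝ k) ∧ q ∈ restrictTotalDegree (Fin 2) ℝ k ∧
      ∀ i, τ K i = p i + X i * q

/-! ### Traces, jumps, weighted averages on an edge `F` -/

/-- The normal of `F` points out of the triangle `K`. -/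
def PointsOut (F K : Finset Plane) : Prop := ∀ x ∈ K, ∀ a ∈ F, ⟪T.normal F, x - a⟫ ≤ 0

open Classical in
/-- The value of `h` at the triangle with edge `F` whose outward normal is the normal of `F`. -/
def minus (F : Finset Plane) (h : T.triangles → ℝ) : ℝ :=
  ∑ K : T.triangles, if F ⊆ K.1 ∧ T.PointsOut F K.1 then h K else 0

open Classical in
/-- The value of `h` at the other triangle with edge `F`; zero if `F` is a boundary edge. -/
def plus (F : Finset Plane) (h : T.triangles → ℝ) : ℝ :=
  ∑ K : T.triangles, if F ⊆ K.1 ∧ ¬ T.PointsOut F K.1 then h K else 0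

variable {T} in
/-- The jump `v⁻ - v⁺`, which is `v⁻` on a boundary edge. -/
def jump (v : T.Broken) (F : Finset Plane) (x : Plane) : ℝ :=
  T.minus F (fun K => eval x.ofLp (v K)) - T.plus F (fun K => eval x.ofLp (v K))

variable {T} in
/-- The value at `x` of the normal component of `τ` in the triangle `K`, for the normal of `F`. -/
def normalComp (τ : T.VectorField) (F : Finset Plane) (x : Plane) (K : T.triangles) : ℝ :=
  ∑ i, eval x.ofLp (τ K i) * T.normal F i

variable {T} in
/-- The normal trace of a field of `H(div; Ω)`, which is the same from both sides of `F`. -/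
def normalTrace (τ : T.VectorField) (F : Finset Plane) (x : Plane) : ℝ :=
  T.minus F (normalComp τ F x)

/-- The integral over the edge `F` with respect to arc length. -/
def edgeIntegral (F : Finset Plane) (h : Plane → ℝ) : ℝ :=
  ∫ x in hull F, h x ∂(Measure.hausdorffMeasure 1)

/-- A coefficient that is constant on each triangle. -/
abbrev Coeff := T.triangles → Matrix (Fin 2) (Fin 2) ℝ

/-- The maximal eigenvalue. -/
def maxEigenvalue (M : Matrix (Fin 2) (Fin 2) ℝ) : ℝ :=
  sSup {μ : ℝ | Module.End.HasEigenvalue (Matrix.toLin' M) μ}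

variable {T} in
/-- The piecewise polynomial vector field `A ∇ u`. -/
def coeffGrad (A : T.Coeff) (u : T.Broken) : T.VectorField :=
  fun K i => ∑ j, C (A K i j) * grad u K j

open Classical in
variable {T} in
/-- The weighted average of the normal component of `τ` on `F`; the weights are
`w⁺ = α⁻ / (α⁻ + α⁺)` and `w⁻ = α⁺ / (α⁻ + α⁺)` with `α` the maximal eigenvalue of `A`. -/
def weightedAverage (A : T.Coeff) (τ : T.VectorField) (F : Finset Plane) (x : Plane) : ℝ :=
  if T.IsBoundaryEdge F then T.minus F (normalComp τ F x)
  else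
    let αm := T.minus F (fun K => maxEigenvalue (A K))
    let αp := T.plus F (fun K => maxEigenvalue (A K))
    αm / (αm + αp) * T.plus F (normalComp τ F x) + αp / (αm + αp) * T.minus F (normalComp τ F x)

/-! ### The conforming finite element solution -/

/-- The conforming space of order `k` with zero trace on the Dirichlet boundary. -/
def CG₀ (k : ℕ) (v : T.Broken) : Prop :=
  T.DG k v ∧ T.IsH1 v ∧
    ∀ F ∈ T.dirichletEdges, ∀ x ∈ hull F, T.minus F (fun K => eval x.ofLp (v K)) = 0

variable {T} in
/-- `(f, v)`. -/
def load (f : Plane → ℝ) (v : T.Broken) : ℝ :=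
  ∑ K : T.triangles, ∫ x in hull K.1, f x * eval x.ofLp (v K)

variable {T} in
/-- `(p, v)` for piecewise polynomials. -/
def pairing (p v : T.Broken) : ℝ :=
  ∑ K : T.triangles, ∫ x in hull K.1, eval x.ofLp (p K) * eval x.ofLp (v K)

/-- `u` is the conforming finite element solution of order `k` of `-∇·(A∇u) = f`, with `u = 0` on
the Dirichlet edges and `-A∇u·n = g` on the Neumann edges. The Neumann datum is given edge by edge
as a polynomial. -/
def IsCGSolution (A : T.Coeff) (f : Plane → ℝ) (g : Finset Plane → MvPolynomial (Fin 2) ℝ)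
    (k : ℕ) (u : T.Broken) : Prop :=
  T.CG₀ k u ∧ ∀ v, T.CG₀ k v →
    ∑ K : T.triangles, ∫ x in hull K.1,
        ∑ i, eval x.ofLp (coeffGrad A u K i) * eval x.ofLp (grad v K i)
      = load f v - ∑ F ∈ T.neumannEdges, edgeIntegral F fun x =>
          eval x.ofLp (g F) * T.minus F (fun K => eval x.ofLp (v K))

/-- `σ` is the weighted averaging flux of index `l` of `u`. -/
def IsAveragedFlux (A : T.Coeff) (g : Finset Plane → MvPolynomial (Fin 2) ℝ) (u : T.Broken)
    (l : ℕ) (σ : T.VectorField) : Prop :=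
  T.RT l σ ∧
  (∀ F ∈ T.activeEdges, ∀ φ ∈ restrictTotalDegree (Fin 2) ℝ l,
    edgeIntegral F (fun x => normalTrace σ F x * eval x.ofLp φ)
      = -edgeIntegral F (fun x => weightedAverage A (coeffGrad A u) F x * eval x.ofLp φ)) ∧
  (∀ F ∈ T.neumannEdges, ∀ φ ∈ restrictTotalDegree (Fin 2) ℝ l,
    edgeIntegral F (fun x => normalTrace σ F x * eval x.ofLp φ)
      = edgeIntegral F (fun x => eval x.ofLp (g F) * eval x.ofLp φ)) ∧
  (1 ≤ l → ∀ K : T.triangles, ∀ ψ : Fin 2 → MvPolynomial (Fin 2) ℝ,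
    (∀ i, ψ i ∈ restrictTotalDegree (Fin 2) ℝ (l - 1)) →
      ∫ x in hull K.1, ∑ i, eval x.ofLp (σ K i) * eval x.ofLp (ψ i)
        = -∫ x in hull K.1, ∑ i, eval x.ofLp (coeffGrad A u K i) * eval x.ofLp (ψ i))

variable {T} in
/-- The averaging residual `(f - ∇·σ, v)` of the flux `σ`. -/
def residual (f : Plane → ℝ) (σ : T.VectorField) (v : T.Broken) : ℝ :=
  ∑ K : T.triangles, ∫ x in hull K.1, (f x - eval x.ofLp (div σ K)) * eval x.ofLp (v K)

/-! ### The correction spaces and the vertex patch problems -/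

/-- The fields of `RT(T_h, s)` with vanishing interior moments of degree `s - 1` (no condition if
`s = 0`) and with vanishing normal trace on the Neumann edges. -/
def RTRing (s : ℕ) (τ : T.VectorField) : Prop :=
  T.RT s τ ∧
  (1 ≤ s → ∀ K : T.triangles, ∀ ψ : Fin 2 → MvPolynomial (Fin 2) ℝ,
    (∀ i, ψ i ∈ restrictTotalDegree (Fin 2) ℝ (s - 1)) →
      ∫ x in hull K.1, ∑ i, eval x.ofLp (τ K i) * eval x.ofLp (ψ i) = 0) ∧
  ∀ F ∈ T.neumannEdges, ∀ x ∈ hull F, normalTrace τ F x = 0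

variable {T} in
/-- The bilinear form `∑_F ∫_F τ·n_F [v]` over all edges that are not Neumann edges. -/
def bform (τ : T.VectorField) (v : T.Broken) : ℝ :=
  ∑ F ∈ T.activeEdges, edgeIntegral F fun x => normalTrace τ F x * jump v F x

open Classical in
variable {T} in
/-- The same form with the sum over the edges that contain the vertex `z`. -/
def patchForm (z : Plane) (τ : T.VectorField) (v : T.Broken) : ℝ :=
  ∑ F ∈ T.activeEdges.filter (fun F => z ∈ F),
    edgeIntegral F fun x => normalTrace τ F x * jump v F x

/-- The star patch of `z` consists of the triangles that contain `z`. Functions on the patch are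
extended by zero. -/
def PatchDG (z : Plane) (s : ℕ) (v : T.Broken) : Prop :=
  T.DG s v ∧ ∀ K : T.triangles, z ∉ K.1 → v K = 0

/-- The patch flux space: supported in the star patch of `z`, and with vanishing normal trace on
the edges that do not contain `z`, in particular on all the edges opposite to `z`. -/
def PatchRT (z : Plane) (s : ℕ) (τ : T.VectorField) : Prop :=
  T.RTRing s τ ∧ (∀ K : T.triangles, z ∉ K.1 → τ K = 0) ∧
    ∀ F ∈ T.edges, z ∉ F → ∀ x ∈ hull F, normalTrace τ F x = 0

/-- The vertices of a triangle as an affine basis of the plane. -/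
def triangleBasis (K : T.triangles) : AffineBasis K.1 ℝ Plane where
  toFun := (↑)
  ind' := T.complex.indep (T.triangle_mem K)
  tot' := by
    rw [(T.complex.indep (T.triangle_mem K)).affineSpan_eq_top_iff_card_eq_finrank_add_one]
    simp [T.card_triangle K]

open Classical in
/-- The linear nodal function of the vertex `z`: on each triangle that contains `z` the barycentric
coordinate that belongs to `z`, and zero elsewhere. -/
def hat (z : Plane) : T.Broken := fun K =>
  if h : z ∈ K.1 then affinePoly ((T.triangleBasis K).coord ⟨z, h⟩) else 0

/-- `σ` solves the patch problem at `z`, with the residual of the flux `ρ`. -/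
def IsPatchSolution (f : Plane → ℝ) (ρ : T.VectorField) (z : Plane) (s : ℕ)
    (σ : T.VectorField) : Prop :=
  T.PatchRT z s σ ∧ ∀ v, T.PatchDG z s v → patchForm z σ v = residual f ρ (v * T.hat z)

/-- `τ` solves the homogeneous patch problem at `z`. -/
def IsPatchKernel (z : Plane) (s : ℕ) (τ : T.VectorField) : Prop :=
  T.PatchRT z s τ ∧ ∀ v, T.PatchDG z s v → patchForm z τ v = 0

open Classical in
variable {T} in
/-- `(A⁻¹ σ, τ)` on the star patch of `z`. -/
def energy (A : T.Coeff) (z : Plane) (σ τ : T.VectorField) : ℝ :=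
  ∑ K : T.triangles, if z ∈ K.1 then
    ∫ x in hull K.1,
      ((A K)⁻¹ *ᵥ (fun i => eval x.ofLp (σ K i))) ⬝ᵥ (fun i => eval x.ofLp (τ K i))
  else 0

variable {T} in
/-- The norm `‖A^{-1/2} σ‖` on the star patch of `z`. -/
def energyNorm (A : T.Coeff) (z : Plane) (σ : T.VectorField) : ℝ := Real.sqrt (energy A z σ σ)

variable {T} in
/-- `σ_z - λ_z σ_z^#` with `λ_z = (A⁻¹ σ_z, σ_z^#)`, where `σ_z = S z` and `σ_z^# = N z`. -/
def correctedFlux (A : T.Coeff) (S N : Plane → T.VectorField) (z : Plane) : T.VectorField :=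
  S z - energy A z (S z) (N z) • N z

open Classical in
variable {T} in
/-- The sum over all vertices of the corrected patch fluxes (interior vertices, and vertices shared
by two Dirichlet edges) and of the uncorrected ones (all other vertices). -/
def assembledFlux (A : T.Coeff) (S N : Plane → T.VectorField) : T.VectorField :=
  ∑ z ∈ T.starVertices, correctedFlux A S N z + ∑ z ∈ T.vertices \ T.starVertices, S z

end Mesh

end EARM

end

noncomputable section

/-! The correction space is an edge space. A Raviart–Thomas polynomial with vanishing interior
moments is determined by its normal traces, and these may be arbitrary polynomials of degree at most
s on the three sides (`eq_zero_of_mem_localRTRing`, `exists_localRTRing`). Since membership in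
H(div) means that normal components do not jump (`isHdiv_iff`), a patch flux at z amounts to a free
choice of a polynomial on each non-Neumann edge at z (`exists_patchRT`).

Kernel. Testing on one triangle K at z shows that the signed moments on its two sides at z cancel.
Composing the test polynomial with the projection that fixes one side and collapses the other to z
turns this into: each normal trace is a multiple of the polynomial representing evaluation at z
(`kernel_pair`, `kernel_edge`). The multiple is the total flux. Oriented counterclockwise around z,
it is the same on both sides of K, hence on all edges of the star, because the star is connected
through edges at z (`kernel_flux`, `star_induction`). So the kernel has dimension at most one. A
Neumann edge at z forces the flux to vanish; without such an edge any value is allowed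
(`exists_kernel`). A boundary vertex lies on exactly two boundary edges (`card_boundaryEdges_at`),
so the vertices outside `starVertices` are those with a Neumann edge.

Solvability. By the Fredholm alternative the right-hand side has to vanish on each v annihilated by
all patch fluxes. Such a v has no jump on the non-Neumann edges at z, so v times the hat function of
z is conforming, vanishes on the Dirichlet edges and has degree s + 1, which is at most the index of
the flux. Galerkin orthogonality gives residual zero (`exists_isPatchSolution`).

Assembly. The hat functions sum to one, so the patch solutions add up to a solution of the global
problem (`bform_sum`). The residual of an averaged flux, tested in degree s, does not depend on its
index (`residual_averagedFlux`), so passing from the index of the patch problems to k - 1 is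
harmless. On the correction space the edge form is the pairing with the divergence
(`bform_eq_pairing`), which yields local conservation. The minimization is a projection onto a unit
vector for the energy inner product (`energyNorm_lt`). -/

namespace EARM

/-! ### Integrals over segments and triangles in coordinates -/

theorem edgeIntegral_pair {a b : Plane} (hab : a ≠ b) (h : Plane → ℝ) :
    Mesh.edgeIntegral {a, b} h = ‖b - a‖ * ∫ t in (0 : ℝ)..1, h (AffineMap.lineMap a b t) := by
  have hL : 0 < ‖b - a‖ := norm_pos_iff.2 (sub_ne_zero.2 hab.symm)
  set L := ‖b - a‖ with hLdef
  set w : Plane := L⁻¹ • (b - a) with hw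
  have hwn : ‖w‖ = 1 := by
    rw [hw, norm_smul, norm_inv, norm_norm]; exact inv_mul_cancel₀ hL.ne'
  -- The unit speed parametrization is an isometry, so it carries one-dimensional Hausdorff measure
  -- on the line, which is Lebesgue measure, to arc length.
  have hiso : Isometry (fun t : ℝ => a + t • w) := by
    refine Isometry.of_dist_eq fun s t => ?_
    rw [dist_add_left, dist_eq_norm, ← sub_smul, norm_smul, hwn, mul_one, Real.dist_eq,
      Real.norm_eq_abs]
  have himg : (hull {a, b} : Set Plane) = (fun t : ℝ => a + t • w) '' Set.Icc 0 L := by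
    rw [hull]
    push_cast
    rw [convexHull_pair, segment_eq_image']
    ext x
    constructor
    · rintro ⟨t, ht, rfl⟩
      refine ⟨t * L, ⟨mul_nonneg ht.1 hL.le, ?_⟩, ?_⟩
      · nlinarith [ht.2]
      · simp only [hw, smul_smul]
        rw [mul_assoc, mul_inv_cancel₀ hL.ne', mul_one]
    · rintro ⟨t, ht, rfl⟩
      refine ⟨t * L⁻¹, ⟨mul_nonneg ht.1 (inv_nonneg.2 hL.le), ?_⟩, ?_⟩
      · rw [← div_eq_mul_inv, div_le_one hL]; exact ht.2
      · simp only [hw, smul_smul]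
  have hemb := hiso.isClosedEmbedding.measurableEmbedding
  have hmap := hiso.map_hausdorffMeasure (d := 1) (Or.inl zero_le_one)
  have hsub : (fun t : ℝ => a + t • w) '' Set.Icc 0 L ⊆ Set.range (fun t : ℝ => a + t • w) :=
    Set.image_subset_range _ _
  rw [Mesh.edgeIntegral, himg, ← Measure.restrict_restrict_of_subset hsub, ← hmap,
    hemb.setIntegral_map, Set.preimage_image_eq _ hiso.injective, hausdorffMeasure_real,
    integral_Icc_eq_integral_Ioc, ← intervalIntegral.integral_of_le hL.le]
  have := intervalIntegral.smul_integral_comp_mul_right (a := 0) (b := 1)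
    (fun t => h (a + t • w)) L
  rw [zero_mul, one_mul] at this
  rw [← this, smul_eq_mul]
  congr 1
  refine intervalIntegral.integral_congr fun t _ => ?_
  simp only [hw, smul_smul, AffineMap.lineMap_apply_module']
  rw [mul_assoc, mul_inv_cancel₀ hL.ne', mul_one, add_comm]

/-- The reference triangle. -/
def refTriangle : Set (ℝ × ℝ) := {p | 0 ≤ p.1 ∧ 0 ≤ p.2 ∧ p.1 + p.2 ≤ 1}

theorem isClosed_refTriangle : IsClosed refTriangle :=
  (isClosed_le continuous_const continuous_fst).inter
    ((isClosed_le continuous_const continuous_snd).inter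
      (isClosed_le (continuous_fst.add continuous_snd) continuous_const))

theorem isCompact_refTriangle : IsCompact refTriangle := by
  refine (isCompact_Icc.prod isCompact_Icc).of_isClosed_subset isClosed_refTriangle
    (s := Set.Icc (0 : ℝ) 1 ×ˢ Set.Icc (0 : ℝ) 1) ?_
  rintro ⟨s, t⟩ ⟨h1, h2, h3⟩
  simp only at h1 h2 h3
  exact ⟨⟨h1, by simp only; linarith⟩, ⟨h2, by simp only; linarith⟩⟩

/-- Fubini's theorem on the reference triangle. -/
theorem integral_refTriangle (h : ℝ × ℝ → ℝ) (hh : Continuous h) :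
    ∫ p in refTriangle, h p = ∫ t in (0 : ℝ)..1, ∫ s in (0 : ℝ)..(1 - t), h (s, t) := by
  have hint : Integrable (refTriangle.indicator h) (volume.prod volume) := by
    rw [integrable_indicator_iff isClosed_refTriangle.measurableSet]
    exact hh.continuousOn.integrableOn_compact isCompact_refTriangle
  rw [← integral_indicator isClosed_refTriangle.measurableSet, Measure.volume_eq_prod,
    integral_prod_symm _ hint, intervalIntegral.integral_of_le zero_le_one,
    ← integral_Icc_eq_integral_Ioc, ← integral_indicator measurableSet_Icc]
  congr 1
  ext t
  by_cases ht : t ∈ Set.Icc (0 : ℝ) 1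
  · rw [Set.indicator_of_mem ht, intervalIntegral.integral_of_le (by linarith [ht.2]),
      ← integral_Icc_eq_integral_Ioc, ← integral_indicator measurableSet_Icc]
    congr 1
    ext s
    have : (s, t) ∈ refTriangle ↔ s ∈ Set.Icc 0 (1 - t) :=
      ⟨fun h => ⟨h.1, by have := h.2.2; simp only at this; linarith⟩,
        fun h => ⟨h.1, ht.1, by have := h.2; simp only; linarith⟩⟩
    by_cases hs : s ∈ Set.Icc 0 (1 - t)
    · rw [Set.indicator_of_mem hs, Set.indicator_of_mem (this.2 hs)]
    · rw [Set.indicator_of_notMem hs, Set.indicator_of_notMem (mt this.1 hs)]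
  · rw [Set.indicator_of_notMem ht]
    have : ∀ s, refTriangle.indicator h (s, t) = 0 := fun s => by
      refine Set.indicator_of_notMem (fun hm => ht ⟨hm.2.1, ?_⟩) _
      have h1 := hm.1; have h2 := hm.2.2
      simp only at h1 h2; linarith
    simp [this]

theorem hull_triple (a u v : Plane) :
    convexHull ℝ {a, a + u, a + v} = (fun p : ℝ × ℝ => a + p.1 • u + p.2 • v) '' refTriangle := by
  rw [convexHull_insert (by simp), convexHull_pair]
  ext x
  simp only [mem_convexJoin, Set.mem_singleton_iff, exists_eq_left, segment_eq_image',
    Set.mem_image]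
  constructor
  · rintro ⟨y, ⟨t, ht, rfl⟩, r, hr, rfl⟩
    refine ⟨(r * (1 - t), r * t), ⟨mul_nonneg hr.1 (by linarith [ht.2]), mul_nonneg hr.1 ht.1, ?_⟩,
      ?_⟩
    · simp only; nlinarith [hr.2]
    · simp only; module
  · rintro ⟨⟨s, t⟩, ⟨h1, h2, h3⟩, rfl⟩
    simp only at h1 h2 h3 ⊢
    -- The ray from a through the point meets the opposite side at parameter t / (s + t), which
    -- makes no sense at the vertex a itself.
    rcases (add_nonneg h1 h2).eq_or_lt with h0 | h0
    · have hs : s = 0 := by linarith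
      have ht : t = 0 := by linarith
      exact ⟨a + u + (0 : ℝ) • (a + v - (a + u)), ⟨0, by simp, rfl⟩, 0, by simp, by simp [hs, ht]⟩
    · refine ⟨_, ⟨t / (s + t), ⟨by positivity, ?_⟩, rfl⟩, s + t, ⟨h0.le, h3⟩, ?_⟩
      · rw [div_le_one h0]; linarith
      · have : (s + t) * (t / (s + t)) = t := by field_simp
        have e : a + (s + t) • (a + u + (t / (s + t)) • (a + v - (a + u)) - a)
          = a + (s + t) • u + ((s + t) * (t / (s + t))) • (v - u) := by module
        rw [e, this]; module

/-- Change of variables: the triangle is the image of the reference triangle under an affine map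
with this Jacobian. -/
theorem integral_hull_triple (a u v : Plane) (huv : u 0 * v 1 - u 1 * v 0 ≠ 0) (g : Plane → ℝ) :
    ∫ x in convexHull ℝ {a, a + u, a + v}, g x
      = |u 0 * v 1 - u 1 * v 0| * ∫ p in refTriangle, g (a + p.1 • u + p.2 • v) := by
  let e : (ℝ × ℝ) ≃ᵐ Plane := (MeasurableEquiv.finTwoArrow).symm.trans
    (MeasurableEquiv.toLp 2 (Fin 2 → ℝ))
  have he : MeasurePreserving e volume volume :=
    ((volume_preserving_finTwoArrow ℝ).symm _).trans
      (EuclideanSpace.volume_preserving_symm_measurableEquiv_toLp (Fin 2)).symm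
  have he0 : ∀ p, e p 0 = p.1 := fun p => rfl
  have he1 : ∀ p, e p 1 = p.2 := fun p => rfl
  let M : Matrix (Fin 2) (Fin 2) ℝ := !![u 0, v 0; u 1, v 1]
  let L : Plane →ₗ[ℝ] Plane := Matrix.toLin (EuclideanSpace.basisFun (Fin 2) ℝ).toBasis
    (EuclideanSpace.basisFun (Fin 2) ℝ).toBasis M
  have hLdet : L.det = u 0 * v 1 - u 1 * v 0 := by
    simp only [L, LinearMap.det_toLin, M, Matrix.det_fin_two_of]; ring
  have hL : ∀ x, L x = x 0 • u + x 1 • v := by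
    intro x
    have hx : x = x 0 • EuclideanSpace.basisFun (Fin 2) ℝ 0
      + x 1 • EuclideanSpace.basisFun (Fin 2) ℝ 1 := by
      ext i; fin_cases i <;> simp
    have hb : ∀ j, L (EuclideanSpace.basisFun (Fin 2) ℝ j) = if j = 0 then u else v := by
      intro j
      have := Matrix.toLin_self (EuclideanSpace.basisFun (Fin 2) ℝ).toBasis
        (EuclideanSpace.basisFun (Fin 2) ℝ).toBasis M j
      simp only [OrthonormalBasis.coe_toBasis] at this
      rw [this]
      ext i; fin_cases j <;> fin_cases i <;> simp [M, Fin.sum_univ_two]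
    conv_lhs => rw [hx]
    rw [map_add, map_smul, map_smul, hb, hb]
    simp
  have hinj : Function.Injective L := by
    have : IsUnit L.det := by rw [hLdet]; exact huv.isUnit
    exact (LinearMap.equivOfDetNeZero L (by rw [hLdet]; exact huv)).injective
  let f : Plane → Plane := fun x => a + L x
  have hf : ∀ x, HasFDerivAt f (LinearMap.toContinuousLinearMap L) x := fun x =>
    (LinearMap.toContinuousLinearMap L).hasFDerivAt.const_add a
  have hset : convexHull ℝ {a, a + u, a + v} = f '' (e '' refTriangle) := by
    rw [hull_triple, Set.image_image]
    refine Set.image_congr fun p _ => ?_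
    simp only [f, hL, he0, he1, add_assoc]
  rw [hset, integral_image_eq_integral_abs_det_fderiv_smul volume
    (e.measurableSet_image.2 isClosed_refTriangle.measurableSet)
    (fun x _ => (hf x).hasFDerivWithinAt) (fun x _ y _ hxy => hinj (add_left_cancel hxy)),
    he.setIntegral_image_emb e.measurableEmbedding]
  simp only [ContinuousLinearMap.det, LinearMap.coe_toContinuousLinearMap, hLdet, smul_eq_mul]
  rw [integral_const_mul]
  simp only [f, hL, he0, he1, add_assoc]

/-- The direction u is the first reference coordinate, so the inner integral in Fubini's theorem is
evaluated by the fundamental theorem of calculus. Its end points run through the two sides that are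
not parallel to u. -/
theorem integral_fderiv_hull_triple (a u v : Plane) (huv : u 0 * v 1 - u 1 * v 0 ≠ 0)
    (G : Plane → ℝ) (hG : ContDiff ℝ 1 G) :
    ∫ x in convexHull ℝ {a, a + u, a + v}, fderiv ℝ G x u
      = |u 0 * v 1 - u 1 * v 0| * ((∫ t in (0 : ℝ)..1, G (AffineMap.lineMap (a + u) (a + v) t))
        - ∫ t in (0 : ℝ)..1, G (AffineMap.lineMap a (a + v) t)) := by
  have hcont : Continuous fun x => fderiv ℝ G x u :=
    (hG.continuous_fderiv one_ne_zero).clm_apply continuous_const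
  have hline : ∀ p q : Plane, IntervalIntegrable (fun t : ℝ => G (AffineMap.lineMap p q t))
      volume 0 1 := fun p q =>
    (hG.continuous.comp AffineMap.lineMap_continuous).intervalIntegrable _ _
  rw [integral_hull_triple a u v huv, integral_refTriangle (fun p => fderiv ℝ G (a + p.1 • u + p.2 • v) u)
      (hcont.comp (by fun_prop)),
    ← intervalIntegral.integral_sub (hline _ _) (hline _ _)]
  congr 1
  refine intervalIntegral.integral_congr fun t _ => ?_
  have hd : ∀ s : ℝ, HasDerivAt (fun s : ℝ => G (a + s • u + t • v))
      (fderiv ℝ G (a + s • u + t • v) u) s := by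
    intro s
    have h1 : HasDerivAt (fun s : ℝ => a + s • u + t • v) u s := by
      simpa using (((hasDerivAt_id s).smul_const u).const_add a).add_const (t • v)
    exact ((hG.differentiable one_ne_zero) _).hasFDerivAt.comp_hasDerivAt s h1
  simp only
  rw [intervalIntegral.integral_eq_sub_of_hasDerivAt (fun s _ => hd s)
    ((hcont.comp (f := fun s : ℝ => a + s • u + t • v) (by fun_prop)).intervalIntegrable _ _)]
  congr 2
  · rw [AffineMap.lineMap_apply_module']; module
  · rw [AffineMap.lineMap_apply_module']; module

/-! ### Polynomials in the plane -/

/-- Polynomials of total degree at most `s`. -/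
abbrev PolyLE (s : ℕ) : Submodule ℝ (MvPolynomial (Fin 2) ℝ) := restrictTotalDegree (Fin 2) ℝ s

theorem mem_polyLE {s : ℕ} {p : MvPolynomial (Fin 2) ℝ} : p ∈ PolyLE s ↔ p.totalDegree ≤ s :=
  mem_restrictTotalDegree _ _ _

theorem polyLE_mono {s t : ℕ} (h : s ≤ t) : PolyLE s ≤ PolyLE t := fun _ hp =>
  mem_polyLE.2 ((mem_polyLE.1 hp).trans h)

theorem mul_mem_polyLE {s t : ℕ} {p q : MvPolynomial (Fin 2) ℝ} (hp : p ∈ PolyLE s)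
    (hq : q ∈ PolyLE t) : p * q ∈ PolyLE (s + t) :=
  mem_polyLE.2 ((totalDegree_mul _ _).trans (add_le_add (mem_polyLE.1 hp) (mem_polyLE.1 hq)))

theorem C_mem_polyLE (s : ℕ) (c : ℝ) : (C c : MvPolynomial (Fin 2) ℝ) ∈ PolyLE s :=
  mem_polyLE.2 (by simp)

theorem one_mem_polyLE (s : ℕ) : (1 : MvPolynomial (Fin 2) ℝ) ∈ PolyLE s :=
  mem_polyLE.2 (by simp)

theorem C_mul_mem_polyLE {s : ℕ} {p : MvPolynomial (Fin 2) ℝ} (c : ℝ) (hp : p ∈ PolyLE s) :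
    C c * p ∈ PolyLE s := by
  rw [← smul_eq_C_mul]; exact Submodule.smul_mem _ _ hp

theorem X_mem_polyLE (i : Fin 2) : (X i : MvPolynomial (Fin 2) ℝ) ∈ PolyLE 1 :=
  mem_polyLE.2 (by simp)

theorem affinePoly_mem_polyLE (l : Plane →ᵃ[ℝ] ℝ) : affinePoly l ∈ PolyLE 1 :=
  Submodule.add_mem _ (C_mem_polyLE _ _) (Submodule.sum_mem _ fun i _ =>
    C_mul_mem_polyLE _ (X_mem_polyLE i))

theorem coeff_eq_zero_of_mem_polyLE {s : ℕ} {p : MvPolynomial (Fin 2) ℝ} (hp : p ∈ PolyLE s)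
    {d : Fin 2 →₀ ℕ} (hd : s < d.degree) : coeff d p = 0 := by
  by_contra h
  have := le_totalDegree (mem_support_iff.2 h)
  have h2 := mem_polyLE.1 hp
  rw [Finsupp.degree_apply] at hd
  simp only [Finsupp.sum] at this
  omega

theorem mem_polyLE_of_coeff {s : ℕ} {p : MvPolynomial (Fin 2) ℝ}
    (h : ∀ d : Fin 2 →₀ ℕ, s < d.degree → coeff d p = 0) : p ∈ PolyLE s := by
  refine mem_polyLE.2 (Finset.sup_le fun d hd => ?_)
  by_contra hlt
  refine mem_support_iff.1 hd (h d ?_)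
  rw [Finsupp.degree_apply]
  simpa only [Finsupp.sum, not_le] using hlt

theorem pderiv_mem_polyLE {s : ℕ} {p : MvPolynomial (Fin 2) ℝ} (hp : p ∈ PolyLE (s + 1))
    (i : Fin 2) : pderiv i p ∈ PolyLE s := by
  rw [p.as_sum, map_sum]
  refine Submodule.sum_mem _ fun d hd => ?_
  rw [pderiv_monomial]
  rcases Nat.eq_zero_or_pos (d i) with h0 | h0
  · simp [h0]
  · refine mem_polyLE.2 ((totalDegree_monomial_le _ _).trans ?_)
    have h1 := (le_totalDegree hd).trans (mem_polyLE.1 hp)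
    have h2 : (d - Finsupp.single i 1) + Finsupp.single i 1 = d :=
      tsub_add_cancel_of_le (Finsupp.single_le_iff.2 h0)
    have h3 : (d.sum fun _ e => e)
        = ((d - Finsupp.single i 1).sum fun _ e => e) + 1 := by
      conv_lhs => rw [← h2]
      rw [Finsupp.sum_add_index' (by simp) (by simp)]
      simp
    rw [h3] at h1
    exact Nat.le_of_succ_le_succ h1

theorem pderiv_eq_zero_of_mem_polyLE {p : MvPolynomial (Fin 2) ℝ} (hp : p ∈ PolyLE 0)
    (i : Fin 2) : pderiv i p = 0 := by
  rw [totalDegree_eq_zero_iff_eq_C.1 (Nat.le_zero.1 (mem_polyLE.1 hp)), pderiv_C]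

theorem aeval_mem_polyLE {s : ℕ} {p : MvPolynomial (Fin 2) ℝ} (hp : p ∈ PolyLE s)
    {q : Fin 2 → MvPolynomial (Fin 2) ℝ} (hq : ∀ i, q i ∈ PolyLE 1) : aeval q p ∈ PolyLE s := by
  rw [aeval_def, eval₂_eq']
  refine Submodule.sum_mem _ fun d hd => ?_
  refine C_mul_mem_polyLE _ (mem_polyLE.2 ((totalDegree_finsetProd _ _).trans ?_))
  have h1 := (le_totalDegree hd).trans (mem_polyLE.1 hp)
  rw [Finsupp.sum_fintype _ _ (by simp)] at h1
  refine le_trans (Finset.sum_le_sum fun i _ => ?_) h1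
  have := mem_polyLE.1 (hq i)
  exact (totalDegree_pow _ _).trans (by nlinarith)

/-- The operators x_i ∂_i are diagonal on monomials. This makes the leading coefficients of the
divergence of x q computable. -/
theorem coeff_X_mul_pderiv (p : MvPolynomial (Fin 2) ℝ) (i : Fin 2) (d : Fin 2 →₀ ℕ) :
    coeff d (X i * pderiv i p) = d i * coeff d p := by
  induction p using MvPolynomial.induction_on' with
  | add p q hp hq => simp only [map_add, mul_add, coeff_add, hp, hq]
  | monomial e a =>
    rw [pderiv_monomial, coeff_monomial]
    rcases Nat.eq_zero_or_pos (e i) with h0 | h0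
    · by_cases hed : e = d
      · simp [← hed, h0]
      · simp [h0, hed]
    · have h2 : Finsupp.single i 1 + (e - Finsupp.single i 1) = e :=
        add_tsub_cancel_of_le (Finsupp.single_le_iff.2 h0)
      rw [X, monomial_mul, h2, coeff_monomial, one_mul]
      by_cases hed : e = d
      · simp [hed, mul_comm]
      · simp [hed]

/-! ### Polynomials as functions on the plane -/

@[fun_prop]
theorem continuous_eval_ofLp (p : MvPolynomial (Fin 2) ℝ) :
    Continuous fun x : Plane => eval x.ofLp p :=
  (MvPolynomial.continuous_eval p).comp (PiLp.continuous_ofLp 2 _)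

theorem hasFDerivAt_eval (p : MvPolynomial (Fin 2) ℝ) (x : Plane) :
    HasFDerivAt (fun x : Plane => eval x.ofLp p)
      (∑ i : Fin 2, eval x.ofLp (pderiv i p) • (EuclideanSpace.proj i : Plane →L[ℝ] ℝ)) x := by
  induction p using MvPolynomial.induction_on with
  | C a => simpa using hasFDerivAt_const a x
  | add p q hp hq =>
    simp only [map_add, add_smul, Finset.sum_add_distrib]
    exact hp.add hq
  | mul_X p j hp =>
    have h1 : HasFDerivAt (fun x : Plane => x j) (EuclideanSpace.proj j : Plane →L[ℝ] ℝ) x :=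
      (EuclideanSpace.proj j : Plane →L[ℝ] ℝ).hasFDerivAt
    have h2 := hp.mul h1
    simp only [map_mul, eval_X]
    refine h2.congr_fderiv ?_
    simp only [Derivation.leibniz, smul_eq_mul, map_add, map_mul, eval_X, add_smul,
      Finset.sum_add_distrib, Finset.smul_sum, pderiv_X, mul_smul]
    congr 1
    simp only [Fin.sum_univ_two]
    fin_cases j <;> simp

@[fun_prop]
theorem contDiff_eval_ofLp (p : MvPolynomial (Fin 2) ℝ) {n : WithTop ℕ∞} :
    ContDiff ℝ n fun x : Plane => eval x.ofLp p := by
  induction p using MvPolynomial.induction_on with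
  | C a => simpa using contDiff_const
  | add p q hp hq => simpa using hp.add hq
  | mul_X p j hp =>
    simp only [map_mul, eval_X]
    exact hp.mul (EuclideanSpace.proj j : Plane →L[ℝ] ℝ).contDiff

theorem fderiv_eval_single (p : MvPolynomial (Fin 2) ℝ) (x : Plane) (i : Fin 2) :
    fderiv ℝ (fun x : Plane => eval x.ofLp p) x (EuclideanSpace.single i 1)
      = eval x.ofLp (pderiv i p) := by
  rw [(hasFDerivAt_eval p x).fderiv]
  simp only [Fin.sum_univ_two]
  fin_cases i <;> simp

/-- An open set contains a product of infinite sets, and a polynomial that vanishes on such a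
product is zero. -/
theorem eq_zero_of_eval_eq_zero {p : MvPolynomial (Fin 2) ℝ} {U : Set Plane} (hU : IsOpen U)
    (hne : U.Nonempty) (h : ∀ x ∈ U, eval x.ofLp p = 0) : p = 0 := by
  obtain ⟨x, hx⟩ := hne
  have hU' : IsOpen ((WithLp.toLp 2) ⁻¹' U : Set (Fin 2 → ℝ)) :=
    hU.preimage (PiLp.continuous_toLp 2 _)
  obtain ⟨ε, hε, hb⟩ := Metric.isOpen_iff.1 hU' x.ofLp hx
  refine funext_set (fun i => Metric.ball (x i) ε) (fun i => ?_) fun y hy => ?_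
  · exact infinite_of_mem_nhds (x i) (Metric.ball_mem_nhds _ hε)
  · rw [map_zero]
    refine h (WithLp.toLp 2 y) (hb ?_)
    rw [Metric.mem_ball, dist_pi_lt_iff hε]
    exact fun i => hy i trivial

/-! ### Integrals over simplices -/

theorem isCompact_hull (S : Finset Plane) : IsCompact (hull S) :=
  S.finite_toSet.isCompact_convexHull ℝ

theorem integrableOn_hull (S : Finset Plane) {h : Plane → ℝ} (hh : Continuous h) :
    IntegrableOn h (hull S) :=
  hh.continuousOn.integrableOn_compact (isCompact_hull S)

theorem eqOn_zero_of_integral_sq_eq_zero {S : Finset Plane} (hS : (interior (hull S)).Nonempty)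
    {h : Plane → ℝ} (hh : Continuous h) (hz : ∫ x in hull S, h x * h x = 0) :
    ∀ x ∈ hull S, h x = 0 := by
  rw [setIntegral_eq_zero_iff_of_nonneg_ae (Filter.Eventually.of_forall fun x =>
    mul_self_nonneg (h x)) (integrableOn_hull S (hh.mul hh))] at hz
  -- An almost everywhere identity between continuous functions holds everywhere on a set that lies
  -- in the closure of its interior.
  have hcl : hull S ⊆ closure (interior (hull S)) := by
    rw [(convex_convexHull ℝ _).closure_interior_eq_closure_of_nonempty_interior hS]
    exact subset_closure
  intro x hx
  exact mul_self_eq_zero.1 (Measure.eqOn_of_ae_eq (f := fun x => h x * h x) (g := 0) hz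
    (hh.mul hh).continuousOn continuousOn_const hcl hx)

/-! ### Calculus of edge integrals -/

namespace Mesh

theorem edgeIntegral_congr {F : Finset Plane} {h h' : Plane → ℝ} (H : ∀ x ∈ hull F, h x = h' x) :
    edgeIntegral F h = edgeIntegral F h' :=
  setIntegral_congr_fun (isCompact_hull F).measurableSet H

theorem edgeIntegral_const_mul (F : Finset Plane) (c : ℝ) (h : Plane → ℝ) :
    edgeIntegral F (fun x => c * h x) = c * edgeIntegral F h :=
  integral_const_mul _ _

theorem edgeIntegral_zero (F : Finset Plane) : edgeIntegral F (fun _ => 0) = 0 :=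
  integral_zero _ _

theorem edgeIntegral_neg (F : Finset Plane) (h : Plane → ℝ) :
    edgeIntegral F (fun x => -h x) = -edgeIntegral F h :=
  integral_neg _

theorem edgeIntegral_add {F : Finset Plane} (hF : F.card = 2) {h h' : Plane → ℝ}
    (hh : Continuous h) (hh' : Continuous h') :
    edgeIntegral F (fun x => h x + h' x) = edgeIntegral F h + edgeIntegral F h' := by
  obtain ⟨a, b, hab, rfl⟩ := Finset.card_eq_two.1 hF
  simp only [edgeIntegral_pair hab]
  rw [intervalIntegral.integral_add, mul_add]
  · exact (hh.comp AffineMap.lineMap_continuous).intervalIntegrable _ _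
  · exact (hh'.comp AffineMap.lineMap_continuous).intervalIntegrable _ _

theorem edgeIntegral_sub {F : Finset Plane} (hF : F.card = 2) {h h' : Plane → ℝ}
    (hh : Continuous h) (hh' : Continuous h') :
    edgeIntegral F (fun x => h x - h' x) = edgeIntegral F h - edgeIntegral F h' := by
  simp only [sub_eq_add_neg]
  rw [edgeIntegral_add (h' := fun x => -h' x) hF hh hh'.neg, edgeIntegral_neg]

theorem edgeIntegral_sum {F : Finset Plane} (hF : F.card = 2) {ι : Type*} (S : Finset ι)
    {h : ι → Plane → ℝ} (hh : ∀ i, Continuous (h i)) :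
    edgeIntegral F (fun x => ∑ i ∈ S, h i x) = ∑ i ∈ S, edgeIntegral F (h i) := by
  classical
  induction S using Finset.induction_on with
  | empty => simpa using edgeIntegral_zero F
  | insert a S ha ih =>
    simp only [Finset.sum_insert ha]
    rw [edgeIntegral_add hF (hh a) (continuous_finsetSum _ fun i _ => hh i), ih]

theorem eqOn_zero_of_edgeIntegral_eq_zero {F : Finset Plane} (hF : F.card = 2) {h : Plane → ℝ}
    (hh : Continuous h) (h0 : ∀ x ∈ hull F, 0 ≤ h x) (hz : edgeIntegral F h = 0) :
    ∀ x ∈ hull F, h x = 0 := by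
  obtain ⟨a, b, hab, rfl⟩ := Finset.card_eq_two.1 hF
  have hseg : (hull {a, b} : Set Plane) = AffineMap.lineMap a b '' Set.Icc (0 : ℝ) 1 := by
    rw [← segment_eq_image_lineMap, ← convexHull_pair]
    simp [hull]
  rw [edgeIntegral_pair hab] at hz
  have hL : ‖b - a‖ ≠ 0 := (norm_pos_iff.2 (sub_ne_zero.2 hab.symm)).ne'
  have hz' := (mul_eq_zero.1 hz).resolve_left hL
  rw [hseg] at h0 ⊢
  rintro _ ⟨t, ht, rfl⟩
  by_contra hne
  refine (intervalIntegral.integral_pos zero_lt_one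
    (hh.comp AffineMap.lineMap_continuous).continuousOn
    (fun r hr => h0 _ ⟨r, ⟨hr.1.le, hr.2⟩, rfl⟩)
    ⟨t, ht, (h0 _ ⟨t, ht, rfl⟩).lt_of_ne' hne⟩).ne' hz'

end Mesh

namespace Mesh

variable (T : Mesh)

/-! ### Barycentric coordinates -/

open Classical in
/-- The barycentric coordinate of the vertex `z` in the triangle `K`; zero if `z` is no vertex
of `K`. -/
def bary (K : T.triangles) (z : Plane) : Plane →ᵃ[ℝ] ℝ :=
  if h : z ∈ K.1 then (T.triangleBasis K).coord ⟨z, h⟩ else 0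

variable {T}

theorem eval_hat (K : T.triangles) (z x : Plane) : eval x.ofLp (T.hat z K) = T.bary K z x := by
  unfold hat bary
  split_ifs with h
  · exact eval_affinePoly _ _
  · simp

theorem hat_of_notMem {K : T.triangles} {z : Plane} (h : z ∉ K.1) : T.hat z K = 0 := dif_neg h

theorem hat_mem_polyLE (K : T.triangles) (z : Plane) : T.hat z K ∈ PolyLE 1 := by
  unfold hat
  split_ifs
  · exact affinePoly_mem_polyLE _
  · exact Submodule.zero_mem _

theorem bary_of_mem {K : T.triangles} {z : Plane} (h : z ∈ K.1) :
    T.bary K z = (T.triangleBasis K).coord ⟨z, h⟩ := dif_pos h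

theorem bary_self {K : T.triangles} {z : Plane} (h : z ∈ K.1) : T.bary K z z = 1 := by
  rw [bary_of_mem h]
  exact (T.triangleBasis K).coord_apply_eq ⟨z, h⟩

theorem bary_of_ne {K : T.triangles} {z y : Plane} (hy : y ∈ K.1) (hyz : y ≠ z) :
    T.bary K z y = 0 := by
  by_cases h : z ∈ K.1
  · rw [bary_of_mem h]
    exact (T.triangleBasis K).coord_apply_ne (i := ⟨z, h⟩) (j := ⟨y, hy⟩)
      (fun h => hyz (congrArg Subtype.val h).symm)
  · simp [bary, h]

theorem continuous_bary (K : T.triangles) (z : Plane) : Continuous (T.bary K z) :=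
  (T.bary K z).continuous_of_finiteDimensional

theorem sum_bary (K : T.triangles) (x : Plane) : ∑ z ∈ K.1, T.bary K z x = 1 := by
  rw [← Finset.sum_attach, ← (T.triangleBasis K).sum_coord_apply_eq_one x, ← Finset.attach_eq_univ]
  exact Finset.sum_congr rfl fun z _ => by rw [bary_of_mem z.2]

theorem sum_bary_smul (K : T.triangles) (x : Plane) : ∑ z ∈ K.1, T.bary K z x • z = x := by
  conv_rhs => rw [← (T.triangleBasis K).linear_combination_coord_eq_self x]
  rw [← Finset.sum_attach, ← Finset.attach_eq_univ]
  exact Finset.sum_congr rfl fun z _ => by rw [bary_of_mem z.2]; rfl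

theorem range_triangleBasis (K : T.triangles) :
    Set.range (T.triangleBasis K) = (K.1 : Set Plane) := Subtype.range_coe

theorem mem_hull_iff (K : T.triangles) (x : Plane) :
    x ∈ hull K.1 ↔ ∀ z ∈ K.1, 0 ≤ T.bary K z x := by
  rw [hull, ← range_triangleBasis, (T.triangleBasis K).convexHull_eq_nonneg_coord]
  exact ⟨fun h z hz => by rw [bary_of_mem hz]; exact h _,
    fun h z => by rw [← bary_of_mem z.2]; exact h _ z.2⟩

theorem mem_interior_hull_iff (K : T.triangles) (x : Plane) :
    x ∈ interior (hull K.1) ↔ ∀ z ∈ K.1, 0 < T.bary K z x := by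
  rw [hull, ← range_triangleBasis, (T.triangleBasis K).interior_convexHull]
  exact ⟨fun h z hz => by rw [bary_of_mem hz]; exact h _,
    fun h z => by rw [← bary_of_mem z.2]; exact h _ z.2⟩

theorem interior_hull_nonempty (K : T.triangles) : (interior (hull K.1)).Nonempty := by
  have := (T.triangleBasis K).centroid_mem_interior_convexHull
  rw [range_triangleBasis] at this
  exact ⟨_, this⟩

theorem closure_interior_hull (K : T.triangles) : closure (interior (hull K.1)) = hull K.1 := by
  rw [(convex_convexHull ℝ _).closure_interior_eq_closure_of_nonempty_interior
    (interior_hull_nonempty K)]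
  exact (isCompact_hull _).isClosed.closure_eq

theorem mem_hull_subset_iff {K : T.triangles} {S : Finset Plane} (hS : S ⊆ K.1) {x : Plane}
    (hx : x ∈ hull K.1) : x ∈ hull S ↔ ∀ z ∈ K.1, z ∉ S → T.bary K z x = 0 := by
  constructor
  · intro h z hz hzS
    have : (S : Set Plane) ⊆ (T.bary K z) ⁻¹' {0} := fun y hy =>
      bary_of_ne (hS hy) (fun h => hzS (h ▸ hy))
    exact convexHull_min this ((convex_singleton 0).affine_preimage _) h
  · intro h
    have h1 : ∑ z ∈ S, T.bary K z x = 1 := by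
      rw [← sum_bary K x]; exact Finset.sum_subset hS h
    have h2 : ∑ z ∈ S, T.bary K z x • z = x := by
      conv_rhs => rw [← sum_bary_smul K x]
      exact Finset.sum_subset hS fun z hz hzS => by rw [h z hz hzS, zero_smul]
    rw [← h2]
    exact (convex_convexHull ℝ _).sum_mem (fun z hz => (mem_hull_iff K x).1 hx z (hS hz)) h1
      fun z hz => subset_convexHull ℝ _ hz

/-! ### Edges -/

theorem mem_edges {F : Finset Plane} : F ∈ T.edges ↔ F ∈ T.complex.faces ∧ F.card = 2 := by
  simp [edges]

theorem mem_triangles {K : Finset Plane} :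
    K ∈ T.triangles ↔ K ∈ T.complex.faces ∧ K.card = 3 := by
  simp [triangles]

theorem exists_triangle_of_face {F : Finset Plane} (hF : F ∈ T.complex.faces) :
    ∃ K : T.triangles, F ⊆ K.1 := by
  obtain ⟨K, hK, hFK, hc⟩ := T.pure F hF
  exact ⟨⟨K, mem_triangles.2 ⟨hK, hc⟩⟩, hFK⟩

theorem mem_edges_of_subset {K : T.triangles} {F : Finset Plane} (hF : F ⊆ K.1)
    (hc : F.card = 2) : F ∈ T.edges :=
  mem_edges.2 ⟨T.complex.down_closed (T.triangle_mem K) hF (Finset.card_pos.1 (by omega)), hc⟩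

open Classical in
theorem card_erase_triangle (K : T.triangles) {c : Plane} (hc : c ∈ K.1) :
    (K.1.erase c).card = 2 := by
  rw [Finset.card_erase_of_mem hc, T.card_triangle K]

open Classical in
theorem erase_mem_edges (K : T.triangles) {c : Plane} (hc : c ∈ K.1) : K.1.erase c ∈ T.edges :=
  mem_edges_of_subset (Finset.erase_subset _ _) (card_erase_triangle K hc)

open Classical in
theorem exists_eq_erase {K : T.triangles} {F : Finset Plane} (hF : F ∈ T.edges) (hFK : F ⊆ K.1) :
    ∃ c ∈ K.1, F = K.1.erase c := by
  have h1 : (K.1 \ F).card = 1 := by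
    rw [Finset.card_sdiff_of_subset hFK, T.card_triangle K, (mem_edges.1 hF).2]
  obtain ⟨c, hc⟩ := Finset.card_eq_one.1 h1
  have hcm : c ∈ K.1 \ F := by rw [hc]; exact Finset.mem_singleton_self c
  refine ⟨c, (Finset.mem_sdiff.1 hcm).1, ?_⟩
  rw [Finset.erase_eq, ← hc, Finset.sdiff_sdiff_eq_self hFK]

open Classical in
-- Sides correspond to opposite vertices. Local arguments index by vertices, global sums by edges,
-- and this passes between the two.
theorem sum_erase (K : T.triangles) (h : Finset Plane → ℝ) :
    ∑ c ∈ K.1, h (K.1.erase c) = ∑ F ∈ T.edges.filter (· ⊆ K.1), h F := by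
  have himg : T.edges.filter (· ⊆ K.1) = K.1.image fun c => K.1.erase c := by
    ext F
    simp only [Finset.mem_filter, Finset.mem_image]
    constructor
    · rintro ⟨hF, hFK⟩
      obtain ⟨c, hc, rfl⟩ := exists_eq_erase hF hFK
      exact ⟨c, hc, rfl⟩
    · rintro ⟨c, hc, rfl⟩
      exact ⟨erase_mem_edges K hc, Finset.erase_subset _ _⟩
  rw [himg, Finset.sum_image (Finset.erase_injOn K.1)]

/-! ### Normals -/

variable (T) in
open Classical in
/-- The sign that makes the normal of `F` an outward normal of `K`. -/
def sgn (F K : Finset Plane) : ℝ := if T.PointsOut F K then 1 else -1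

theorem sgn_mul_self (F K : Finset Plane) : T.sgn F K * T.sgn F K = 1 := by
  unfold sgn; split_ifs <;> norm_num

theorem sgn_ne_zero (F K : Finset Plane) : T.sgn F K ≠ 0 := by
  unfold sgn; split_ifs <;> norm_num

open Classical in
theorem minus_sub_plus (F : Finset Plane) (h : T.triangles → ℝ) :
    T.minus F h - T.plus F h = ∑ K : T.triangles, if F ⊆ K.1 then T.sgn F K.1 * h K else 0 := by
  rw [minus, plus, ← Finset.sum_sub_distrib]
  refine Finset.sum_congr rfl fun K _ => ?_
  by_cases h1 : F ⊆ K.1 <;> by_cases h2 : T.PointsOut F K.1 <;> simp [h1, h2, sgn]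

open Classical in
/-- The signed distance to the line through an edge of a triangle is a multiple of the barycentric
coordinate of the opposite vertex. -/
theorem exists_height (K : T.triangles) {c : Plane} (hc : c ∈ K.1) :
    ∃ κ > 0, ∀ x, ∀ a ∈ K.1.erase c,
      ⟪T.normal (K.1.erase c), x - a⟫ = -(T.sgn (K.1.erase c) K.1 * κ) * T.bary K c x := by
  set F := K.1.erase c with hF
  obtain ⟨hFf, hFc⟩ := mem_edges.1 (erase_mem_edges K hc)
  obtain ⟨a, ha⟩ : F.Nonempty := Finset.card_pos.1 (by rw [hFc]; norm_num)
  have hperp := T.normal_perp F hFf hFc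
  have key : ∀ x, ∀ b ∈ F, ⟪T.normal F, x - b⟫ = ⟪T.normal F, c - a⟫ * T.bary K c x := by
    intro x b hb
    have h1 : x - b = ∑ z ∈ K.1, T.bary K z x • (z - b) := by
      simp only [smul_sub, Finset.sum_sub_distrib]
      rw [sum_bary_smul, ← Finset.sum_smul, sum_bary, one_smul]
    rw [h1, inner_sum, ← Finset.add_sum_erase _ _ hc, Finset.sum_eq_zero, add_zero,
      inner_smul_right]
    · have : c - b = (c - a) + (a - b) := by abel
      rw [this, inner_add_right, hperp a ha b hb, add_zero, mul_comm]
    · intro z hz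
      rw [inner_smul_right, hperp z hz b hb, mul_zero]
  set κ := ⟪T.normal F, c - a⟫ with hκ
  -- If κ were zero, the normal would be orthogonal to every vector, itself included.
  have hκ0 : κ ≠ 0 := by
    intro h0
    have : ⟪T.normal F, T.normal F⟫ = 0 := by
      have := key (T.normal F + a) a ha
      rwa [add_sub_cancel_right, h0, zero_mul] at this
    have h1 := T.norm_normal F hFf hFc
    rw [inner_self_eq_zero] at this
    rw [this, norm_zero] at h1
    exact zero_ne_one h1
  have hpo : T.PointsOut F K.1 ↔ κ < 0 := by
    constructor
    · intro h
      exact lt_of_le_of_ne (h c hc a ha) hκ0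
    · intro h x hx b hb
      rw [key x b hb]
      have : 0 ≤ T.bary K c x := (mem_hull_iff K x).1 (subset_convexHull ℝ _ hx) c hc
      nlinarith
  refine ⟨|κ|, abs_pos.2 hκ0, fun x b hb => ?_⟩
  rw [key x b hb]
  unfold sgn
  split_ifs with h
  · rw [abs_of_neg (hpo.1 h)]; ring
  · rw [abs_of_nonneg (not_lt.1 (mt hpo.2 h))]; ring

/-! ### The divergence theorem on a triangle -/

/-- Base times height: both sides are the area of the parallelogram spanned by e and d. -/
theorem norm_mul_abs_inner {n e d : Plane} (hn : ‖n‖ = 1) (hne : ⟪n, e⟫ = 0) :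
    ‖e‖ * |⟪n, d⟫| = |e 0 * d 1 - e 1 * d 0| := by
  have hin : ∀ x y : Plane, ⟪x, y⟫ = x 0 * y 0 + x 1 * y 1 := fun x y => by
    simp [PiLp.inner_apply, Fin.sum_univ_two, mul_comm]
  have h1 : n 0 * n 0 + n 1 * n 1 = 1 := by
    rw [← hin, real_inner_self_eq_norm_sq, hn, one_pow]
  have h2 : n 0 * e 0 + n 1 * e 1 = 0 := by rw [← hin, hne]
  have h3 : ‖e‖ ^ 2 = e 0 * e 0 + e 1 * e 1 := by rw [← hin, real_inner_self_eq_norm_sq]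
  have h4 : ⟪n, d⟫ = n 0 * d 0 + n 1 * d 1 := hin _ _
  rw [← abs_of_nonneg (norm_nonneg e), ← abs_mul, ← sq_eq_sq_iff_abs_eq_abs, mul_pow, h3, h4]
  -- The vector e is a multiple of n turned by a right angle; the factor is named t below.
  have e0 : e 0 = -(e 1 * n 0 - e 0 * n 1) * n 1 := by
    linear_combination (-e 0) * h1 + n 0 * h2
  have e1 : e 1 = (e 1 * n 0 - e 0 * n 1) * n 0 := by
    linear_combination (-e 1) * h1 + n 1 * h2
  generalize e 1 * n 0 - e 0 * n 1 = t at e0 e1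
  rw [e0, e1]
  linear_combination (t ^ 2 * (n 0 * d 0 + n 1 * d 1) ^ 2) * h1

open Classical in
-- The coordinate of a vanishes at b, so its sign at b + w tells whether w points into the triangle
-- across the side bc. The length of that side times the normal component of w is a determinant, the
-- Jacobian of the reference map.
theorem edgeIntegral_erase_mul_height (K : T.triangles) {a b c : Plane} (hK : K.1 = {a, b, c})
    (hab : a ≠ b) (hac : a ≠ c) (hbc : b ≠ c) (w : Plane) (hw : T.bary K a (b + w) ≠ 0) :
    0 < |(c - b) 0 * w 1 - (c - b) 1 * w 0| ∧ ∀ G : Plane → ℝ,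
      T.sgn (K.1.erase a) K.1 * ⟪T.normal (K.1.erase a), w⟫ * edgeIntegral (K.1.erase a) G
        = -SignType.sign (T.bary K a (b + w)) * (|(c - b) 0 * w 1 - (c - b) 1 * w 0|
          * ∫ t in (0 : ℝ)..1, G (AffineMap.lineMap b c t)) := by
  have haK : a ∈ K.1 := by simp [hK]
  have hE : K.1.erase a = {b, c} := by
    rw [hK]; ext x; simp only [Finset.mem_erase, Finset.mem_insert, Finset.mem_singleton]; grind
  obtain ⟨κ, hκ, hh⟩ := exists_height K haK
  obtain ⟨hFf, hFc⟩ := mem_edges.1 (erase_mem_edges K haK)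
  have hbF : b ∈ K.1.erase a := by simp [hE]
  have hcF : c ∈ K.1.erase a := by simp [hE]
  have h1 := hh (b + w) b hbF
  rw [add_sub_cancel_left] at h1
  have h2 := norm_mul_abs_inner (d := w) (T.norm_normal _ hFf hFc)
    (T.normal_perp _ hFf hFc c hcF b hbF)
  have hs := sgn_mul_self (T := T) (K.1.erase a) K.1
  rw [← h2]
  have hn : 0 < ‖c - b‖ := norm_pos_iff.2 (sub_ne_zero.2 hbc.symm)
  have hin : ⟪T.normal (K.1.erase a), w⟫ ≠ 0 := by
    rw [h1]
    exact mul_ne_zero (neg_ne_zero.2 (mul_ne_zero (sgn_ne_zero _ _) hκ.ne')) hw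
  refine ⟨mul_pos hn (abs_pos.2 hin), fun G => ?_⟩
  have h3 : T.sgn (K.1.erase a) K.1 * ⟪T.normal (K.1.erase a), w⟫
      = -SignType.sign (T.bary K a (b + w)) * |⟪T.normal (K.1.erase a), w⟫| := by
    have habs : |⟪T.normal (K.1.erase a), w⟫| = κ * |T.bary K a (b + w)| := by
      rw [h1, abs_mul, abs_neg, abs_mul, abs_of_pos hκ]
      have : |T.sgn (K.1.erase a) K.1| = 1 := by unfold sgn; split_ifs <;> simp
      rw [this, one_mul]
    rw [habs, h1]
    have := sign_mul_abs (T.bary K a (b + w))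
    linear_combination (-κ * T.bary K a (b + w)) * hs + κ * this
  rw [h3, hE, edgeIntegral_pair hbc]
  ring

open Classical in
-- A direction parallel to a side has no flux through that side and enters with opposite signs on
-- the other two, which are the two line integrals of `integral_fderiv_hull_triple`.
theorem integral_fderiv_triangle_edge (K : T.triangles) {a b c : Plane} (hK : K.1 = {a, b, c})
    (hab : a ≠ b) (hac : a ≠ c) (hbc : b ≠ c) {G : Plane → ℝ} (hG : ContDiff ℝ 1 G) :
    ∫ x in hull K.1, fderiv ℝ G x (b - a)
      = ∑ z ∈ K.1, T.sgn (K.1.erase z) K.1 * ⟪T.normal (K.1.erase z), b - a⟫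
          * edgeIntegral (K.1.erase z) G := by
  have haK : a ∈ K.1 := by simp [hK]
  have hbK : b ∈ K.1 := by simp [hK]
  have hcK : c ∈ K.1 := by simp [hK]
  have ha1 : T.bary K a (b + (b - a)) = -1 := by
    have := (T.bary K a).map_vadd b (b - a)
    have h2 := (T.bary K a).linearMap_vsub b a
    simp only [vadd_eq_add, vsub_eq_sub] at this h2
    rw [add_comm b, this, h2, bary_self haK, bary_of_ne hbK hab.symm]; norm_num
  have hb1 : T.bary K b (a + (b - a)) = 1 := by
    rw [add_sub_cancel, bary_self hbK]
  have hKb : K.1 = {b, a, c} := by rw [hK, Finset.insert_comm]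
  obtain ⟨-, h1⟩ := edgeIntegral_erase_mul_height K hK hab hac hbc (b - a) (by rw [ha1]; norm_num)
  obtain ⟨hd, h2⟩ := edgeIntegral_erase_mul_height K hKb hab.symm hbc hac (b - a)
    (by rw [hb1]; norm_num)
  have h3 : ⟪T.normal (K.1.erase c), b - a⟫ = 0 := by
    obtain ⟨hFf, hFc⟩ := mem_edges.1 (erase_mem_edges K hcK)
    exact T.normal_perp _ hFf hFc b (by simp [hbK, hbc]) a (by simp [haK, hac])
  have hS : ∀ f : Plane → ℝ, ∑ z ∈ K.1, f z = f a + f b + f c := fun f => by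
    rw [hK, Finset.sum_insert (by simp [hab, hac]), Finset.sum_insert (by simp [hbc]),
      Finset.sum_singleton, add_assoc]
  rw [hS, h1 G, h2 G, h3, ha1, hb1]
  have hdet : |(c - b) 0 * (b - a) 1 - (c - b) 1 * (b - a) 0|
      = |(b - a) 0 * (c - a) 1 - (b - a) 1 * (c - a) 0| := by
    simp only [PiLp.sub_apply]; rw [← abs_neg]; congr 1; ring
  have hdet' : |(c - a) 0 * (b - a) 1 - (c - a) 1 * (b - a) 0|
      = |(b - a) 0 * (c - a) 1 - (b - a) 1 * (c - a) 0| := by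
    simp only [PiLp.sub_apply]; rw [← abs_neg]; congr 1; ring
  rw [hdet'] at hd
  have main := integral_fderiv_hull_triple a (b - a) (c - a) (abs_pos.1 hd) G hG
  rw [add_sub_cancel, add_sub_cancel] at main
  have hset : hull K.1 = convexHull ℝ {a, b, c} := by rw [hull, hK]; push_cast; rfl
  rw [hset, main, hdet, hdet']
  simp only [sign_one, SignType.coe_one, Left.sign_neg, SignType.coe_neg]
  ring

open Classical in
/-- The divergence theorem on a triangle. -/
theorem integral_fderiv_triangle (K : T.triangles) {G : Plane → ℝ} (hG : ContDiff ℝ 1 G)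
    (w : Plane) :
    ∫ x in hull K.1, fderiv ℝ G x w
      = ∑ z ∈ K.1, T.sgn (K.1.erase z) K.1 * ⟪T.normal (K.1.erase z), w⟫
          * edgeIntegral (K.1.erase z) G := by
  obtain ⟨a, b, c, hab, hac, hbc, hK⟩ := Finset.card_eq_three.1 (T.card_triangle K)
  have hK' : K.1 = {a, c, b} := by rw [hK]; congr 1; exact Finset.pair_comm b c
  have h1 := integral_fderiv_triangle_edge K hK hab hac hbc hG
  have h2 := integral_fderiv_triangle_edge K hK' hac hab hbc.symm hG
  -- Both sides of the formula are linear in w, and the two sides of the triangle at a span the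
  -- plane.
  have hw : w = T.bary K b (a + w) • (b - a) + T.bary K c (a + w) • (c - a) := by
    have hS : ∀ f : Plane → Plane, ∑ z ∈ K.1, f z = f a + f b + f c := fun f => by
      rw [hK, Finset.sum_insert (by simp [hab, hac]), Finset.sum_insert (by simp [hbc]),
        Finset.sum_singleton, add_assoc]
    have h3 : w = ∑ z ∈ K.1, T.bary K z (a + w) • (z - a) := by
      simp only [smul_sub, Finset.sum_sub_distrib]
      rw [sum_bary_smul, ← Finset.sum_smul, sum_bary, one_smul, add_sub_cancel_left]
    conv_lhs => rw [h3]
    rw [hS]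
    simp
  generalize T.bary K b (a + w) = β at hw
  generalize T.bary K c (a + w) = γ at hw
  have hc : ∀ v : Plane, Continuous fun x => fderiv ℝ G x v := fun v =>
    (hG.continuous_fderiv one_ne_zero).clm_apply continuous_const
  rw [hw]
  simp only [map_add, map_smul, smul_eq_mul, inner_add_right, inner_smul_right]
  rw [integral_add ((integrableOn_hull _ (hc _)).const_mul _)
    ((integrableOn_hull _ (hc _)).const_mul _), integral_const_mul, integral_const_mul, h1, h2,
    Finset.mul_sum, Finset.mul_sum, ← Finset.sum_add_distrib]
  exact Finset.sum_congr rfl fun z _ => by ring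

end Mesh

open Filter Topology

namespace Mesh

variable {T : Mesh}

/-! ### The geometry near an edge -/

/-- A Lipschitz domain lies on one side of its boundary: a small step downwards from a boundary
point, in the local coordinates, leaves the closure. Hence an open set covered by triangles lies in
the domain. -/
theorem interior_closure_eq (T : Mesh) : interior (closure T.Ω) = T.Ω := by
  refine Set.Subset.antisymm (fun x hx => ?_)
    (interior_maximal subset_closure T.isOpen)
  by_contra hxΩ
  have hfr : x ∈ frontier T.Ω := by
    rw [T.isOpen.frontier_eq]; exact ⟨interior_subset hx, hxΩ⟩
  obtain ⟨e, φ, L, r, h, hr, hh, hφ, hex, hloc⟩ := T.lipschitz x hfr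
  have hφ0 : 0 ≤ φ 0 := by
    have := (hloc x (by simpa [hex] using hr) (by simpa [hex] using hh)).not.1 hxΩ
    simpa [hex] using this
  let γ : ℝ → Plane := fun t => e.symm (t • EuclideanSpace.single (1 : Fin 2) (1 : ℝ))
  have hγ : Continuous γ := e.symm.continuous.comp (continuous_id.smul continuous_const)
  have hγ0 : γ 0 = x := by
    simp only [γ, zero_smul]; rw [← hex]; exact e.symm_apply_apply x
  have hev : ∀ᶠ t in 𝓝 (0 : ℝ), γ t ∈ interior (closure T.Ω) :=
    hγ.continuousAt.eventually_mem (by rw [hγ0]; exact isOpen_interior.mem_nhds hx)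
  obtain ⟨ε, hε, hb⟩ := Metric.eventually_nhds_iff.1 hev
  set t := -(min ε h / 2) with ht
  have hm : 0 < min ε h := lt_min hε hh
  have h1 : γ t ∈ closure T.Ω := interior_subset (hb (by
    rw [Real.dist_eq, sub_zero, ht, abs_neg, abs_of_pos (by linarith)]
    linarith [min_le_left ε h]))
  have he0 : e (γ t) 0 = 0 := by simp [γ]
  have he1 : e (γ t) 1 = t := by simp [γ]
  have hopen : IsOpen {y | |e y 0| < r ∧ |e y 1| < h ∧ e y 1 < φ (e y 0)} := by
    have c0 : Continuous fun y => e y 0 := (PiLp.continuous_apply 2 _ 0).comp e.continuous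
    have c1 : Continuous fun y => e y 1 := (PiLp.continuous_apply 2 _ 1).comp e.continuous
    exact (isOpen_lt c0.abs continuous_const).inter ((isOpen_lt c1.abs continuous_const).inter
      (isOpen_lt c1 (hφ.continuous.comp c0)))
  obtain ⟨y, ⟨hy0, hy1, hy2⟩, hyΩ⟩ := mem_closure_iff.1 h1 _ hopen
    ⟨by rw [he0, abs_zero]; exact hr, by
      rw [he1, ht, abs_neg, abs_of_pos (by linarith)]; linarith [min_le_right ε h],
      by rw [he0, he1]; linarith⟩
  exact absurd ((hloc y hy0 hy1).1 hyΩ) (not_lt.2 hy2.le)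

theorem hull_subset_closure_domain (K : T.triangles) : hull K.1 ⊆ closure T.Ω := by
  rw [← T.space_eq]
  exact T.complex.convexHull_subset_space (T.triangle_mem K)

theorem interior_hull_subset (K : T.triangles) : interior (hull K.1) ⊆ T.Ω := by
  rw [← interior_closure_eq T]; exact interior_mono (hull_subset_closure_domain K)

theorem exists_triangle_of_mem {x : Plane} (hx : x ∈ closure T.Ω) :
    ∃ K : T.triangles, x ∈ hull K.1 := by
  rw [← T.space_eq] at hx
  obtain ⟨F, hF, hxF⟩ := T.complex.mem_space_iff.1 hx
  obtain ⟨K, hK⟩ := exists_triangle_of_face hF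
  exact ⟨K, convexHull_mono (Finset.coe_subset.2 hK) hxF⟩

open Classical in
theorem hull_inter_subset {S S' : Finset Plane} (hS : S ∈ T.complex.faces)
    (hS' : S' ∈ T.complex.faces) {x : Plane} (hx : x ∈ hull S) (hx' : x ∈ hull S') :
    x ∈ hull (S ∩ S') := by
  have := T.complex.inter_subset_convexHull hS hS' ⟨hx, hx'⟩
  rwa [hull, Finset.coe_inter]

theorem hull_subset_of_card_le_one {S : Finset Plane} (hS : S.card ≤ 1) {x : Plane}
    (hx : x ∈ hull S) : x ∈ S := by
  rcases Finset.card_le_one_iff_subset_singleton.1 hS with ⟨a, ha⟩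
  rcases Finset.subset_singleton_iff.1 ha with rfl | rfl
  · simp [hull] at hx
  · simpa [hull] using hx

open Classical in
-- Two faces meet in the hull of their common vertices. If F is not contained in S, that hull has at
-- most one point, a vertex of F, whereas y is not a vertex.
theorem edge_subset_of_mem {F S : Finset Plane} (hF : F ∈ T.edges) (hS : S ∈ T.complex.faces)
    {y : Plane} (hy : y ∈ hull F) (hyF : y ∉ F) (hyS : y ∈ hull S) : F ⊆ S := by
  by_contra hFS
  have h1 : (F ∩ S).card < F.card := Finset.card_lt_card
    ⟨Finset.inter_subset_left, fun h => hFS fun z hz => (Finset.mem_inter.1 (h hz)).2⟩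
  rw [(mem_edges.1 hF).2] at h1
  exact hyF (Finset.mem_inter.1 (hull_subset_of_card_le_one (by omega)
    (hull_inter_subset (mem_edges.1 hF).1 hS hy hyS))).1

theorem hull_edge_subset_closure {F : Finset Plane} (hF : F.card = 2) :
    hull F ⊆ closure (hull F \ F) := by
  obtain ⟨a, b, hab, rfl⟩ := Finset.card_eq_two.1 hF
  have hseg : (hull {a, b} : Set Plane) = segment ℝ a b := by
    rw [← convexHull_pair]; simp [hull]
  have hsub : openSegment ℝ a b ⊆ (hull {a, b} : Set Plane) \ (({a, b} : Finset Plane) : Set Plane) := by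
    intro y hy
    refine ⟨hseg ▸ openSegment_subset_segment ℝ a b hy, ?_⟩
    simp only [Finset.coe_insert, Finset.coe_singleton, Set.mem_insert_iff,
      Set.mem_singleton_iff, not_or]
    exact ⟨fun h => hab (left_mem_openSegment_iff.1 (h ▸ hy)),
      fun h => hab (right_mem_openSegment_iff.1 (h ▸ hy))⟩
  intro x hx
  rw [hseg, ← closure_openSegment] at hx
  exact closure_mono hsub hx

theorem exists_mem_hull_edge {F : Finset Plane} (hF : F.card = 2) : ∃ y ∈ hull F, y ∉ F := by
  obtain ⟨a, ha⟩ : F.Nonempty := Finset.card_pos.1 (by omega)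
  obtain ⟨y, hy⟩ : (hull F \ F).Nonempty :=
    closure_nonempty_iff.1 ⟨a, hull_edge_subset_closure hF (subset_convexHull ℝ _ ha)⟩
  exact ⟨y, hy.1, hy.2⟩

theorem inner_normal_eq_zero {F : Finset Plane} (hF : F ∈ T.edges) {x y : Plane}
    (hx : x ∈ hull F) (hy : y ∈ hull F) : ⟪T.normal F, x - y⟫ = 0 := by
  obtain ⟨hFf, hFc⟩ := mem_edges.1 hF
  obtain ⟨a, ha⟩ : F.Nonempty := Finset.card_pos.1 (by omega)
  have key : ∀ x ∈ hull F, ⟪T.normal F, x⟫ = ⟪T.normal F, a⟫ := by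
    have h1 : Convex ℝ {x | ⟪T.normal F, x⟫ = ⟪T.normal F, a⟫} :=
      convex_hyperplane (f := fun x => ⟪T.normal F, x⟫)
        ⟨fun x y => inner_add_right _ _ _, fun c x => inner_smul_right _ _ _⟩ _
    intro x hx
    refine convexHull_min (fun b hb => ?_) h1 hx
    have := T.normal_perp F hFf hFc b hb a ha
    rw [inner_sub_right] at this
    exact sub_eq_zero.1 this
  rw [inner_sub_right, key x hx, key y hy, sub_self]

/-- Near a relatively interior point of one of its edges, a triangle is a half plane. -/
theorem eventually_mem_hull_iff {F : Finset Plane} (hF : F ∈ T.edges) {K : T.triangles}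
    (hFK : F ⊆ K.1) {y : Plane} (hy : y ∈ hull F) (hyF : y ∉ F) :
    ∀ᶠ x in 𝓝 y, x ∈ hull K.1 ↔ T.sgn F K.1 * ⟪T.normal F, x - y⟫ ≤ 0 := by
  classical
  obtain ⟨c, hc, rfl⟩ := exists_eq_erase hF hFK
  obtain ⟨κ, hκ, hh⟩ := exists_height K hc
  have hyK : y ∈ hull K.1 := convexHull_mono (Finset.coe_subset.2 hFK) hy
  obtain ⟨a, ha⟩ : (K.1.erase c).Nonempty :=
    Finset.card_pos.1 (by rw [card_erase_triangle K hc]; norm_num)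
  have haF : a ∈ hull (K.1.erase c) := subset_convexHull ℝ _ ha
  -- The coordinates of the end points of the edge are positive at y and stay so nearby, so only the
  -- coordinate of c, a signed distance to the edge, decides membership.
  have hpos : ∀ z ∈ K.1.erase c, 0 < T.bary K z y := by
    intro z hz
    refine lt_of_le_of_ne ((mem_hull_iff K y).1 hyK z (hFK hz)) fun h0 => hyF ?_
    have hmem : y ∈ hull ((K.1.erase c).erase z) := by
      refine (mem_hull_subset_iff ((Finset.erase_subset _ _).trans hFK) hyK).2 fun w hw hw' => ?_
      by_cases hwz : w = z
      · rw [hwz, ← h0]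
      · refine (mem_hull_subset_iff hFK hyK).1 hy w hw fun h => hw' (Finset.mem_erase.2 ⟨hwz, h⟩)
    refine Finset.erase_subset _ _ (hull_subset_of_card_le_one ?_ hmem)
    rw [Finset.card_erase_of_mem hz, card_erase_triangle K hc]
  have hev : ∀ᶠ x in 𝓝 y, ∀ z ∈ K.1.erase c, 0 < T.bary K z x := by
    rw [Finset.eventually_all]
    exact fun z hz => (continuous_bary K z).continuousAt.eventually_const_lt (hpos z hz)
  filter_upwards [hev] with x hx
  have h1 : ⟪T.normal (K.1.erase c), x - y⟫
      = -(T.sgn (K.1.erase c) K.1 * κ) * T.bary K c x := by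
    rw [← hh x a ha, ← sub_add_sub_cancel x a y, inner_add_right,
      inner_normal_eq_zero hF haF hy, add_zero]
  have h2 : T.sgn (K.1.erase c) K.1 * ⟪T.normal (K.1.erase c), x - y⟫ = -(κ * T.bary K c x) := by
    rw [h1]
    linear_combination (-κ * T.bary K c x) * sgn_mul_self (T := T) (K.1.erase c) K.1
  rw [h2, mem_hull_iff, neg_nonpos, mul_nonneg_iff_of_pos_left hκ]
  refine ⟨fun h => h c hc, fun h z hz => ?_⟩
  by_cases hzc : z = c
  · rwa [hzc]
  · exact (hx z (Finset.mem_erase.2 ⟨hzc, hz⟩)).le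

theorem tendsto_add_smul_normal (F : Finset Plane) (y : Plane) (c : ℝ) :
    Tendsto (fun t : ℝ => y + (t * c) • T.normal F) (𝓝[>] 0) (𝓝 y) := by
  have : Continuous fun t : ℝ => y + (t * c) • T.normal F := by fun_prop
  have h := this.tendsto 0
  simp only [zero_mul, zero_smul, add_zero] at h
  exact h.mono_left nhdsWithin_le_nhds

theorem inner_normal_smul {F : Finset Plane} (hF : F ∈ T.edges) (y : Plane) (c : ℝ) :
    ⟪T.normal F, y + c • T.normal F - y⟫ = c := by
  rw [add_sub_cancel_left, inner_smul_right, real_inner_self_eq_norm_sq,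
    T.norm_normal F (mem_edges.1 hF).1 (mem_edges.1 hF).2]
  ring

open Classical in
/-- Two triangles with a common edge lie on opposite sides of it. -/
theorem sgn_eq_neg {F : Finset Plane} (hF : F ∈ T.edges) {K K' : T.triangles} (hFK : F ⊆ K.1)
    (hFK' : F ⊆ K'.1) (hne : K ≠ K') : T.sgn F K'.1 = -T.sgn F K.1 := by
  by_contra hs
  have hs' : T.sgn F K'.1 = T.sgn F K.1 := by
    unfold sgn at hs ⊢; split_ifs at hs ⊢ <;> simp_all
  obtain ⟨y, hy, hyF⟩ := exists_mem_hull_edge (mem_edges.1 hF).2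
  have hcard : (K.1 ∩ K'.1).card = 2 := by
    have h1 : F.card ≤ (K.1 ∩ K'.1).card := Finset.card_le_card (Finset.subset_inter hFK hFK')
    have h2 : (K.1 ∩ K'.1).card < K.1.card := Finset.card_lt_card
      ⟨Finset.inter_subset_left, fun h => hne (Subtype.ext (Finset.eq_of_subset_of_card_le
        (fun z hz => (Finset.mem_inter.1 (h hz)).2)
        (by rw [T.card_triangle, T.card_triangle])))⟩
    rw [(mem_edges.1 hF).2] at h1
    rw [T.card_triangle] at h2
    omega
  have hFi : F = K.1 ∩ K'.1 := Finset.eq_of_subset_of_card_le (Finset.subset_inter hFK hFK')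
    (by rw [hcard, (mem_edges.1 hF).2])
  -- With equal signs, a short step from y against the outward normal would stay in both triangles,
  -- hence in their common edge, on which the normal component is constant.
  have ht := tendsto_add_smul_normal (T := T) F y (-T.sgn F K.1)
  obtain ⟨t, ⟨h1, h2⟩, h3⟩ := ((ht.eventually ((eventually_mem_hull_iff hF hFK hy hyF).and
    (eventually_mem_hull_iff hF hFK' hy hyF))).and self_mem_nhdsWithin).exists
  have h3 : 0 < t := h3
  have hsq := sgn_mul_self (T := T) F K.1
  rw [inner_normal_smul hF] at h1 h2
  have hm := hull_inter_subset (T.triangle_mem K) (T.triangle_mem K') (h1.2 (by nlinarith))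
    (h2.2 (by rw [hs']; nlinarith))
  rw [← hFi] at hm
  have := inner_normal_eq_zero hF hm hy
  rw [inner_normal_smul hF] at this
  exact mul_ne_zero h3.ne' (neg_ne_zero.2 (sgn_ne_zero _ _)) this

/-- The two triangles are complementary half planes near y, so together they cover a neighbourhood
of y. -/
theorem mem_domain_of_two_triangles {F : Finset Plane} (hF : F ∈ T.edges) {K K' : T.triangles}
    (hFK : F ⊆ K.1) (hFK' : F ⊆ K'.1) (hne : K ≠ K') {y : Plane} (hy : y ∈ hull F) (hyF : y ∉ F) :
    y ∈ T.Ω := by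
  rw [← interior_closure_eq T, mem_interior_iff_mem_nhds]
  filter_upwards [eventually_mem_hull_iff hF hFK hy hyF,
    eventually_mem_hull_iff hF hFK' hy hyF] with x h1 h2
  rw [sgn_eq_neg hF hFK hFK' hne] at h2
  rcases le_total (T.sgn F K.1 * ⟪T.normal F, x - y⟫) 0 with h | h
  · exact hull_subset_closure_domain K (h1.2 h)
  · exact hull_subset_closure_domain K' (h2.2 (by linarith))

/-- Points just across the edge lie in the domain and thus in some triangle other than K. There are
finitely many triangles, so one of them occurs arbitrarily close to y; being closed, it contains y
and then the whole edge. -/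
theorem exists_two_triangles {F : Finset Plane} (hF : F ∈ T.edges) {y : Plane} (hy : y ∈ hull F)
    (hyF : y ∉ F) (hyΩ : y ∈ T.Ω) (K : T.triangles) (hFK : F ⊆ K.1) :
    ∃ K' : T.triangles, F ⊆ K'.1 ∧ K ≠ K' := by
  have ht := tendsto_add_smul_normal (T := T) F y (T.sgn F K.1)
  have hev : ∀ᶠ t in 𝓝[>] (0 : ℝ), ∃ K' : T.triangles,
      y + (t * T.sgn F K.1) • T.normal F ∈ hull K'.1 ∧ K ≠ K' := by
    filter_upwards [ht.eventually (eventually_mem_hull_iff hF hFK hy hyF),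
      ht.eventually (T.isOpen.mem_nhds hyΩ), self_mem_nhdsWithin] with t h1 h2 h3
    have h3 : 0 < t := h3
    obtain ⟨K', hK'⟩ := exists_triangle_of_mem (subset_closure h2)
    refine ⟨K', hK', ?_⟩
    rintro rfl
    have := h1.1 hK'
    rw [inner_normal_smul hF] at this
    nlinarith [sgn_mul_self (T := T) F K.1]
  obtain ⟨K', hK'⟩ : ∃ K' : T.triangles, ∃ᶠ t in 𝓝[>] (0 : ℝ),
      y + (t * T.sgn F K.1) • T.normal F ∈ hull K'.1 ∧ K ≠ K' := by
    by_contra hcon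
    simp only [not_exists, not_frequently] at hcon
    obtain ⟨t, ⟨K', h⟩, h2⟩ := (hev.and (eventually_all.2 hcon)).exists
    exact h2 K' h
  obtain ⟨t, -, hne⟩ := hK'.exists
  refine ⟨K', edge_subset_of_mem hF (T.triangle_mem K') hy hyF ?_, hne⟩
  exact (isCompact_hull K'.1).isClosed.mem_of_frequently_of_tendsto
    (hK'.mono fun t h => h.1) ht

theorem exists_mem_domain_of_not_isBoundaryEdge {F : Finset Plane} (hF : F ∈ T.edges)
    (hb : ¬ T.IsBoundaryEdge F) : ∃ y ∈ hull F, y ∉ F ∧ y ∈ T.Ω := by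
  obtain ⟨x, hx, hxf⟩ := Set.not_subset.1 hb
  have hxΩ : x ∈ T.Ω := by
    have h1 : x ∈ closure T.Ω := by
      rw [← T.space_eq]; exact T.complex.convexHull_subset_space (mem_edges.1 hF).1 hx
    by_contra h
    exact hxf (by rw [T.isOpen.frontier_eq]; exact ⟨h1, h⟩)
  obtain ⟨y, hyΩ, hy⟩ := mem_closure_iff.1 (hull_edge_subset_closure (mem_edges.1 hF).2 hx)
    _ T.isOpen hxΩ
  exact ⟨y, hy.1, hy.2, hyΩ⟩

theorem notMem_domain_of_mem_frontier {x : Plane} (hx : x ∈ frontier T.Ω) : x ∉ T.Ω := by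
  rw [T.isOpen.frontier_eq] at hx; exact hx.2

theorem exists_of_isBoundaryEdge {F : Finset Plane} (hF : F ∈ T.edges) (hb : T.IsBoundaryEdge F) :
    ∃ K : T.triangles, F ⊆ K.1 ∧ T.PointsOut F K.1 ∧ ∀ K' : T.triangles, F ⊆ K'.1 → K' = K := by
  obtain ⟨K, hK⟩ := exists_triangle_of_face (mem_edges.1 hF).1
  refine ⟨K, hK, fun x hx a ha => T.normal_outward F (mem_edges.1 hF).1 (mem_edges.1 hF).2 hb K.1
    (T.triangle_mem K) hK x hx a ha, fun K' hK' => ?_⟩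
  by_contra hne
  obtain ⟨y, hy, hyF⟩ := exists_mem_hull_edge (mem_edges.1 hF).2
  exact notMem_domain_of_mem_frontier (hb hy) (mem_domain_of_two_triangles hF hK' hK hne hy hyF)

theorem exists_of_not_isBoundaryEdge {F : Finset Plane} (hF : F ∈ T.edges)
    (hb : ¬ T.IsBoundaryEdge F) :
    ∃ K K' : T.triangles, F ⊆ K.1 ∧ F ⊆ K'.1 ∧ K ≠ K' ∧ T.PointsOut F K.1 ∧ ¬ T.PointsOut F K'.1 ∧
      ∀ K'' : T.triangles, F ⊆ K''.1 → K'' = K ∨ K'' = K' := by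
  obtain ⟨y, hy, hyF, hyΩ⟩ := exists_mem_domain_of_not_isBoundaryEdge hF hb
  obtain ⟨K, hK⟩ := exists_triangle_of_face (mem_edges.1 hF).1
  obtain ⟨K', hK', hne⟩ := exists_two_triangles hF hy hyF hyΩ K hK
  -- Three triangles at one edge would have pairwise opposite signs.
  have hthird : ∀ K'' : T.triangles, F ⊆ K''.1 → K'' = K ∨ K'' = K' := by
    intro K'' hK''
    by_contra h
    push Not at h
    have h1 := sgn_eq_neg hF hK hK' hne
    have h2 := sgn_eq_neg hF hK'' hK h.1
    have h3 := sgn_eq_neg hF hK'' hK' h.2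
    exact sgn_ne_zero (T := T) F K''.1 (by linarith)
  have hs := sgn_eq_neg hF hK hK' hne
  unfold sgn at hs
  by_cases h1 : T.PointsOut F K.1
  · refine ⟨K, K', hK, hK', hne, h1, fun h2 => ?_, hthird⟩
    norm_num [h1, h2] at hs
  · refine ⟨K', K, hK', hK, hne.symm, ?_, h1, fun K'' h => (hthird K'' h).symm⟩
    by_contra h2
    norm_num [h1, h2] at hs

theorem mem_domain_of_not_isBoundaryEdge {F : Finset Plane} (hF : F ∈ T.edges)
    (hb : ¬ T.IsBoundaryEdge F) {y : Plane} (hy : y ∈ hull F) (hyF : y ∉ F) : y ∈ T.Ω := by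
  obtain ⟨K, K', hK, hK', hne, -⟩ := exists_of_not_isBoundaryEdge hF hb
  exact mem_domain_of_two_triangles hF hK hK' hne hy hyF

end Mesh

namespace Mesh

variable {T : Mesh}

/-! ### One-sided values on an edge -/

theorem minus_plus_of_isBoundaryEdge {F : Finset Plane} (hF : F ∈ T.edges)
    (hb : T.IsBoundaryEdge F) :
    ∃ K : T.triangles, F ⊆ K.1 ∧ (∀ K' : T.triangles, F ⊆ K'.1 → K' = K) ∧ T.sgn F K.1 = 1 ∧
      (∀ h, T.minus F h = h K) ∧ ∀ h, T.plus F h = 0 := by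
  classical
  obtain ⟨K, hK, hP, huniq⟩ := exists_of_isBoundaryEdge hF hb
  refine ⟨K, hK, huniq, if_pos hP, fun h => ?_, fun h => ?_⟩
  · rw [minus, Finset.sum_eq_single K]
    · rw [if_pos ⟨hK, hP⟩]
    · intro K' _ hne
      exact if_neg fun h => hne (huniq K' h.1)
    · simp
  · rw [plus]
    refine Finset.sum_eq_zero fun K' _ => if_neg fun h => ?_
    rw [huniq K' h.1] at h
    exact h.2 hP

theorem minus_plus_of_not_isBoundaryEdge {F : Finset Plane} (hF : F ∈ T.edges)
    (hb : ¬ T.IsBoundaryEdge F) :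
    ∃ K K' : T.triangles, F ⊆ K.1 ∧ F ⊆ K'.1 ∧ K ≠ K' ∧
      (∀ K'' : T.triangles, F ⊆ K''.1 → K'' = K ∨ K'' = K') ∧
      (∀ h, T.minus F h = h K) ∧ ∀ h, T.plus F h = h K' := by
  classical
  obtain ⟨K, K', hK, hK', hne, hP, hP', huniq⟩ := exists_of_not_isBoundaryEdge hF hb
  refine ⟨K, K', hK, hK', hne, huniq, fun h => ?_, fun h => ?_⟩
  · rw [minus, Finset.sum_eq_single K]
    · rw [if_pos ⟨hK, hP⟩]
    · intro K'' _ hne''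
      refine if_neg fun h => ?_
      rcases huniq K'' h.1 with rfl | rfl
      · exact hne'' rfl
      · exact hP' h.2
    · simp
  · rw [plus, Finset.sum_eq_single K']
    · rw [if_pos ⟨hK', hP'⟩]
    · intro K'' _ hne''
      refine if_neg fun h => ?_
      rcases huniq K'' h.1 with rfl | rfl
      · exact h.2 hP
      · exact hne'' rfl
    · simp

theorem continuous_minus (F : Finset Plane) {h : T.triangles → Plane → ℝ}
    (hh : ∀ K, Continuous (h K)) : Continuous fun x => T.minus F (fun K => h K x) := by
  unfold minus
  refine continuous_finsetSum _ fun K _ => ?_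
  split_ifs
  · exact hh K
  · exact continuous_const

theorem continuous_plus (F : Finset Plane) {h : T.triangles → Plane → ℝ}
    (hh : ∀ K, Continuous (h K)) : Continuous fun x => T.plus F (fun K => h K x) := by
  unfold plus
  refine continuous_finsetSum _ fun K _ => ?_
  split_ifs
  · exact hh K
  · exact continuous_const

theorem continuous_normalComp (τ : T.VectorField) (F : Finset Plane) (K : T.triangles) :
    Continuous fun x => normalComp τ F x K := by
  unfold normalComp; fun_prop

theorem continuous_normalTrace (τ : T.VectorField) (F : Finset Plane) :
    Continuous fun x => normalTrace τ F x :=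
  continuous_minus F fun K => continuous_normalComp τ F K

theorem continuous_jump (v : T.Broken) (F : Finset Plane) : Continuous fun x => jump v F x :=
  (continuous_minus F fun K => continuous_eval_ofLp (v K)).sub
    (continuous_plus F fun K => continuous_eval_ofLp (v K))

/-! ### Integration by parts -/

open Classical in
theorem integral_triangle_by_parts (K : T.triangles) (p : Fin 2 → MvPolynomial (Fin 2) ℝ)
    {φ : Plane → ℝ} (hφ : ContDiff ℝ 1 φ) :
    ∫ x in hull K.1, ∑ i, eval x.ofLp (p i) * fderiv ℝ φ x (EuclideanSpace.single i 1)
      = -(∫ x in hull K.1, eval x.ofLp (∑ i, pderiv i (p i)) * φ x)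
        + ∑ z ∈ K.1, T.sgn (K.1.erase z) K.1 * edgeIntegral (K.1.erase z)
            (fun x => (∑ i, eval x.ofLp (p i) * T.normal (K.1.erase z) i) * φ x) := by
  have hcφ : ∀ w : Plane, Continuous fun x => fderiv ℝ φ x w := fun w =>
    (hφ.continuous_fderiv one_ne_zero).clm_apply continuous_const
  have hφc := hφ.continuous
  have hfd : ∀ i x, fderiv ℝ (fun x : Plane => eval x.ofLp (p i) * φ x) x
      (EuclideanSpace.single i 1) = eval x.ofLp (p i) * fderiv ℝ φ x (EuclideanSpace.single i 1)
        + eval x.ofLp (pderiv i (p i)) * φ x := by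
    intro i x
    have h1 := ((hasFDerivAt_eval (p i) x).differentiableAt.hasFDerivAt.mul
      ((hφ.differentiable one_ne_zero) x).hasFDerivAt).fderiv
    have h2 : (fun x : Plane => eval x.ofLp (p i) * φ x) = (fun x : Plane => eval x.ofLp (p i)) * φ :=
      rfl
    rw [h2, h1, ← fderiv_eval_single]
    simp only [_root_.add_apply, _root_.smul_apply, smul_eq_mul]
    ring
  have hdiv : ∀ i, ∫ x in hull K.1, (eval x.ofLp (p i) * fderiv ℝ φ x (EuclideanSpace.single i 1)
        + eval x.ofLp (pderiv i (p i)) * φ x)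
      = ∑ z ∈ K.1, T.sgn (K.1.erase z) K.1 * edgeIntegral (K.1.erase z)
          (fun x => eval x.ofLp (p i) * T.normal (K.1.erase z) i * φ x) := by
    intro i
    have h := integral_fderiv_triangle K ((contDiff_eval_ofLp (p i)).mul hφ)
      (EuclideanSpace.single i (1 : ℝ))
    simp only [hfd] at h
    rw [h]
    refine Finset.sum_congr rfl fun z _ => ?_
    rw [mul_assoc, ← edgeIntegral_const_mul]
    congr 2
    ext x
    rw [EuclideanSpace.inner_single_right]
    simp only [conj_trivial, one_mul]
    ring
  have hsum := Finset.sum_congr (rfl : (Finset.univ : Finset (Fin 2)) = _) fun i _ => hdiv i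
  rw [Finset.sum_comm] at hsum
  have hedge : ∀ z ∈ K.1, ∑ i, T.sgn (K.1.erase z) K.1 * edgeIntegral (K.1.erase z)
          (fun x => eval x.ofLp (p i) * T.normal (K.1.erase z) i * φ x)
      = T.sgn (K.1.erase z) K.1 * edgeIntegral (K.1.erase z)
            (fun x => (∑ i, eval x.ofLp (p i) * T.normal (K.1.erase z) i) * φ x) := by
    intro z hz
    rw [← Finset.mul_sum, ← edgeIntegral_sum (card_erase_triangle K hz) _
      (fun i => by fun_prop)]
    simp only [Finset.sum_mul]
  have hint : ∀ i ∈ (Finset.univ : Finset (Fin 2)), Integrable (fun x : Plane =>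
      eval x.ofLp (p i) * fderiv ℝ φ x (EuclideanSpace.single i 1)
        + eval x.ofLp (pderiv i (p i)) * φ x) (volume.restrict (hull K.1)) := fun i _ =>
    integrableOn_hull _ (((continuous_eval_ofLp _).mul (hcφ _)).add
      ((continuous_eval_ofLp _).mul hφc))
  rw [Finset.sum_congr rfl hedge, ← integral_finsetSum _ hint] at hsum
  rw [← hsum, neg_add_eq_sub, ← integral_sub (integrableOn_hull _ ?_) (integrableOn_hull _ ?_)]
  · congr 1
    ext x
    rw [Finset.sum_add_distrib, map_sum, Finset.sum_mul, add_sub_cancel_right]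
  · exact continuous_finsetSum _ fun i _ => ((continuous_eval_ofLp _).mul (hcφ _)).add (by fun_prop)
  · fun_prop

open Classical in
-- Regrouping boundary terms by edges: the outward signs turn the contributions of the adjacent
-- triangles into a jump.
theorem sum_triangles_edges (a : Finset Plane → T.triangles → Plane → ℝ)
    (ha : ∀ F K, Continuous (a F K)) :
    ∑ K : T.triangles, ∑ z ∈ K.1, T.sgn (K.1.erase z) K.1 * edgeIntegral (K.1.erase z)
        (a (K.1.erase z) K)
      = ∑ F ∈ T.edges, edgeIntegral F
          (fun x => T.minus F (fun K => a F K x) - T.plus F (fun K => a F K x)) := by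
  simp only [minus_sub_plus]
  have h1 : ∀ K : T.triangles, ∑ z ∈ K.1, T.sgn (K.1.erase z) K.1 * edgeIntegral (K.1.erase z)
        (a (K.1.erase z) K) = ∑ F ∈ T.edges, edgeIntegral F
          (fun x => if F ⊆ K.1 then T.sgn F K.1 * a F K x else 0) := by
    intro K
    rw [sum_erase K fun F => T.sgn F K.1 * edgeIntegral F (a F K), Finset.sum_filter]
    refine Finset.sum_congr rfl fun F _ => ?_
    split_ifs
    · rw [edgeIntegral_const_mul]
    · rw [edgeIntegral_zero]
  rw [Finset.sum_congr rfl fun K _ => h1 K, Finset.sum_comm]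
  refine Finset.sum_congr rfl fun F hF => ?_
  rw [edgeIntegral_sum (mem_edges.1 hF).2]
  intro K
  split_ifs
  · exact continuous_const.mul (ha F K)
  · exact continuous_const

theorem sum_by_parts (τ : T.VectorField) {φ : T.triangles → Plane → ℝ}
    (hφ : ∀ K, ContDiff ℝ 1 (φ K)) :
    ∑ K : T.triangles, ∫ x in hull K.1,
        ∑ i, eval x.ofLp (τ K i) * fderiv ℝ (φ K) x (EuclideanSpace.single i 1)
      = -(∑ K : T.triangles, ∫ x in hull K.1, eval x.ofLp (div τ K) * φ K x)
        + ∑ F ∈ T.edges, edgeIntegral F fun x =>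
            T.minus F (fun K => normalComp τ F x K * φ K x)
              - T.plus F (fun K => normalComp τ F x K * φ K x) := by
  classical
  rw [← sum_triangles_edges (fun F K x => normalComp τ F x K * φ K x) fun F K =>
    (continuous_normalComp τ F K).mul (hφ K).continuous, ← Finset.sum_neg_distrib,
    ← Finset.sum_add_distrib]
  exact Finset.sum_congr rfl fun K _ => integral_triangle_by_parts K (τ K) (hφ K)

/-! ### Normal continuity -/

theorem edge_eq_of_mem {F F' : Finset Plane} (hF : F ∈ T.edges) (hF' : F' ∈ T.edges) {y : Plane}
    (hy : y ∈ hull F) (hyF : y ∉ F) (hy' : y ∈ hull F') : F = F' :=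
  Finset.eq_of_subset_of_card_le (edge_subset_of_mem hF (mem_edges.1 hF').1 hy hyF hy')
    (by rw [(mem_edges.1 hF).2, (mem_edges.1 hF').2])

/-- A piecewise polynomial field lies in `H(div)` if and only if its normal component does not jump
across interior edges. -/
theorem isHdiv_iff (τ : T.VectorField) :
    T.IsHdiv τ ↔ ∀ F ∈ T.edges, ¬ T.IsBoundaryEdge F → ∀ x ∈ hull F,
      T.minus F (normalComp τ F x) = T.plus F (normalComp τ F x) := by
  have hform : ∀ φ : Plane → ℝ, ContDiff ℝ 1 φ →
      ∑ K : T.triangles, ∫ x in hull K.1,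
        ∑ i, eval x.ofLp (τ K i) * fderiv ℝ φ x (EuclideanSpace.single i 1)
      = -(∑ K : T.triangles, ∫ x in hull K.1, eval x.ofLp (div τ K) * φ x)
        + ∑ F ∈ T.edges, edgeIntegral F fun x =>
            (T.minus F (normalComp τ F x) - T.plus F (normalComp τ F x)) * φ x := by
    intro φ hφ
    rw [sum_by_parts τ (φ := fun _ => φ) fun _ => hφ]
    congr 1
    refine Finset.sum_congr rfl fun F _ => ?_
    congr 1
    ext x
    rw [minus_sub_plus, minus_sub_plus, Finset.sum_mul]
    refine Finset.sum_congr rfl fun K _ => ?_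
    split_ifs
    · ring
    · ring
  have h1le : ((1 : ℕ∞) : WithTop ℕ∞) ≤ ∞ := by exact_mod_cast le_top
  constructor
  · intro h F hF hb
    set J : Plane → ℝ := fun x => T.minus F (normalComp τ F x) - T.plus F (normalComp τ F x)
      with hJ
    have hJc : Continuous J := (continuous_minus F fun K => continuous_normalComp τ F K).sub
      (continuous_plus F fun K => continuous_normalComp τ F K)
    have key : ∀ y ∈ hull F, y ∉ F → J y = 0 := by
      intro y hy hyF
      by_contra hne
      -- A test function supported in this neighbourhood of y sees no edge but F, and there J has
      -- the same sign as at y. The edge term of F is then an integral of constant sign.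
      have hU : IsOpen (T.Ω ∩ (⋃ F' ∈ T.edges.erase F, hull F')ᶜ ∩ {x | 0 < J y * J x}) :=
        (T.isOpen.inter ((T.edges.erase F).finite_toSet.isClosed_biUnion
          fun F' _ => (isCompact_hull F').isClosed).isOpen_compl).inter
            (isOpen_lt continuous_const (continuous_const.mul hJc))
      have hyU : y ∈ T.Ω ∩ (⋃ F' ∈ T.edges.erase F, hull F')ᶜ ∩ {x | 0 < J y * J x} := by
        refine ⟨⟨mem_domain_of_not_isBoundaryEdge hF hb hy hyF, ?_⟩, mul_self_pos.2 hne⟩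
        simp only [Set.mem_compl_iff, Set.mem_iUnion, not_exists]
        intro F' hF' hy'
        exact (Finset.mem_erase.1 hF').1 (edge_eq_of_mem hF (Finset.mem_erase.1 hF').2 hy hyF hy').symm
      obtain ⟨φ, hφs, hφc, hφd, hφr, hφy⟩ := exists_contDiff_tsupport_subset (n := ⊤)
        (hU.mem_nhds hyU)
      have htest : T.IsTest φ := ⟨hφd, hφc, fun x hx => (hφs hx).1.1⟩
      have h1 := hform φ (hφd.of_le h1le)
      rw [h φ htest, left_eq_add, ← Finset.add_sum_erase _ _ hF,
        Finset.sum_eq_zero, add_zero] at h1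
      · have h2 : edgeIntegral F (fun x => J y * (J x * φ x)) = 0 := by
          rw [edgeIntegral_const_mul, h1, mul_zero]
        have h3 := eqOn_zero_of_edgeIntegral_eq_zero (h := fun x => J y * (J x * φ x))
          (mem_edges.1 hF).2
          (continuous_const.mul (hJc.mul hφd.continuous)) (fun x _ => ?_) h2 y hy
        · rw [hφy, mul_one] at h3
          exact hne (mul_self_eq_zero.1 h3)
        · by_cases hx : φ x = 0
          · simp [hx]
          · have := (hφs (subset_tsupport _ hx)).2
            rw [← mul_assoc]
            exact mul_nonneg (le_of_lt this) (hφr ⟨x, rfl⟩).1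
      · intro F' hF'
        rw [edgeIntegral_congr (h' := fun _ => 0), edgeIntegral_zero]
        intro x hx
        have : φ x = 0 := by
          by_contra hne
          have := (hφs (subset_tsupport _ hne)).1.2
          simp only [Set.mem_compl_iff, Set.mem_iUnion, not_exists] at this
          exact this F' hF' hx
        rw [this, mul_zero]
    intro x hx
    have : hull F ⊆ J ⁻¹' {0} := (hull_edge_subset_closure (mem_edges.1 hF).2).trans
      (closure_minimal (fun y hy => key y hy.1 hy.2) (isClosed_singleton.preimage hJc))
    exact sub_eq_zero.1 (this hx)
  · intro h φ hφ
    rw [hform φ (hφ.1.of_le h1le), add_eq_left]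
    refine Finset.sum_eq_zero fun F hF => ?_
    rw [edgeIntegral_congr (h' := fun _ => 0), edgeIntegral_zero]
    intro x hx
    by_cases hb : T.IsBoundaryEdge F
    · have : φ x = 0 := by
        by_contra hne
        exact notMem_domain_of_mem_frontier (hb hx) (hφ.2.2 (subset_tsupport _ hne))
      rw [this, mul_zero]
    · rw [h F hF hb x hx, sub_self, zero_mul]

theorem minus_mul_sub_plus_mul {τ : T.VectorField} (hτ : T.IsHdiv τ) (v : T.Broken)
    {F : Finset Plane} (hF : F ∈ T.edges) {x : Plane} (hx : x ∈ hull F) :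
    T.minus F (fun K => normalComp τ F x K * eval x.ofLp (v K))
        - T.plus F (fun K => normalComp τ F x K * eval x.ofLp (v K))
      = normalTrace τ F x * jump v F x := by
  unfold jump normalTrace
  by_cases hb : T.IsBoundaryEdge F
  · obtain ⟨K, -, -, -, hm, hp⟩ := minus_plus_of_isBoundaryEdge hF hb
    simp only [hm, hp, sub_zero]
  · have h := (isHdiv_iff τ).1 hτ F hF hb x hx
    obtain ⟨K, K', -, -, -, -, hm, hp⟩ := minus_plus_of_not_isBoundaryEdge hF hb
    simp only [hm, hp] at h ⊢
    rw [h]; ring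

/-- Integration by parts for a field in `H(div)` and a broken polynomial. -/
theorem by_parts {τ : T.VectorField} (hτ : T.IsHdiv τ) (v : T.Broken) :
    ∑ K : T.triangles, ∫ x in hull K.1, ∑ i, eval x.ofLp (τ K i) * eval x.ofLp (grad v K i)
      = -pairing (div τ) v
        + ∑ F ∈ T.edges, edgeIntegral F fun x => normalTrace τ F x * jump v F x := by
  have h := sum_by_parts τ (φ := fun K x => eval x.ofLp (v K)) fun K => contDiff_eval_ofLp _
  simp only [fderiv_eval_single] at h
  refine h.trans ?_
  congr 1
  exact Finset.sum_congr rfl fun F hF => edgeIntegral_congr fun x hx =>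
    minus_mul_sub_plus_mul hτ v hF hx

end Mesh

/-! ### Raviart-Thomas polynomials and their divergence -/

theorem eqOn_zero_of_integral_eq_zero {S : Finset Plane} (hS : (interior (hull S)).Nonempty)
    {h : Plane → ℝ} (hh : Continuous h) (h0 : ∀ x ∈ hull S, 0 ≤ h x)
    (hz : ∫ x in hull S, h x = 0) : ∀ x ∈ hull S, h x = 0 := by
  rw [setIntegral_eq_zero_iff_of_nonneg_ae
    ((ae_restrict_iff' (isCompact_hull S).measurableSet).2 (Filter.Eventually.of_forall h0))
    (integrableOn_hull S hh)] at hz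
  have hcl : hull S ⊆ closure (interior (hull S)) := by
    rw [(convex_convexHull ℝ _).closure_interior_eq_closure_of_nonempty_interior hS]
    exact subset_closure
  exact Measure.eqOn_of_ae_eq (f := h) (g := 0) hz hh.continuousOn continuousOn_const hcl

/-- The Raviart-Thomas polynomials of index `s`. -/
def LocalRT (s : ℕ) : Submodule ℝ (Fin 2 → MvPolynomial (Fin 2) ℝ) where
  carrier := {τ | ∃ (p : Fin 2 → MvPolynomial (Fin 2) ℝ) (q : MvPolynomial (Fin 2) ℝ),
    (∀ i, p i ∈ PolyLE s) ∧ q ∈ PolyLE s ∧ ∀ i, τ i = p i + X i * q}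
  zero_mem' := ⟨0, 0, fun _ => Submodule.zero_mem _, Submodule.zero_mem _, fun _ => by simp⟩
  add_mem' := by
    rintro τ τ' ⟨p, q, hp, hq, h⟩ ⟨p', q', hp', hq', h'⟩
    exact ⟨p + p', q + q', fun i => Submodule.add_mem _ (hp i) (hp' i), Submodule.add_mem _ hq hq',
      fun i => by simp only [Pi.add_apply, h, h']; ring⟩
  smul_mem' := by
    rintro c τ ⟨p, q, hp, hq, h⟩
    exact ⟨c • p, c • q, fun i => Submodule.smul_mem _ _ (hp i), Submodule.smul_mem _ _ hq,
      fun i => by simp only [Pi.smul_apply, h, smul_add, mul_smul_comm]⟩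

theorem localRT_mono {s t : ℕ} (hst : s ≤ t) : LocalRT s ≤ LocalRT t :=
  fun _ ⟨p, q, hp, hq, h⟩ => ⟨p, q, fun i => polyLE_mono hst (hp i), polyLE_mono hst hq, h⟩

theorem sub_C_mul_mem_localRT {s : ℕ} {q : MvPolynomial (Fin 2) ℝ} (hq : q ∈ PolyLE s)
    (c : Plane) : (fun i => (X i - C (c i)) * q) ∈ LocalRT s :=
  ⟨fun i => -(C (c i) * q), q, fun i => Submodule.neg_mem _ (C_mul_mem_polyLE _ hq), hq,
    fun i => by ring⟩

theorem div_mem_polyLE {s : ℕ} {τ : Fin 2 → MvPolynomial (Fin 2) ℝ} (hτ : τ ∈ LocalRT s) :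
    ∑ i, pderiv i (τ i) ∈ PolyLE s := by
  obtain ⟨p, q, hp, hq, h⟩ := hτ
  refine Submodule.sum_mem _ fun i _ => ?_
  rw [h i]
  refine pderiv_mem_polyLE (Submodule.add_mem _ (polyLE_mono s.le_succ (hp i)) ?_) i
  rw [add_comm]
  exact mul_mem_polyLE (X_mem_polyLE i) hq

/-- By Euler's identity the part of degree s in the divergence of p + x q is s + 2 times the part of
degree s of q. If the divergence vanishes, q has lower degree and x q causes no excess of degree. -/
theorem mem_polyLE_of_div_eq_zero {s : ℕ} {τ : Fin 2 → MvPolynomial (Fin 2) ℝ}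
    (hτ : τ ∈ LocalRT s) (hdiv : ∑ i, pderiv i (τ i) = 0) (i : Fin 2) : τ i ∈ PolyLE s := by
  obtain ⟨p, q, hp, hq, h⟩ := hτ
  have hpd : ∀ (d : Fin 2 →₀ ℕ) i, s = d.degree → coeff d (pderiv i (p i)) = 0 := by
    intro d i hd
    rcases s with _ | s
    · rw [pderiv_eq_zero_of_mem_polyLE (hp i), coeff_zero]
    · exact coeff_eq_zero_of_mem_polyLE (pderiv_mem_polyLE (hp i) i) (by omega)
  have hq0 : ∀ d : Fin 2 →₀ ℕ, s = d.degree → coeff d q = 0 := by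
    intro d hd
    have h1 := congrArg (coeff d) hdiv
    simp only [h, map_add, Derivation.leibniz, smul_eq_mul, pderiv_X_self, mul_one, coeff_add, coeff_X_mul_pderiv, coeff_zero, Fin.sum_univ_two, hpd d _ hd] at h1
    have h2 : (0 : ℝ) ≤ (d 0 : ℝ) := Nat.cast_nonneg _
    have h3 : (0 : ℝ) ≤ (d 1 : ℝ) := Nat.cast_nonneg _
    have h4 : ((d 0 : ℝ) + d 1 + 2) * coeff d q = 0 := by linarith
    exact (mul_eq_zero.1 h4).resolve_left (by positivity)
  rw [h i]
  refine Submodule.add_mem _ (hp i) ?_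
  rcases s with _ | s
  · have : q = 0 := by
      have h1 := totalDegree_eq_zero_iff_eq_C.1 (Nat.le_zero.1 (mem_polyLE.1 hq))
      rw [h1, hq0 0 (by simp), map_zero]
    rw [this, mul_zero]; exact Submodule.zero_mem _
  · have hqs : q ∈ PolyLE s := mem_polyLE_of_coeff fun d hd => by
      rcases Nat.eq_or_lt_of_le (Nat.succ_le_of_lt hd) with h1 | h1
      · exact hq0 d h1
      · exact coeff_eq_zero_of_mem_polyLE hq h1
    rw [add_comm]
    exact mul_mem_polyLE (X_mem_polyLE i) hqs

namespace Mesh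

variable {T : Mesh}

/-! ### Projection onto the line through an edge -/

/-- The coordinates of the projection along `c - a` onto the line where the barycentric coordinate
of `c` vanishes. -/
def proj (K : T.triangles) (c a : Plane) (i : Fin 2) : MvPolynomial (Fin 2) ℝ :=
  X i - T.hat c K * C ((c - a) i)

theorem proj_mem_polyLE (K : T.triangles) (c a : Plane) (i : Fin 2) : proj K c a i ∈ PolyLE 1 :=
  Submodule.sub_mem _ (X_mem_polyLE i) (by
    rw [mul_comm]; exact C_mul_mem_polyLE _ (hat_mem_polyLE K c))

theorem eval_aeval_proj (K : T.triangles) (c a x : Plane) (p : MvPolynomial (Fin 2) ℝ) :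
    eval x.ofLp (aeval (proj K c a) p) = eval (x - T.bary K c x • (c - a)).ofLp p := by
  have : (eval x.ofLp).comp (aeval (proj K c a) : _ →ₐ[ℝ] MvPolynomial (Fin 2) ℝ).toRingHom
      = eval (x - T.bary K c x • (c - a)).ofLp := by
    refine MvPolynomial.ringHom_ext (fun r => by simp) fun i => ?_
    simp [proj, eval_hat]
  exact RingHom.congr_fun this p

open Classical in
theorem proj_mem_hull {K : T.triangles} {a c : Plane} (ha : a ∈ K.1) (hc : c ∈ K.1) (hac : a ≠ c)
    {x : Plane} (hx : x ∈ hull K.1) : x - T.bary K c x • (c - a) ∈ hull (K.1.erase c) := by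
  have hb : ∀ z ∈ K.1, T.bary K z (x - T.bary K c x • (c - a))
      = T.bary K z x - T.bary K c x * (T.bary K z c - T.bary K z a) := by
    intro z _
    have h1 := (T.bary K z).linearMap_vsub x (x - T.bary K c x • (c - a))
    have h2 := (T.bary K z).linearMap_vsub c a
    simp only [vsub_eq_sub, sub_sub_cancel, map_smul, smul_eq_mul] at h1 h2
    rw [h2] at h1
    linarith
  have hnn := (mem_hull_iff K x).1 hx
  have hmem : x - T.bary K c x • (c - a) ∈ hull K.1 := by
    refine (mem_hull_iff K _).2 fun z hz => ?_
    rw [hb z hz]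
    by_cases hzc : z = c
    · rw [hzc, bary_self hc, bary_of_ne ha hac]; linarith
    · rw [bary_of_ne hc (Ne.symm hzc)]
      by_cases hza : z = a
      · rw [hza, bary_self ha]; linarith [hnn a ha, hnn c hc]
      · rw [bary_of_ne ha (Ne.symm hza)]; linarith [hnn z hz]
  refine (mem_hull_subset_iff (Finset.erase_subset _ _) hmem).2 fun z hz hzF => ?_
  have hzc : z = c := by
    by_contra h
    exact hzF (Finset.mem_erase.2 ⟨h, hz⟩)
  rw [hb z hz, hzc, bary_self hc, bary_of_ne ha hac]; ring

open Classical in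
theorem exists_ne_mem {K : T.triangles} (c : Plane) : ∃ a ∈ K.1, a ≠ c := by
  obtain ⟨a, ha, hac⟩ := Finset.exists_mem_ne (s := K.1) (by rw [T.card_triangle]; norm_num) c
  exact ⟨a, ha, hac⟩

theorem hat_ne_zero {K : T.triangles} {c : Plane} (hc : c ∈ K.1) : T.hat c K ≠ 0 := fun h => by
  have := eval_hat K c c
  rw [h, map_zero, bary_self hc] at this
  exact zero_ne_one this

theorem totalDegree_hat {K : T.triangles} {c : Plane} (hc : c ∈ K.1) :
    1 ≤ (T.hat c K).totalDegree := by
  by_contra h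
  have h0 := totalDegree_eq_zero_iff_eq_C.1 (Nat.lt_one_iff.1 (not_le.1 h))
  obtain ⟨a, ha, hac⟩ := exists_ne_mem (K := K) c
  have h1 := eval_hat K c c
  have h2 := eval_hat K c a
  rw [h0, eval_C] at h1 h2
  rw [h1, bary_self hc, bary_of_ne ha hac] at h2
  exact one_ne_zero h2

open Classical in
/-- A polynomial that vanishes on an edge is a multiple of the barycentric coordinate of the
opposite vertex. -/
theorem exists_eq_hat_mul {K : T.triangles} {c : Plane} (hc : c ∈ K.1)
    {p : MvPolynomial (Fin 2) ℝ} (hp : ∀ x ∈ hull (K.1.erase c), eval x.ofLp p = 0) :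
    ∃ ψ, p = T.hat c K * ψ := by
  obtain ⟨a, ha, hac⟩ := exists_ne_mem (K := K) c
  -- The projection maps the triangle into the edge, so p composed with it vanishes on an open set.
  have h0 : aeval (proj K c a) p = 0 := by
    refine eq_zero_of_eval_eq_zero isOpen_interior (interior_hull_nonempty K) fun x hx => ?_
    rw [eval_aeval_proj]
    exact hp _ (proj_mem_hull ha hc hac (interior_subset hx))
  let I : Ideal (MvPolynomial (Fin 2) ℝ) := Ideal.span {T.hat c K}
  -- Modulo the barycentric coordinate of c the projection is the identity.
  have hcomp : (Ideal.Quotient.mkₐ ℝ I).comp (aeval (proj K c a)) = Ideal.Quotient.mkₐ ℝ I := by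
    refine MvPolynomial.algHom_ext fun i => ?_
    simp only [AlgHom.comp_apply, aeval_X, proj, map_sub, map_mul]
    have : Ideal.Quotient.mkₐ ℝ I (T.hat c K) = 0 :=
      Ideal.Quotient.eq_zero_iff_mem.2 (Ideal.mem_span_singleton_self _)
    rw [this, zero_mul, sub_zero]
  have h1 := AlgHom.congr_fun hcomp p
  rw [AlgHom.comp_apply, h0, map_zero] at h1
  exact Ideal.mem_span_singleton.1 (Ideal.Quotient.eq_zero_iff_mem.1 h1.symm)

theorem mem_polyLE_of_hat_mul {K : T.triangles} {c : Plane} (hc : c ∈ K.1) {s : ℕ}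
    {ψ : MvPolynomial (Fin 2) ℝ} (h : T.hat c K * ψ ∈ PolyLE (s + 1)) : ψ ∈ PolyLE s := by
  by_cases hψ : ψ = 0
  · rw [hψ]; exact Submodule.zero_mem _
  · have h1 := mem_polyLE.1 h
    rw [totalDegree_mul_of_isDomain (hat_ne_zero hc) hψ] at h1
    exact mem_polyLE.2 (by have := totalDegree_hat hc; omega)

theorem eq_zero_of_hat_mul {K : T.triangles} {c : Plane} (hc : c ∈ K.1)
    {ψ : MvPolynomial (Fin 2) ℝ} (h : T.hat c K * ψ ∈ PolyLE 0) : ψ = 0 := by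
  by_contra hψ
  have h1 := mem_polyLE.1 h
  rw [totalDegree_mul_of_isDomain (hat_ne_zero hc) hψ] at h1
  have := totalDegree_hat hc
  omega

/-! ### Unisolvence of the Raviart-Thomas element -/

/-- The inner product of two polynomial vector fields on a triangle. -/
def innerForm (K : T.triangles) : (Fin 2 → MvPolynomial (Fin 2) ℝ) →ₗ[ℝ]
    (Fin 2 → MvPolynomial (Fin 2) ℝ) →ₗ[ℝ] ℝ :=
  LinearMap.mk₂ ℝ (fun τ ψ => ∫ x in hull K.1, ∑ i, eval x.ofLp (τ i) * eval x.ofLp (ψ i))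
    (fun τ τ' ψ => by
      rw [← integral_add (integrableOn_hull _ (by fun_prop)) (integrableOn_hull _ (by fun_prop))]
      congr 1; ext x
      rw [← Finset.sum_add_distrib]
      exact Finset.sum_congr rfl fun i _ => by rw [Pi.add_apply, map_add, add_mul])
    (fun c τ ψ => by
      rw [smul_eq_mul, ← integral_const_mul]
      congr 1; ext x
      rw [Finset.mul_sum]
      exact Finset.sum_congr rfl fun i _ => by rw [Pi.smul_apply, smul_eval, mul_assoc])
    (fun τ ψ ψ' => by
      rw [← integral_add (integrableOn_hull _ (by fun_prop)) (integrableOn_hull _ (by fun_prop))]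
      congr 1; ext x
      rw [← Finset.sum_add_distrib]
      exact Finset.sum_congr rfl fun i _ => by rw [Pi.add_apply, map_add, mul_add])
    (fun c τ ψ => by
      rw [smul_eq_mul, ← integral_const_mul]
      congr 1; ext x
      rw [Finset.mul_sum]
      exact Finset.sum_congr rfl fun i _ => by rw [Pi.smul_apply, smul_eval]; ring)

theorem innerForm_apply (K : T.triangles) (τ ψ : Fin 2 → MvPolynomial (Fin 2) ℝ) :
    innerForm K τ ψ = ∫ x in hull K.1, ∑ i, eval x.ofLp (τ i) * eval x.ofLp (ψ i) := rfl

/-- The Raviart-Thomas polynomials with vanishing interior moments. -/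
def LocalRTRing (K : T.triangles) (s : ℕ) : Submodule ℝ (Fin 2 → MvPolynomial (Fin 2) ℝ) where
  carrier := {τ | τ ∈ LocalRT s ∧ (1 ≤ s → ∀ ψ : Fin 2 → MvPolynomial (Fin 2) ℝ,
    (∀ i, ψ i ∈ PolyLE (s - 1)) → innerForm K τ ψ = 0)}
  zero_mem' := ⟨Submodule.zero_mem _, fun _ ψ _ => by simp⟩
  add_mem' h h' := ⟨Submodule.add_mem _ h.1 h'.1, fun hs ψ hψ => by
    rw [map_add, LinearMap.add_apply, h.2 hs ψ hψ, h'.2 hs ψ hψ, add_zero]⟩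
  smul_mem' c τ h := ⟨Submodule.smul_mem _ _ h.1, fun hs ψ hψ => by
    rw [map_smul, LinearMap.smul_apply, h.2 hs ψ hψ, smul_zero]⟩

theorem sum_mul_normal (τ : Fin 2 → MvPolynomial (Fin 2) ℝ) (n x : Plane) :
    ∑ i, eval x.ofLp (τ i) * n i = ⟪n, WithLp.toLp 2 fun i => eval x.ofLp (τ i)⟫ := by
  simp [PiLp.inner_apply, Fin.sum_univ_two]

open Classical in
-- The normals of the two sides at a are linearly independent.
theorem eq_zero_of_inner_normal {K : T.triangles} {a : Plane} (ha : a ∈ K.1) {w : Plane}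
    (hw : ∀ c ∈ K.1, c ≠ a → ⟪T.normal (K.1.erase c), w⟫ = 0) : w = 0 := by
  have h1 : ∀ c ∈ K.1, c ≠ a → T.bary K c (a + w) = 0 := by
    intro c hc hca
    obtain ⟨κ, hκ, hh⟩ := exists_height K hc
    have := hh (a + w) a (Finset.mem_erase.2 ⟨hca.symm, ha⟩)
    rw [add_sub_cancel_left, hw c hc hca] at this
    exact (mul_eq_zero.1 this.symm).resolve_left
      (neg_ne_zero.2 (mul_ne_zero (sgn_ne_zero _ _) hκ.ne'))
  have h2 := sum_bary K (a + w)
  rw [Finset.sum_eq_single_of_mem a ha h1] at h2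
  have h3 := sum_bary_smul K (a + w)
  rw [Finset.sum_eq_single_of_mem a ha (fun c hc hca => by rw [h1 c hc hca, zero_smul]), h2,
    one_smul] at h3
  simpa using h3

open Classical in
/-- A Raviart-Thomas polynomial is determined by its normal traces and its interior moments. -/
theorem eq_zero_of_mem_localRTRing {K : T.triangles} {s : ℕ}
    {τ : Fin 2 → MvPolynomial (Fin 2) ℝ} (hτ : τ ∈ LocalRTRing K s)
    (h0 : ∀ c ∈ K.1, ∀ x ∈ hull (K.1.erase c),
      ∑ i, eval x.ofLp (τ i) * T.normal (K.1.erase c) i = 0) : τ = 0 := by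
  -- Integration by parts against the divergence D itself: the boundary terms vanish, and so does
  -- the interior term because the gradient of D has degree at most s - 1. Hence the integral of D²
  -- is zero.
  have hdiv : ∑ i, pderiv i (τ i) = 0 := by
    set D := ∑ i, pderiv i (τ i) with hD
    have hDs : D ∈ PolyLE s := div_mem_polyLE hτ.1
    have h1 := integral_triangle_by_parts K τ (contDiff_eval_ofLp D)
    rw [← hD, Finset.sum_eq_zero, add_zero] at h1
    · simp only [fderiv_eval_single] at h1
      have h2 : ∫ x in hull K.1, ∑ i, eval x.ofLp (τ i) * eval x.ofLp (pderiv i D) = 0 := by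
        rcases s with _ | s
        · simp [pderiv_eq_zero_of_mem_polyLE hDs]
        · exact hτ.2 (by omega) (fun i => pderiv i D) fun i => pderiv_mem_polyLE hDs i
      rw [h2, eq_comm, neg_eq_zero] at h1
      have h3 := eqOn_zero_of_integral_sq_eq_zero (interior_hull_nonempty K)
        (continuous_eval_ofLp D) h1
      exact eq_zero_of_eval_eq_zero isOpen_interior (interior_hull_nonempty K) fun x hx =>
        h3 x (interior_subset hx)
    · intro c hc
      rw [edgeIntegral_congr (h' := fun _ => 0), edgeIntegral_zero, mul_zero]
      intro x hx
      rw [h0 c hc x hx, zero_mul]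
  have hP := mem_polyLE_of_div_eq_zero hτ.1 hdiv
  -- The normal component for a side vanishes on it, so it is the opposite coordinate times some ψ,
  -- which is zero for s = 0 and otherwise has degree at most s - 1. Testing with ψ times the normal
  -- gives a vanishing integral of the coordinate times ψ².
  have ht : ∀ c ∈ K.1, ∑ i, C (T.normal (K.1.erase c) i) * τ i = 0 := by
    intro c hc
    have hts : ∑ i, C (T.normal (K.1.erase c) i) * τ i ∈ PolyLE s :=
      Submodule.sum_mem _ fun i _ => C_mul_mem_polyLE _ (hP i)
    obtain ⟨ψ, hψ⟩ := exists_eq_hat_mul hc (p := ∑ i, C (T.normal (K.1.erase c) i) * τ i)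
      fun x hx => by
        simp only [map_sum, map_mul, eval_C]
        rw [← h0 c hc x hx]
        exact Finset.sum_congr rfl fun i _ => mul_comm _ _
    suffices ψ = 0 by rw [hψ, this, mul_zero]
    rw [hψ] at hts
    rcases s with _ | s
    · exact eq_zero_of_hat_mul hc hts
    · have hψs := mem_polyLE_of_hat_mul hc hts
      have h1 := hτ.2 (by omega) (fun i => C (T.normal (K.1.erase c) i) * ψ)
        fun i => C_mul_mem_polyLE _ hψs
      rw [innerForm_apply] at h1
      have h2 : ∀ x : Plane, ∑ i, eval x.ofLp (τ i)
          * eval x.ofLp (C (T.normal (K.1.erase c) i) * ψ)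
          = T.bary K c x * (eval x.ofLp ψ * eval x.ofLp ψ) := by
        intro x
        have := congrArg (eval x.ofLp) hψ
        rw [map_mul, eval_hat] at this
        rw [← mul_assoc, ← this, map_sum, Finset.sum_mul]
        exact Finset.sum_congr rfl fun i _ => by simp only [map_mul, eval_C]; ring
      simp only [h2] at h1
      have h3 := eqOn_zero_of_integral_eq_zero (interior_hull_nonempty K)
        (h := fun x => T.bary K c x * (eval x.ofLp ψ * eval x.ofLp ψ))
        ((continuous_bary K c).mul (by fun_prop))
        (fun x hx => mul_nonneg ((mem_hull_iff K x).1 hx c hc) (mul_self_nonneg _)) h1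
      refine eq_zero_of_eval_eq_zero isOpen_interior (interior_hull_nonempty K) fun x hx => ?_
      have h4 := h3 x (interior_subset hx)
      exact mul_self_eq_zero.1 ((mul_eq_zero.1 h4).resolve_left
        ((mem_interior_hull_iff K x).1 hx c hc).ne')
  obtain ⟨a, ha, -⟩ := exists_ne_mem (K := K) 0
  have hw : ∀ x : Plane, WithLp.toLp 2 (fun i => eval x.ofLp (τ i)) = (0 : Plane) := by
    intro x
    refine eq_zero_of_inner_normal ha fun c hc _ => ?_
    rw [← sum_mul_normal]
    have := congrArg (eval x.ofLp) (ht c hc)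
    simp only [map_sum, map_mul, eval_C, map_zero] at this
    rw [← this]
    exact Finset.sum_congr rfl fun i _ => mul_comm _ _
  funext i
  refine eq_zero_of_eval_eq_zero isOpen_univ Set.univ_nonempty fun x _ => ?_
  have := congrArg (fun w : Plane => w i) (hw x)
  simpa using this

theorem eval_sub_mul_normal (q : MvPolynomial (Fin 2) ℝ) (c n x : Plane) :
    ∑ i, eval x.ofLp ((X i - C (c i)) * q) * n i = ⟪n, x - c⟫ * eval x.ofLp q := by
  simp only [PiLp.inner_apply, Fin.sum_univ_two, map_mul, map_sub, eval_X, eval_C,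
    PiLp.sub_apply]
  simp
  ring

/-- The fields `λ₁ q₁ (x - a₁) + λ₂ q₂ (x - a₂)` for two vertices `a₁`, `a₂`. -/
def bubble (K : T.triangles) (a : Fin 2 → Plane) (m : ℕ) :
    (Fin 2 → PolyLE m) →ₗ[ℝ] (Fin 2 → MvPolynomial (Fin 2) ℝ) where
  toFun q i := ∑ j, (X i - C (a j i)) * (T.hat (a j) K * (q j : MvPolynomial (Fin 2) ℝ))
  map_add' q q' := by
    ext1 i
    simp only [Pi.add_apply, Submodule.coe_add, mul_add, Finset.sum_add_distrib]
  map_smul' c q := by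
    ext1 i
    simp only [Pi.smul_apply, Submodule.coe_smul, mul_smul_comm, Finset.smul_sum, RingHom.id_apply]

theorem bubble_mem_localRT (K : T.triangles) (a : Fin 2 → Plane) (m : ℕ)
    (q : Fin 2 → PolyLE m) : bubble K a m q ∈ LocalRT (m + 1) := by
  have : bubble K a m q = ∑ j, fun i => (X i - C (a j i)) * (T.hat (a j) K * (q j).1) := by
    ext1 i; rw [Finset.sum_apply]; rfl
  rw [this]
  refine Submodule.sum_mem _ fun j _ => sub_C_mul_mem_localRT ?_ _
  rw [add_comm]
  exact mul_mem_polyLE (hat_mem_polyLE K _) (q j).2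

open Classical in
-- On the side opposite a_j the barycentric coordinate vanishes; the other sides contain a_j, so x -
-- a_j is tangential there.
theorem bubble_normal {K : T.triangles} {a : Fin 2 → Plane} (ha : ∀ j, a j ∈ K.1) (m : ℕ)
    (q : Fin 2 → PolyLE m) {c : Plane} (hc : c ∈ K.1) {x : Plane} (hx : x ∈ hull (K.1.erase c)) :
    ∑ i, eval x.ofLp (bubble K a m q i) * T.normal (K.1.erase c) i = 0 := by
  have h1 : ∑ i, eval x.ofLp (bubble K a m q i) * T.normal (K.1.erase c) i
      = ∑ j, ∑ i, eval x.ofLp ((X i - C (a j i)) * (T.hat (a j) K * (q j).1))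
          * T.normal (K.1.erase c) i := by
    rw [Finset.sum_comm]
    exact Finset.sum_congr rfl fun i _ => by rw [← Finset.sum_mul, ← map_sum]; rfl
  rw [h1]
  refine Finset.sum_eq_zero fun j _ => ?_
  rw [eval_sub_mul_normal, map_mul, eval_hat]
  have hxK : x ∈ hull K.1 := convexHull_mono (Finset.coe_subset.2 (Finset.erase_subset _ _)) hx
  by_cases hj : a j = c
  · rw [hj, (mem_hull_subset_iff (Finset.erase_subset _ _) hxK).1 hx c hc
      (Finset.notMem_erase _ _)]
    ring
  · rw [inner_normal_eq_zero (erase_mem_edges K hc) hx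
      (subset_convexHull ℝ _ (Finset.mem_erase.2 ⟨hj, ha j⟩)), zero_mul]

/-- At an interior point the vectors x - a_0 and x - a_1 are linearly independent and the
coordinates are positive. The independence is read off from the normals of the side joining the two
vertices and of the side opposite to one of them. -/
theorem eq_zero_of_bubble_eq_zero {K : T.triangles} {a : Fin 2 → Plane} (ha : ∀ j, a j ∈ K.1)
    (hne : a 0 ≠ a 1) {m : ℕ} {q : Fin 2 → PolyLE m} (hq : bubble K a m q = 0) : q = 0 := by
  classical
  obtain ⟨c, hc, hcn⟩ := Finset.exists_mem_notMem_of_card_lt_card (s := {a 0, a 1}) (t := K.1)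
    ((Finset.card_le_two).trans_lt (by rw [T.card_triangle]; norm_num))
  simp only [Finset.mem_insert, Finset.mem_singleton, not_or] at hcn
  have hcj : ∀ j, a j ≠ c := fun j => by fin_cases j; exacts [Ne.symm hcn.1, Ne.symm hcn.2]
  have hcase : ∀ j j' : Fin 2, a j ≠ a j' → (∀ f : Fin 2 → ℝ, ∑ i, f i = f j + f j') →
      q j = 0 := by
    intro j j' hjj hsum
    refine Subtype.ext (eq_zero_of_eval_eq_zero isOpen_interior (interior_hull_nonempty K)
      fun x hx => ?_)
    have hpos := (mem_interior_hull_iff K x).1 hx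
    have h1 : ∀ n : Plane, ⟪n, x - a j⟫ * (T.bary K (a j) x * eval x.ofLp (q j).1)
        + ⟪n, x - a j'⟫ * (T.bary K (a j') x * eval x.ofLp (q j').1) = 0 := by
      intro n
      have h2 : ∑ i, eval x.ofLp (bubble K a m q i) * n i = 0 := by simp [hq]
      rw [← hsum fun i => ⟪n, x - a i⟫ * (T.bary K (a i) x * eval x.ofLp (q i).1), ← h2]
      have h3 : ∀ i, eval x.ofLp (bubble K a m q i) * n i
          = ∑ r, eval x.ofLp ((X i - C (a r i)) * (T.hat (a r) K * (q r).1)) * n i := fun i => by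
        rw [← Finset.sum_mul, ← map_sum]; rfl
      rw [Finset.sum_congr rfl fun i _ => h3 i, Finset.sum_comm]
      exact Finset.sum_congr rfl fun r _ => by rw [eval_sub_mul_normal, map_mul, eval_hat]
    obtain ⟨κ, hκ, hh⟩ := exists_height K hc
    have h2 := h1 (T.normal (K.1.erase c))
    rw [hh x _ (Finset.mem_erase.2 ⟨hcj j, ha j⟩), hh x _ (Finset.mem_erase.2 ⟨hcj j', ha j'⟩),
      ← mul_add] at h2
    have h3 := (mul_eq_zero.1 h2).resolve_left (mul_ne_zero
      (neg_ne_zero.2 (mul_ne_zero (sgn_ne_zero _ _) hκ.ne')) (hpos c hc).ne')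
    obtain ⟨κ', hκ', hh'⟩ := exists_height K (ha j)
    have hmem := Finset.mem_erase.2 ⟨hjj.symm, ha j'⟩
    have h4 := h1 (T.normal (K.1.erase (a j)))
    have h5 := hh' (a j) _ hmem
    rw [bary_self (ha j)] at h5
    rw [← sub_sub_sub_cancel_right x (a j) (a j'), inner_sub_right, hh' x _ hmem, h5] at h4
    have h6 : -(T.sgn (K.1.erase (a j)) K.1 * κ') * (T.bary K (a j) x * eval x.ofLp (q j).1)
        = 0 := by
      linear_combination (-(T.sgn (K.1.erase (a j)) K.1 * κ') * T.bary K (a j) x) * h3 - h4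
    have h7 := (mul_eq_zero.1 h6).resolve_left
      (neg_ne_zero.2 (mul_ne_zero (sgn_ne_zero _ _) hκ'.ne'))
    exact (mul_eq_zero.1 h7).resolve_left (hpos _ (ha j)).ne'
  funext j
  fin_cases j
  · exact hcase 0 1 hne fun f => Fin.sum_univ_two f
  · exact hcase 1 0 hne.symm fun f => by rw [Fin.sum_univ_two, add_comm]

/-- The interior moments of a Raviart-Thomas polynomial are attained by a field with vanishing
normal traces. -/
theorem exists_bubble (K : T.triangles) {m : ℕ} (ρ : Fin 2 → MvPolynomial (Fin 2) ℝ) :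
    ∃ (a : Fin 2 → Plane) (q : Fin 2 → PolyLE m), (∀ j, a j ∈ K.1) ∧
      ∀ ψ : Fin 2 → MvPolynomial (Fin 2) ℝ, (∀ i, ψ i ∈ PolyLE m) →
        innerForm K (bubble K a m q) ψ = innerForm K ρ ψ := by
  classical
  obtain ⟨a₀, ha₀, -⟩ := exists_ne_mem (K := K) 0
  obtain ⟨a₁, ha₁, hne⟩ := exists_ne_mem (K := K) a₀
  let a : Fin 2 → Plane := ![a₀, a₁]
  have ha : ∀ j, a j ∈ K.1 := fun j => by fin_cases j; exacts [ha₀, ha₁]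
  let ι : (Fin 2 → PolyLE m) →ₗ[ℝ] (Fin 2 → MvPolynomial (Fin 2) ℝ) :=
    LinearMap.pi fun i => (PolyLE m).subtype ∘ₗ LinearMap.proj i
  let L : (Fin 2 → PolyLE m) →ₗ[ℝ] Module.Dual ℝ (Fin 2 → PolyLE m) :=
    (LinearMap.lcomp ℝ ℝ ι) ∘ₗ (innerForm K) ∘ₗ (bubble K a m)
  have hL : ∀ q ψ, L q ψ = innerForm K (bubble K a m q) (ι ψ) := fun _ _ => rfl
  -- A bubble whose moments vanish is zero by unisolvence. Fields and moments have the same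
  -- dimension, so injectivity gives surjectivity.
  have hinj : Function.Injective L := by
    rw [← LinearMap.ker_eq_bot, LinearMap.ker_eq_bot']
    intro q hq
    refine eq_zero_of_bubble_eq_zero ha hne.symm (eq_zero_of_mem_localRTRing (s := m + 1)
      ⟨bubble_mem_localRT K a m q, fun _ ψ hψ => ?_⟩ fun c hc x hx => bubble_normal ha m q hc hx)
    exact LinearMap.congr_fun hq fun i => ⟨ψ i, hψ i⟩
  have hsurj := (LinearMap.injective_iff_surjective_of_finrank_eq_finrank
    (Subspace.dual_finrank_eq (K := ℝ) (V := Fin 2 → PolyLE m)).symm).1 hinj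
  obtain ⟨q, hq⟩ := hsurj ((innerForm K ρ) ∘ₗ ι)
  exact ⟨a, q, ha, fun ψ hψ => LinearMap.congr_fun hq fun i => ⟨ψ i, hψ i⟩⟩

open Classical in
/-- There is a Raviart-Thomas polynomial with vanishing interior moments, prescribed normal trace on
one edge and vanishing normal traces on the others. -/
theorem exists_localRTRing (K : T.triangles) {c : Plane} (hc : c ∈ K.1) {s : ℕ}
    {p : MvPolynomial (Fin 2) ℝ} (hp : p ∈ PolyLE s) :
    ∃ τ ∈ LocalRTRing K s, ∀ c' ∈ K.1, ∀ x ∈ hull (K.1.erase c'),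
      ∑ i, eval x.ofLp (τ i) * T.normal (K.1.erase c') i
        = if c' = c then eval x.ofLp p else 0 := by
  obtain ⟨κ, hκ, hh⟩ := exists_height K hc
  -- On the side opposite c the normal component of x - c is the constant sign times κ, and on the
  -- sides through c it is zero; α is the inverse of that constant.
  set α := T.sgn (K.1.erase c) K.1 * κ⁻¹ with hα
  let ρ : Fin 2 → MvPolynomial (Fin 2) ℝ := fun i => (X i - C (c i)) * (C α * p)
  have hρ : ρ ∈ LocalRT s := sub_C_mul_mem_localRT (C_mul_mem_polyLE _ hp) c
  have hρn : ∀ c' ∈ K.1, ∀ x ∈ hull (K.1.erase c'),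
      ∑ i, eval x.ofLp (ρ i) * T.normal (K.1.erase c') i
        = if c' = c then eval x.ofLp p else 0 := by
    intro c' hc' x hx
    simp only [ρ]
    rw [eval_sub_mul_normal, map_mul, eval_C]
    split_ifs with h
    · rw [h] at hx ⊢
      obtain ⟨a, ha, hac⟩ := exists_ne_mem (K := K) c
      have haF : a ∈ K.1.erase c := Finset.mem_erase.2 ⟨hac, ha⟩
      have h1 := hh c a haF
      rw [bary_self hc] at h1
      have h2 := inner_normal_eq_zero (erase_mem_edges K hc) hx (subset_convexHull ℝ _ haF)
      rw [← sub_sub_sub_cancel_right x c a, inner_sub_right, h1, h2, hα]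
      have h3 := sgn_mul_self (T := T) (K.1.erase c) K.1
      have h4 : κ * κ⁻¹ = 1 := mul_inv_cancel₀ hκ.ne'
      linear_combination (eval x.ofLp p * (κ * κ⁻¹)) * h3 + eval x.ofLp p * h4
    · rw [inner_normal_eq_zero (erase_mem_edges K hc') hx
        (subset_convexHull ℝ _ (Finset.mem_erase.2 ⟨fun h' => h h'.symm, hc⟩)), zero_mul]
  rcases s with _ | m
  · exact ⟨ρ, ⟨hρ, fun h => absurd h (by norm_num)⟩, hρn⟩
  · obtain ⟨a, q, ha, hq⟩ := exists_bubble K (m := m) ρ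
    refine ⟨ρ - bubble K a m q, ⟨Submodule.sub_mem _ hρ (bubble_mem_localRT K a m q),
      fun _ ψ hψ => ?_⟩, fun c' hc' x hx => ?_⟩
    · rw [map_sub, LinearMap.sub_apply, hq ψ hψ, sub_self]
    · simp only [Pi.sub_apply, map_sub, sub_mul, Finset.sum_sub_distrib]
      rw [hρn c' hc' x hx, bubble_normal ha m q hc' hx, sub_zero]

/-- The function x · n is constant on an edge, so the term x q adds no degree to the normal trace.
-/
theorem exists_normal_polyLE {s : ℕ} {τ : Fin 2 → MvPolynomial (Fin 2) ℝ} (hτ : τ ∈ LocalRT s)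
    {F : Finset Plane} (hF : F ∈ T.edges) :
    ∃ p ∈ PolyLE s, ∀ x ∈ hull F, ∑ i, eval x.ofLp (τ i) * T.normal F i = eval x.ofLp p := by
  obtain ⟨p, q, hp, hq, h⟩ := hτ
  obtain ⟨y, hy, -⟩ := exists_mem_hull_edge (mem_edges.1 hF).2
  refine ⟨∑ i, C (T.normal F i) * p i + C ⟪T.normal F, y⟫ * q, Submodule.add_mem _
    (Submodule.sum_mem _ fun i _ => C_mul_mem_polyLE _ (hp i)) (C_mul_mem_polyLE _ hq),
    fun x hx => ?_⟩
  have h1 := inner_normal_eq_zero hF hx hy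
  rw [inner_sub_right, sub_eq_zero] at h1
  rw [← h1]
  simp only [h, map_add, map_mul, eval_X, eval_C, Fin.sum_univ_two, PiLp.inner_apply]
  simp
  ring

end Mesh

open Filter Topology

/-! ### Connectedness of a domain near a point -/

/-- Polar coordinates: the punctured disc is a continuous image of the unit circle times an
interval. -/
theorem isPreconnected_ball_diff_singleton (z : Plane) (ε : ℝ) :
    IsPreconnected (Metric.ball z ε \ {z}) := by
  have hrank : 1 < Module.rank ℝ Plane := by
    rw [← Module.finrank_eq_rank]; simp
  have himg : Metric.ball z ε \ {z}
      = (fun p : Plane × ℝ => z + p.2 • p.1) '' (Metric.sphere 0 1 ×ˢ Set.Ioo 0 ε) := by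
    ext x
    constructor
    · rintro ⟨hx, hxz⟩
      have hpos : 0 < ‖x - z‖ := norm_pos_iff.2 (sub_ne_zero.2 hxz)
      refine ⟨(‖x - z‖⁻¹ • (x - z), ‖x - z‖), ⟨?_, hpos, by rwa [← dist_eq_norm]⟩, ?_⟩
      · rw [mem_sphere_zero_iff_norm, norm_smul, norm_inv, norm_norm, inv_mul_cancel₀ hpos.ne']
      · simp only [smul_smul, mul_inv_cancel₀ hpos.ne', one_smul, add_sub_cancel]
    · rintro ⟨⟨w, t⟩, ⟨hw, ht⟩, rfl⟩
      have hw : ‖w‖ = 1 := mem_sphere_zero_iff_norm.1 hw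
      have hn : ‖t • w‖ = t := by rw [norm_smul, hw, mul_one, Real.norm_of_nonneg ht.1.le]
      refine ⟨?_, fun h => ?_⟩
      · rw [Metric.mem_ball, dist_eq_norm, add_sub_cancel_left, hn]; exact ht.2
      · have h0 : t • w = 0 := add_eq_left.1 h
        rw [h0, norm_zero] at hn
        exact ht.1.ne hn
  rw [himg]
  exact ((isPreconnected_sphere hrank _ _).prod isPreconnected_Ioo).image _
    (by fun_prop : Continuous _).continuousOn

/-- Each point is joined to (0, η / 2) by a vertical segment up or down to height η / 2, followed by
a horizontal one; at that height one is above the graph. -/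
theorem isPreconnected_epigraph (φ : ℝ → ℝ) {δ η : ℝ} (hδ : 0 < δ) (hη : 0 < η)
    (hφ : ∀ t, |t| < δ → φ t < η / 2) :
    IsPreconnected {y : Plane | |y 0| < δ ∧ |y 1| < η ∧ φ (y 0) < y 1} := by
  let pt : ℝ → ℝ → Plane := fun a b => !₂[a, b]
  have h0 : ∀ a b, pt a b 0 = a := fun a b => by simp [pt]
  have h1 : ∀ a b, pt a b 1 = b := fun a b => by simp [pt]
  have hpt : ∀ y : Plane, pt (y 0) (y 1) = y := fun y => by ext i; fin_cases i <;> simp [pt]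
  refine isPreconnected_of_forall (pt 0 (η / 2)) fun y ⟨hy0, hy1, hy2⟩ => ?_
  refine ⟨segment ℝ y (pt (y 0) (η / 2)) ∪ segment ℝ (pt (y 0) (η / 2)) (pt 0 (η / 2)), ?_,
    Or.inr (right_mem_segment _ _ _), Or.inl (left_mem_segment _ _ _), ?_⟩
  · rw [abs_lt] at hy0 hy1
    rintro x (⟨a, b, ha, hb, hab, rfl⟩ | ⟨a, b, ha, hb, hab, rfl⟩)
    · simp only [Set.mem_ofPred_eq, PiLp.add_apply, PiLp.smul_apply, smul_eq_mul, h0, h1]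
      have e : a * y 0 + b * y 0 = y 0 := by rw [← add_mul, hab, one_mul]
      rw [e]
      have hφy := hφ _ (abs_lt.2 hy0)
      have hb' : b = 1 - a := by linarith
      subst hb'
      refine ⟨abs_lt.2 hy0, abs_lt.2 ⟨by nlinarith, by nlinarith⟩, ?_⟩
      rcases ha.eq_or_lt with rfl | ha'
      · linarith
      · nlinarith
    · simp only [Set.mem_ofPred_eq, PiLp.add_apply, PiLp.smul_apply, smul_eq_mul, h0, h1]
      have e : a * (η / 2) + b * (η / 2) = η / 2 := by rw [← add_mul, hab, one_mul]
      have hlt : |a * y 0 + b * 0| < δ := by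
        rw [mul_zero, add_zero, abs_lt]
        constructor <;> nlinarith
      rw [e]
      exact ⟨hlt, abs_lt.2 ⟨by linarith, by linarith⟩, hφ _ hlt⟩
  · exact IsPreconnected.union _ (right_mem_segment _ _ _) (left_mem_segment _ _ _)
      (convex_segment _ _).isPreconnected (convex_segment _ _).isPreconnected

namespace Mesh

variable {T : Mesh}

/-- The domain with z removed is connected near z: a punctured disc at an interior point, the region
above a Lipschitz graph at a boundary point. This prevents the star of a vertex from splitting into
pieces that touch only at z. -/
theorem exists_isPreconnected {z : Plane} (hz : z ∈ closure T.Ω) {N : Set Plane} (hN : N ∈ 𝓝 z) :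
    ∃ P, IsPreconnected P ∧ P ⊆ N ∩ T.Ω ∧ z ∉ P ∧ ∃ N' ∈ 𝓝 z, (N' ∩ T.Ω) \ {z} ⊆ P := by
  by_cases hzΩ : z ∈ T.Ω
  · obtain ⟨ε, hε, hb⟩ := Metric.mem_nhds_iff.1 (inter_mem hN (T.isOpen.mem_nhds hzΩ))
    exact ⟨_, isPreconnected_ball_diff_singleton z ε, Set.sdiff_subset.trans hb, fun h => h.2 rfl,
      _, Metric.ball_mem_nhds z hε, fun x hx => ⟨hx.1.1, hx.2⟩⟩
  have hfr : z ∈ frontier T.Ω := by rw [T.isOpen.frontier_eq]; exact ⟨hz, hzΩ⟩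
  obtain ⟨e, φ, L, r, h, hr, hh, hφ, hex, hloc⟩ := T.lipschitz z hfr
  have c0 : Continuous fun y => e y 0 := (PiLp.continuous_apply 2 _ 0).comp e.continuous
  have c1 : Continuous fun y => e y 1 := (PiLp.continuous_apply 2 _ 1).comp e.continuous
  have hφ0 : φ 0 ≤ 0 := by
    by_contra hpos
    have hopen : IsOpen {y | |e y 0| < r ∧ |e y 1| < h ∧ e y 1 < φ (e y 0)} :=
      (isOpen_lt c0.abs continuous_const).inter ((isOpen_lt c1.abs continuous_const).inter
        (isOpen_lt c1 (hφ.continuous.comp c0)))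
    obtain ⟨y, ⟨hy0, hy1, hy2⟩, hyΩ⟩ := mem_closure_iff.1 hz _ hopen
      ⟨by simpa [hex] using hr, by simpa [hex] using hh, by simpa [hex] using hpos⟩
    exact absurd ((hloc y hy0 hy1).1 hyΩ) (not_lt.2 hy2.le)
  have hN' : e.symm ⁻¹' N ∈ 𝓝 (0 : Plane) := by
    refine e.symm.continuous.continuousAt.preimage_mem_nhds ?_
    rw [← hex, e.symm_apply_apply]; exact hN
  obtain ⟨ε, hε, hb⟩ := Metric.mem_nhds_iff.1 hN'
  set η := min (ε / 2) h with hη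
  have hη0 : 0 < η := lt_min (by linarith) hh
  have hev : ∀ᶠ t in 𝓝 (0 : ℝ), φ t < η / 2 :=
    hφ.continuous.continuousAt.eventually_lt_const (by linarith)
  obtain ⟨δ', hδ', hb'⟩ := Metric.eventually_nhds_iff.1 hev
  set δ := min δ' (min (ε / 2) r) with hδ
  have hδ0 : 0 < δ := lt_min hδ' (lt_min (by linarith) hr)
  have hδr : δ ≤ r := (min_le_right _ _).trans (min_le_right _ _)
  have hδε : δ ≤ ε / 2 := (min_le_right _ _).trans (min_le_left _ _)
  have hpre := isPreconnected_epigraph φ hδ0 hη0 fun t ht => hb' (by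
    rw [Real.dist_eq, sub_zero]; exact ht.trans_le (min_le_left _ _))
  refine ⟨e.symm '' {y : Plane | |y 0| < δ ∧ |y 1| < η ∧ φ (y 0) < y 1},
    hpre.image _ e.symm.continuous.continuousOn, ?_, ?_,
    {y | |e y 0| < δ ∧ |e y 1| < η}, ?_, ?_⟩
  · rintro _ ⟨y, ⟨hy0, hy1, hy2⟩, rfl⟩
    refine ⟨hb ?_, (hloc _ ?_ ?_).2 ?_⟩
    · rw [mem_ball_zero_iff]
      have h1 : ‖y‖ ^ 2 = y 0 * y 0 + y 1 * y 1 := by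
        rw [← real_inner_self_eq_norm_sq]
        simp only [PiLp.inner_apply, Fin.sum_univ_two, RCLike.inner_apply, conj_trivial]
      have h2 : ‖y‖ ≤ |y 0| + |y 1| := by
        refine abs_le_of_sq_le_sq' ?_ (by positivity) |>.2
        rw [h1]
        nlinarith [abs_mul_abs_self (y 0), abs_mul_abs_self (y 1),
          mul_nonneg (abs_nonneg (y 0)) (abs_nonneg (y 1))]
      have h3 : η ≤ ε / 2 := min_le_left _ _
      linarith
    · rw [e.apply_symm_apply]; linarith
    · rw [e.apply_symm_apply]; exact hy1.trans_le (min_le_right _ _)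
    · rw [e.apply_symm_apply]; exact hy2
  · rintro ⟨y, ⟨hy0, hy1, hy2⟩, hyz⟩
    refine hzΩ ?_
    rw [← hyz]
    refine (hloc _ ?_ ?_).2 ?_
    · rw [e.apply_symm_apply]; linarith
    · rw [e.apply_symm_apply]; exact hy1.trans_le (min_le_right _ _)
    · rw [e.apply_symm_apply]; exact hy2
  · exact ((isOpen_lt c0.abs continuous_const).inter (isOpen_lt c1.abs continuous_const)).mem_nhds
      ⟨by simpa [hex] using hδ0, by simpa [hex] using hη0⟩
  · rintro x ⟨⟨⟨hx0, hx1⟩, hxΩ⟩, -⟩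
    refine ⟨e x, ⟨hx0, hx1, (hloc x (hx0.trans_le hδr) (hx1.trans_le (min_le_right _ _))).1 hxΩ⟩,
      e.symm_apply_apply x⟩

/-! ### The star of a vertex -/

theorem singleton_mem_faces {K : T.triangles} {z : Plane} (hz : z ∈ K.1) :
    {z} ∈ T.complex.faces :=
  T.complex.down_closed (T.triangle_mem K) (Finset.singleton_subset_iff.2 hz)
    (Finset.singleton_nonempty z)

theorem eventually_mem_of_mem_hull {K : T.triangles} {z : Plane} (hz : z ∈ K.1) :
    ∀ᶠ x in 𝓝 z, ∀ S ∈ T.complex.faces, x ∈ hull S → z ∈ S := by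
  rw [T.finite.eventually_all]
  intro S hS
  by_cases hzS : z ∈ S
  · exact Eventually.of_forall fun _ _ => hzS
  · have : z ∉ hull S := fun h =>
      hzS ((T.complex.vertex_mem_convexHull_iff (singleton_mem_faces hz) hS).1 h)
    filter_upwards [(isCompact_hull S).isClosed.isOpen_compl.mem_nhds this] with x hx hxS
    exact absurd hxS hx

theorem mem_closure_domain {K : T.triangles} {z : Plane} (hz : z ∈ K.1) : z ∈ closure T.Ω :=
  hull_subset_closure_domain K (subset_convexHull ℝ _ hz)

theorem exists_mem_interior_hull {K : T.triangles} {z : Plane} (hz : z ∈ K.1) {N : Set Plane}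
    (hN : N ∈ 𝓝 z) : ∃ x ∈ interior (hull K.1), x ∈ N ∧ x ≠ z := by
  have h1 : z ∈ closure (interior (hull K.1)) := by
    rw [closure_interior_hull]; exact subset_convexHull ℝ _ hz
  obtain ⟨x, hxN, hx⟩ := mem_closure_iff_nhds.1 h1 N hN
  refine ⟨x, hx, hxN, ?_⟩
  rintro rfl
  obtain ⟨c, hc, hcx⟩ := exists_ne_mem (K := K) x
  have := (mem_interior_hull_iff K x).1 hx c hc
  rw [bary_of_ne hz hcx.symm] at this
  exact lt_irrefl _ this

/-- Any two triangles at a vertex are connected through triangles that share edges at the vertex. -/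
theorem star_induction {z : Plane} {p : T.triangles → Prop}
    (hstep : ∀ K K' : T.triangles, ∀ F ∈ T.edges, z ∈ F → F ⊆ K.1 → F ⊆ K'.1 → p K → p K')
    {K K' : T.triangles} (hK : z ∈ K.1) (hK' : z ∈ K'.1) (hp : p K) : p K' := by
  classical
  by_contra hp'
  have hN := eventually_mem_of_mem_hull (T := T) hK
  obtain ⟨P, hP, hPN, hzP, N', hN', hsub⟩ := exists_isPreconnected (mem_closure_domain hK) hN
  -- The triangles at z with property p and those without it form two closed sets that cover the
  -- connected set P and both meet it. They share a point of P, which is not z, so two triangles of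
  -- different kind have a common edge at z.
  have hcl : ∀ q : T.triangles → Prop, IsClosed (⋃ K ∈ {K : T.triangles | z ∈ K.1 ∧ q K}, hull K.1) :=
    fun q => (Set.toFinite _).isClosed_biUnion fun K _ => (isCompact_hull K.1).isClosed
  have hmeet : ∀ (q : T.triangles → Prop) (K : T.triangles), z ∈ K.1 → q K →
      (P ∩ ⋃ K ∈ {K : T.triangles | z ∈ K.1 ∧ q K}, hull K.1).Nonempty := by
    intro q K hz hq
    obtain ⟨x, hx, hxN, hxz⟩ := exists_mem_interior_hull hz hN'
    exact ⟨x, hsub ⟨⟨hxN, interior_hull_subset K hx⟩, hxz⟩,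
      Set.mem_biUnion (⟨hz, hq⟩ : z ∈ K.1 ∧ q K) (interior_subset hx)⟩
  have hcover : P ⊆ (⋃ K ∈ {K : T.triangles | z ∈ K.1 ∧ p K}, hull K.1)
      ∪ ⋃ K ∈ {K : T.triangles | z ∈ K.1 ∧ ¬ p K}, hull K.1 := by
    intro x hx
    obtain ⟨K, hxK⟩ := exists_triangle_of_mem (subset_closure (hPN hx).2)
    have hzK := (hPN hx).1 K.1 (T.triangle_mem K) hxK
    by_cases h : p K
    · exact Or.inl (Set.mem_biUnion (⟨hzK, h⟩ : z ∈ K.1 ∧ p K) hxK)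
    · exact Or.inr (Set.mem_biUnion (⟨hzK, h⟩ : z ∈ K.1 ∧ ¬ p K) hxK)
  obtain ⟨x, hxP, hx1, hx2⟩ := isPreconnected_closed_iff.1 hP _ _ (hcl p) (hcl fun K => ¬ p K)
    hcover (hmeet p K hK hp) (hmeet (fun K => ¬ p K) K' hK' hp')
  simp only [Set.mem_iUnion] at hx1 hx2
  obtain ⟨K₁, ⟨hz1, hp1⟩, hx1⟩ := hx1
  obtain ⟨K₂, ⟨hz2, hp2⟩, hx2⟩ := hx2
  have hx := hull_inter_subset (T.triangle_mem K₁) (T.triangle_mem K₂) hx1 hx2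
  have hzi : z ∈ K₁.1 ∩ K₂.1 := Finset.mem_inter.2 ⟨hz1, hz2⟩
  have hcard : 1 < (K₁.1 ∩ K₂.1).card := by
    by_contra hle
    have hxi := hull_subset_of_card_le_one (not_lt.1 hle) hx
    exact hzP ((Finset.card_le_one.1 (not_lt.1 hle) x hxi z hzi) ▸ hxP)
  obtain ⟨b, hb, hbz⟩ := Finset.exists_mem_ne hcard z
  have hsub1 : ({z, b} : Finset Plane) ⊆ K₁.1 ∩ K₂.1 :=
    Finset.insert_subset hzi (Finset.singleton_subset_iff.2 hb)
  exact hp2 (hstep K₁ K₂ {z, b} (mem_edges_of_subset (hsub1.trans Finset.inter_subset_left)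
    (Finset.card_pair hbz.symm)) (by simp) (hsub1.trans Finset.inter_subset_left)
    (hsub1.trans Finset.inter_subset_right) hp1)

/-- If all edges at z were interior, the domain would be relatively closed in a small punctured
disc, and by connectedness would contain it. Then z would be interior to the closure, hence in the
domain. -/
theorem exists_isBoundaryEdge {K : T.triangles} {z : Plane} (hz : z ∈ K.1) (hzΩ : z ∉ T.Ω) :
    ∃ F ∈ T.edges, z ∈ F ∧ T.IsBoundaryEdge F := by
  classical
  by_contra hcon
  push Not at hcon
  obtain ⟨ε, hε, hb⟩ := Metric.eventually_nhds_iff_ball.1 (eventually_mem_of_mem_hull (T := T) hz)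
  have hne : ((Metric.ball z ε \ {z}) ∩ T.Ω).Nonempty := by
    obtain ⟨x, hx, hxN, hxz⟩ := exists_mem_interior_hull hz (Metric.ball_mem_nhds z hε)
    exact ⟨x, ⟨hxN, hxz⟩, interior_hull_subset K hx⟩
  have hsub := (isPreconnected_ball_diff_singleton z ε).subset_of_closure_inter_subset T.isOpen hne
    (by
      rintro x ⟨hx, hxb, hxz⟩
      obtain ⟨K, hxK⟩ := exists_triangle_of_mem hx
      by_cases hint : x ∈ interior (hull K.1)
      · exact interior_hull_subset K hint
      · rw [mem_interior_hull_iff] at hint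
        push Not at hint
        obtain ⟨c, hc, hcx⟩ := hint
        have hcx0 := le_antisymm hcx ((mem_hull_iff K x).1 hxK c hc)
        have hxF : x ∈ hull (K.1.erase c) :=
          (mem_hull_subset_iff (Finset.erase_subset _ _) hxK).2 fun w hw hwF => by
            have : w = c := by by_contra h; exact hwF (Finset.mem_erase.2 ⟨h, hw⟩)
            rw [this, hcx0]
        have hF := erase_mem_edges K hc
        have hzF := hb x hxb _ (mem_edges.1 hF).1 hxF
        refine mem_domain_of_not_isBoundaryEdge hF (hcon _ hF hzF) hxF fun hxF' => hxz ?_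
        have := hb x hxb {x} (singleton_mem_faces (Finset.erase_subset _ _ hxF'))
          (subset_convexHull ℝ _ (by simp))
        exact (Finset.mem_singleton.1 this).symm)
  refine hzΩ ?_
  rw [← interior_closure_eq T, mem_interior_iff_mem_nhds]
  filter_upwards [Metric.ball_mem_nhds z hε] with x hx
  by_cases hxz : x = z
  · rw [hxz]; exact mem_closure_domain hz
  · exact subset_closure (hsub ⟨hx, hxz⟩)

open Classical in
/-- The number of triangles at a vertex exceeds the number of its interior edges by at most one. -/
theorem card_star_le {z : Plane} {K₀ : T.triangles} (hz : z ∈ K₀.1) :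
    (Finset.univ.filter fun K : T.triangles => z ∈ K.1).card
      ≤ (T.edges.filter fun F => z ∈ F ∧ ¬ T.IsBoundaryEdge F).card + 1 := by
  let V := {K : T.triangles // z ∈ K.1}
  -- The dual graph of the star. It is connected by `star_induction`, so its vertices exceed its
  -- edges by at most one.
  let G : SimpleGraph V :=
    { Adj := fun K K' => K ≠ K' ∧ ∃ F ∈ T.edges, z ∈ F ∧ F ⊆ K.1.1 ∧ F ⊆ K'.1.1
      symm := ⟨fun K K' ⟨h, F, hF, hzF, h1, h2⟩ => ⟨h.symm, F, hF, hzF, h2, h1⟩⟩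
      loopless := ⟨fun K h => h.1 rfl⟩ }
  have hconn : G.Connected := by
    rw [SimpleGraph.connected_iff]
    refine ⟨fun K K' => ?_, ⟨⟨K₀, hz⟩⟩⟩
    have := star_induction (z := z) (p := fun K'' => ∀ h : z ∈ K''.1, G.Reachable K ⟨K'', h⟩)
      (fun K₁ K₂ F hF hzF h1 h2 h3 h4 => by
        have h5 := h3 (h1 hzF)
        by_cases hne : K₁ = K₂
        · subst hne; exact h5
        · exact h5.trans (SimpleGraph.Adj.reachable
            ⟨fun h => hne (congrArg Subtype.val h), F, hF, hzF, h1, h2⟩))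
      K.2 K'.2 (fun _ => SimpleGraph.Reachable.refl _)
    exact this K'.2
  have h1 := hconn.card_vert_le_card_edgeSet_add_one
  have h2 : Nat.card V = (Finset.univ.filter fun K : T.triangles => z ∈ K.1).card := by
    rw [Nat.card_eq_fintype_card, Fintype.card_subtype]
  -- Each adjacency is realized by an interior edge, which has only two triangles and therefore
  -- determines the adjacency.
  have hex : ∀ e : G.edgeSet, ∃ F ∈ T.edges.filter fun F => z ∈ F ∧ ¬ T.IsBoundaryEdge F,
      ∀ K K' : V, F ⊆ K.1.1 → F ⊆ K'.1.1 → K ≠ K' → e.1 = s(K, K') := by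
    rintro ⟨e, he⟩
    induction e using Sym2.ind with
    | _ K K' =>
      obtain ⟨hne, F, hF, hzF, h1, h2⟩ := (SimpleGraph.mem_edgeSet _).1 he
      have hne' : K.1 ≠ K'.1 := fun h => hne (Subtype.ext h)
      have hb : ¬ T.IsBoundaryEdge F := fun hb => by
        obtain ⟨K₁, -, -, hu⟩ := exists_of_isBoundaryEdge hF hb
        exact hne' ((hu _ h1).trans (hu _ h2).symm)
      refine ⟨F, Finset.mem_filter.2 ⟨hF, hzF, hb⟩, fun K₁ K₂ g1 g2 g12 => ?_⟩
      have g12' : K₁.1 ≠ K₂.1 := fun h => g12 (Subtype.ext h)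
      obtain ⟨A, B, -, -, -, -, -, hu⟩ := exists_of_not_isBoundaryEdge hF hb
      have hext : ∀ a b : V, a = b ↔ a.1 = b.1 := fun a b => Subtype.ext_iff
      rw [Sym2.eq_iff]
      rcases hu _ h1 with a1 | a1 <;> rcases hu _ h2 with a2 | a2 <;>
        rcases hu _ g1 with a3 | a3 <;> rcases hu _ g2 with a4 | a4 <;>
        simp only [hext] <;> grind
  choose f hf hf' using hex
  have hinj : Function.Injective fun e : G.edgeSet =>
      (⟨f e, hf e⟩ : {F // F ∈ T.edges.filter fun F => z ∈ F ∧ ¬ T.IsBoundaryEdge F}) := by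
    intro e e' hee
    have hee : f e = f e' := congrArg Subtype.val hee
    obtain ⟨hF, hzF, hb⟩ := Finset.mem_filter.1 (hf e)
    obtain ⟨A, B, hA, hB, hAB, -⟩ := exists_of_not_isBoundaryEdge hF hb
    have e1 := hf' e ⟨A, hA hzF⟩ ⟨B, hB hzF⟩ hA hB fun h => hAB (congrArg Subtype.val h)
    have e2 := hf' e' ⟨A, hA hzF⟩ ⟨B, hB hzF⟩ (hee ▸ hA) (hee ▸ hB)
      fun h => hAB (congrArg Subtype.val h)
    exact Subtype.ext (e1.trans e2.symm)
  have h3 := Nat.card_le_card_of_injective _ hinj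
  rw [Nat.card_eq_finsetCard] at h3
  omega

open Classical in
theorem card_edges_at (K : T.triangles) {z : Plane} (hz : z ∈ K.1) :
    ((T.edges.filter fun F => z ∈ F).filter fun F => F ⊆ K.1).card = 2 := by
  have : (T.edges.filter fun F => z ∈ F).filter (fun F => F ⊆ K.1)
      = (K.1.erase z).image fun c => K.1.erase c := by
    ext F
    simp only [Finset.mem_filter, Finset.mem_image, Finset.mem_erase]
    constructor
    · rintro ⟨⟨hF, hzF⟩, hFK⟩
      obtain ⟨c, hc, rfl⟩ := exists_eq_erase hF hFK
      exact ⟨c, ⟨fun h => Finset.notMem_erase c K.1 (h ▸ hzF), hc⟩, rfl⟩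
    · rintro ⟨c, ⟨hcz, hc⟩, rfl⟩
      exact ⟨⟨erase_mem_edges K hc, Finset.mem_erase.2 ⟨hcz.symm, hz⟩⟩, Finset.erase_subset _ _⟩
  rw [this, Finset.card_image_of_injOn ((Finset.erase_injOn K.1).mono
    (Finset.coe_subset.2 (Finset.erase_subset _ _))), card_erase_triangle K hz]

open Classical in
-- Double counting of incidences at z: a triangle has two sides through z, an interior edge lies in
-- two triangles, a boundary edge in one.
theorem card_boundary_add {z : Plane} :
    (T.edges.filter fun F => z ∈ F ∧ T.IsBoundaryEdge F).card
      + 2 * (T.edges.filter fun F => z ∈ F ∧ ¬ T.IsBoundaryEdge F).card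
      = 2 * (Finset.univ.filter fun K : T.triangles => z ∈ K.1).card := by
  have h1 := Finset.sum_card_bipartiteAbove_eq_sum_card_bipartiteBelow
    (s := T.edges.filter fun F => z ∈ F)
    (t := Finset.univ.filter fun K : T.triangles => z ∈ K.1) (fun F K => F ⊆ K.1)
  have h2 : ∀ K ∈ Finset.univ.filter fun K : T.triangles => z ∈ K.1,
      (Finset.bipartiteBelow (fun (F : Finset Plane) (K : T.triangles) => F ⊆ K.1)
        (T.edges.filter fun F => z ∈ F) K).card = 2 := fun K hK =>
    card_edges_at K (Finset.mem_filter.1 hK).2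
  rw [Finset.sum_congr rfl h2, Finset.sum_const, smul_eq_mul, mul_comm _ 2,
    ← Finset.sum_filter_add_sum_filter_not _ (fun F => T.IsBoundaryEdge F)] at h1
  rw [← h1, Finset.filter_filter, Finset.filter_filter]
  congr 1
  · rw [Finset.card_eq_sum_ones]
    refine Finset.sum_congr rfl fun F hF => ?_
    obtain ⟨hF, hzF, hb⟩ := Finset.mem_filter.1 hF
    obtain ⟨A, hA, -, hu⟩ := exists_of_isBoundaryEdge hF hb
    rw [eq_comm, Finset.card_eq_one]
    refine ⟨A, ?_⟩
    ext K
    simp only [Finset.mem_bipartiteAbove, Finset.mem_filter, Finset.mem_univ, true_and,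
      Finset.mem_singleton]
    exact ⟨fun h => hu K h.2, fun h => by rw [h]; exact ⟨hA hzF, hA⟩⟩
  · rw [mul_comm, ← smul_eq_mul, ← Finset.sum_const]
    refine Finset.sum_congr rfl fun F hF => ?_
    obtain ⟨hF, hzF, hb⟩ := Finset.mem_filter.1 hF
    obtain ⟨A, B, hA, hB, hAB, -, -, hu⟩ := exists_of_not_isBoundaryEdge hF hb
    rw [eq_comm, Finset.card_eq_two]
    refine ⟨A, B, hAB, ?_⟩
    ext K
    simp only [Finset.mem_bipartiteAbove, Finset.mem_filter, Finset.mem_univ, true_and,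
      Finset.mem_insert, Finset.mem_singleton]
    refine ⟨fun h => hu K h.2, ?_⟩
    rintro (rfl | rfl)
    · exact ⟨hA hzF, hA⟩
    · exact ⟨hB hzF, hB⟩

open Classical in
/-- There are exactly two boundary edges at each boundary vertex. -/
theorem card_boundaryEdges_at {K : T.triangles} {z : Plane} (hz : z ∈ K.1) (hzΩ : z ∉ T.Ω) :
    (T.edges.filter fun F => z ∈ F ∧ T.IsBoundaryEdge F).card = 2 := by
  -- With t triangles, i interior and b boundary edges at z: t ≤ i + 1 and b + 2i = 2t make b even
  -- and at most two, and b is positive.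
  have h1 := card_star_le hz
  have h2 := card_boundary_add (T := T) (z := z)
  obtain ⟨F, hF, hzF, hb⟩ := exists_isBoundaryEdge hz hzΩ
  have h3 : 0 < (T.edges.filter fun F => z ∈ F ∧ T.IsBoundaryEdge F).card :=
    Finset.card_pos.2 ⟨F, Finset.mem_filter.2 ⟨hF, hzF, hb⟩⟩
  omega

end Mesh

/-- The Fredholm alternative for a bilinear form with a finite-dimensional test space. -/
theorem exists_eq_of_annihilates {X Y : Type*} [AddCommGroup X] [Module ℝ X] [AddCommGroup Y]
    [Module ℝ Y] [FiniteDimensional ℝ Y] (B : X →ₗ[ℝ] Y →ₗ[ℝ] ℝ) (l : Y →ₗ[ℝ] ℝ)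
    (h : ∀ y, (∀ x, B x y = 0) → l y = 0) : ∃ x, B x = l := by
  have h1 : l ∈ (LinearMap.range B).dualCoannihilator.dualAnnihilator := by
    rw [Submodule.mem_dualAnnihilator]
    intro y hy
    rw [Submodule.mem_dualCoannihilator] at hy
    exact h y fun x => hy _ ⟨x, rfl⟩
  rw [Subspace.dualCoannihilator_dualAnnihilator_eq] at h1
  exact h1

namespace Mesh

variable {T : Mesh}

/-! ### Linearity of traces -/

theorem minus_add (F : Finset Plane) (h h' : T.triangles → ℝ) :
    T.minus F (fun K => h K + h' K) = T.minus F h + T.minus F h' := by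
  rw [minus, minus, minus, ← Finset.sum_add_distrib]
  exact Finset.sum_congr rfl fun K _ => by split_ifs <;> simp

theorem minus_mul (F : Finset Plane) (c : ℝ) (h : T.triangles → ℝ) :
    T.minus F (fun K => c * h K) = c * T.minus F h := by
  rw [minus, minus, Finset.mul_sum]
  exact Finset.sum_congr rfl fun K _ => by split_ifs <;> simp

theorem plus_add (F : Finset Plane) (h h' : T.triangles → ℝ) :
    T.plus F (fun K => h K + h' K) = T.plus F h + T.plus F h' := by
  rw [plus, plus, plus, ← Finset.sum_add_distrib]
  exact Finset.sum_congr rfl fun K _ => by split_ifs <;> simp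

theorem plus_mul (F : Finset Plane) (c : ℝ) (h : T.triangles → ℝ) :
    T.plus F (fun K => c * h K) = c * T.plus F h := by
  rw [plus, plus, Finset.mul_sum]
  exact Finset.sum_congr rfl fun K _ => by split_ifs <;> simp

theorem normalComp_add (τ τ' : T.VectorField) (F : Finset Plane) (x : Plane) (K : T.triangles) :
    normalComp (τ + τ') F x K = normalComp τ F x K + normalComp τ' F x K := by
  simp only [normalComp, Pi.add_apply, map_add, add_mul, Finset.sum_add_distrib]

theorem normalComp_smul (c : ℝ) (τ : T.VectorField) (F : Finset Plane) (x : Plane)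
    (K : T.triangles) : normalComp (c • τ) F x K = c * normalComp τ F x K := by
  simp only [normalComp, Pi.smul_apply, smul_eval, Finset.mul_sum, mul_assoc]

theorem normalTrace_add (τ τ' : T.VectorField) (F : Finset Plane) (x : Plane) :
    normalTrace (τ + τ') F x = normalTrace τ F x + normalTrace τ' F x := by
  rw [normalTrace, normalTrace, normalTrace, ← minus_add]
  exact congrArg _ (funext fun K => normalComp_add τ τ' F x K)

theorem normalTrace_smul (c : ℝ) (τ : T.VectorField) (F : Finset Plane) (x : Plane) :
    normalTrace (c • τ) F x = c * normalTrace τ F x := by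
  rw [normalTrace, normalTrace, ← minus_mul]
  exact congrArg _ (funext fun K => normalComp_smul c τ F x K)

theorem normalTrace_zero (F : Finset Plane) (x : Plane) :
    normalTrace (0 : T.VectorField) F x = 0 := by
  have := normalTrace_smul 0 (0 : T.VectorField) F x
  rwa [zero_smul, zero_mul] at this

open Classical in
theorem jump_eq_sum (v : T.Broken) (F : Finset Plane) (x : Plane) :
    jump v F x = ∑ K : T.triangles, if F ⊆ K.1 then T.sgn F K.1 * eval x.ofLp (v K) else 0 :=
  minus_sub_plus F _

theorem jump_add (v v' : T.Broken) (F : Finset Plane) (x : Plane) :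
    jump (v + v') F x = jump v F x + jump v' F x := by
  simp only [jump, Pi.add_apply, map_add, minus_add, plus_add]; ring

theorem jump_smul (c : ℝ) (v : T.Broken) (F : Finset Plane) (x : Plane) :
    jump (c • v) F x = c * jump v F x := by
  simp only [jump, Pi.smul_apply, smul_eval, minus_mul, plus_mul]; ring

/-- The normal component from either side is the normal trace. -/
theorem normalComp_eq_normalTrace {τ : T.VectorField} (hτ : T.IsHdiv τ) {F : Finset Plane}
    (hF : F ∈ T.edges) {K : T.triangles} (hFK : F ⊆ K.1) {x : Plane} (hx : x ∈ hull F) :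
    normalComp τ F x K = normalTrace τ F x := by
  unfold normalTrace
  by_cases hb : T.IsBoundaryEdge F
  · obtain ⟨A, hA, hu, -, hm, -⟩ := minus_plus_of_isBoundaryEdge hF hb
    rw [hm, hu K hFK]
  · have h := (isHdiv_iff τ).1 hτ F hF hb x hx
    obtain ⟨A, B, -, -, -, hu, hm, hp⟩ := minus_plus_of_not_isBoundaryEdge hF hb
    rcases hu K hFK with rfl | rfl
    · rw [hm]
    · rw [h, hp]

theorem normalTrace_eq_of_forall {τ : T.VectorField} {F : Finset Plane} (hF : F ∈ T.edges)
    {x : Plane} {r : ℝ} (h : ∀ K : T.triangles, F ⊆ K.1 → normalComp τ F x K = r) :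
    normalTrace τ F x = r := by
  unfold normalTrace
  by_cases hb : T.IsBoundaryEdge F
  · obtain ⟨A, hA, -, -, hm, -⟩ := minus_plus_of_isBoundaryEdge hF hb
    rw [hm, h A hA]
  · obtain ⟨A, B, hA, -, -, -, hm, -⟩ := minus_plus_of_not_isBoundaryEdge hF hb
    rw [hm, h A hA]

theorem isHdiv_of_forall {τ : T.VectorField} {r : Finset Plane → Plane → ℝ}
    (h : ∀ F ∈ T.edges, ∀ x ∈ hull F, ∀ K : T.triangles, F ⊆ K.1 → normalComp τ F x K = r F x) :
    T.IsHdiv τ := by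
  refine (isHdiv_iff τ).2 fun F hF hb x hx => ?_
  obtain ⟨A, B, hA, hB, -, -, hm, hp⟩ := minus_plus_of_not_isBoundaryEdge hF hb
  rw [hm, hp, h F hF x hx A hA, h F hF x hx B hB]

/-! ### The flux spaces as linear spaces -/

variable (T) in
def hdivSpace : Submodule ℝ T.VectorField where
  carrier := {τ | T.IsHdiv τ}
  zero_mem' := isHdiv_of_forall (r := fun _ _ => 0) fun F _ x _ K _ => by simp [normalComp]
  add_mem' h h' := isHdiv_of_forall fun F hF x hx K hK => by
    rw [normalComp_add, normalComp_eq_normalTrace h hF hK hx,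
      normalComp_eq_normalTrace h' hF hK hx]
  smul_mem' c τ h := isHdiv_of_forall fun F hF x hx K hK => by
    rw [normalComp_smul, normalComp_eq_normalTrace h hF hK hx]

variable (T) in
def rtSpace (s : ℕ) : Submodule ℝ T.VectorField where
  carrier := {τ | T.RT s τ}
  zero_mem' := ⟨(T.hdivSpace).zero_mem, fun _ => (LocalRT s).zero_mem⟩
  add_mem' h h' := ⟨(T.hdivSpace).add_mem h.1 h'.1, fun K => (LocalRT s).add_mem (h.2 K) (h'.2 K)⟩
  smul_mem' c _ h := ⟨(T.hdivSpace).smul_mem c h.1, fun K => (LocalRT s).smul_mem c (h.2 K)⟩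

theorem rTRing_iff {s : ℕ} {τ : T.VectorField} : T.RTRing s τ ↔ T.IsHdiv τ ∧
    (∀ K, τ K ∈ LocalRTRing K s) ∧ ∀ F ∈ T.neumannEdges, ∀ x ∈ hull F, normalTrace τ F x = 0 :=
  ⟨fun h => ⟨h.1.1, fun K => ⟨h.1.2 K, fun hs ψ hψ => h.2.1 hs K ψ hψ⟩, h.2.2⟩,
    fun h => ⟨⟨h.1, fun K => (h.2.1 K).1⟩, fun hs K ψ hψ => (h.2.1 K).2 hs ψ hψ, h.2.2⟩⟩

variable (T) in
def rtRingSpace (s : ℕ) : Submodule ℝ T.VectorField where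
  carrier := {τ | T.RTRing s τ}
  zero_mem' := rTRing_iff.2 ⟨(T.hdivSpace).zero_mem, fun _ => Submodule.zero_mem _,
    fun F _ x _ => normalTrace_zero F x⟩
  add_mem' h h' := by
    have h := rTRing_iff.1 h
    have h' := rTRing_iff.1 h'
    exact rTRing_iff.2 ⟨(T.hdivSpace).add_mem h.1 h'.1,
      fun K => Submodule.add_mem _ (h.2.1 K) (h'.2.1 K), fun F hF x hx => by
        rw [normalTrace_add, h.2.2 F hF x hx, h'.2.2 F hF x hx, add_zero]⟩
  smul_mem' c _ h := by
    have h := rTRing_iff.1 h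
    exact rTRing_iff.2 ⟨(T.hdivSpace).smul_mem c h.1,
      fun K => Submodule.smul_mem _ c (h.2.1 K), fun F hF x hx => by
        rw [normalTrace_smul, h.2.2 F hF x hx, mul_zero]⟩

variable (T) in
def patchRTSpace (z : Plane) (s : ℕ) : Submodule ℝ T.VectorField where
  carrier := {τ | T.PatchRT z s τ}
  zero_mem' := ⟨(T.rtRingSpace s).zero_mem, fun _ _ => rfl, fun F _ _ x _ => normalTrace_zero F x⟩
  add_mem' h h' := ⟨(T.rtRingSpace s).add_mem h.1 h'.1,
    fun K hK => by rw [Pi.add_apply, h.2.1 K hK, h'.2.1 K hK, add_zero],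
    fun F hF hz x hx => by rw [normalTrace_add, h.2.2 F hF hz x hx, h'.2.2 F hF hz x hx, add_zero]⟩
  smul_mem' c _ h := ⟨(T.rtRingSpace s).smul_mem c h.1,
    fun K hK => by rw [Pi.smul_apply, h.2.1 K hK, smul_zero],
    fun F hF hz x hx => by rw [normalTrace_smul, h.2.2 F hF hz x hx, mul_zero]⟩

variable (T) in
def patchDGSpace (z : Plane) (s : ℕ) : Submodule ℝ T.Broken where
  carrier := {v | T.PatchDG z s v}
  zero_mem' := ⟨fun _ => Submodule.zero_mem _, fun _ _ => rfl⟩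
  add_mem' h h' := ⟨fun K => Submodule.add_mem _ (h.1 K) (h'.1 K),
    fun K hK => by rw [Pi.add_apply, h.2 K hK, h'.2 K hK, add_zero]⟩
  smul_mem' c _ h := ⟨fun K => Submodule.smul_mem _ c (h.1 K),
    fun K hK => by rw [Pi.smul_apply, h.2 K hK, smul_zero]⟩

instance (z : Plane) (s : ℕ) : FiniteDimensional ℝ (T.patchDGSpace z s) := by
  let φ : T.patchDGSpace z s →ₗ[ℝ] (T.triangles → PolyLE s) :=
    { toFun := fun v K => ⟨v.1 K, v.2.1 K⟩
      map_add' := fun _ _ => rfl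
      map_smul' := fun _ _ => rfl }
  refine FiniteDimensional.of_injective φ fun v w h => Subtype.ext (funext fun K => ?_)
  exact congrArg Subtype.val (congrFun h K)

/-- A field of the correction space is determined by its normal traces. -/
theorem eq_zero_of_normalTrace {s : ℕ} {τ : T.VectorField} (hτ : T.RTRing s τ)
    (h0 : ∀ F ∈ T.edges, ∀ x ∈ hull F, normalTrace τ F x = 0) : τ = 0 := by
  classical
  have h := rTRing_iff.1 hτ
  funext K
  refine eq_zero_of_mem_localRTRing (h.2.1 K) fun c hc x hx => ?_
  exact (normalComp_eq_normalTrace h.1 (erase_mem_edges K hc) (Finset.erase_subset _ _) hx).trans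
    (h0 _ (erase_mem_edges K hc) x hx)

/-- There is a field of the correction space with prescribed polynomial normal traces. -/
theorem exists_patchRT {z : Plane} {s : ℕ} (p : Finset Plane → MvPolynomial (Fin 2) ℝ)
    (hp : ∀ F, p F ∈ PolyLE s) (hz : ∀ F, z ∉ F → p F = 0) (hN : ∀ F ∈ T.neumannEdges, p F = 0) :
    ∃ τ, T.PatchRT z s τ ∧ ∀ F ∈ T.edges, ∀ x ∈ hull F, normalTrace τ F x = eval x.ofLp (p F) := by
  classical
  -- The field is assembled triangle by triangle. It lies in H(div) because both triangles at an
  -- edge F receive the same normal trace p F.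
  have hloc : ∀ K : T.triangles, ∃ τ ∈ LocalRTRing K s, ∀ c ∈ K.1, ∀ x ∈ hull (K.1.erase c),
      ∑ i, eval x.ofLp (τ i) * T.normal (K.1.erase c) i = eval x.ofLp (p (K.1.erase c)) := by
    intro K
    choose τ hτ hτn using fun c : K.1 => exists_localRTRing K c.2 (hp (K.1.erase c))
    refine ⟨∑ c, τ c, Submodule.sum_mem _ fun c _ => hτ c, fun c hc x hx => ?_⟩
    simp only [Finset.sum_apply, map_sum, Finset.sum_mul]
    rw [Finset.sum_comm, Finset.sum_congr rfl fun c' _ => hτn c' c hc x hx,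
      Finset.sum_eq_single ⟨c, hc⟩]
    · simp
    · intro c' _ hne
      exact if_neg fun h => hne (Subtype.ext h.symm)
    · simp
  choose τ hτ hτn using hloc
  have hcomp : ∀ F ∈ T.edges, ∀ x ∈ hull F, ∀ K : T.triangles, F ⊆ K.1 →
      normalComp τ F x K = eval x.ofLp (p F) := by
    intro F hF x hx K hK
    obtain ⟨c, hc, rfl⟩ := exists_eq_erase hF hK
    exact hτn K c hc x hx
  have htr : ∀ F ∈ T.edges, ∀ x ∈ hull F, normalTrace τ F x = eval x.ofLp (p F) :=
    fun F hF x hx => normalTrace_eq_of_forall hF fun K hK => hcomp F hF x hx K hK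
  refine ⟨τ, ⟨rTRing_iff.2 ⟨isHdiv_of_forall hcomp, hτ, fun F hF x hx => ?_⟩, fun K hK => ?_,
    fun F hF hzF x hx => ?_⟩, htr⟩
  · have : F ∈ T.edges := (Finset.mem_filter.1 hF).1
    rw [htr F this x hx, hN F hF, map_zero]
  -- Off the patch all prescribed traces are zero, so unisolvence makes the local field vanish.
  · refine eq_zero_of_mem_localRTRing (hτ K) fun c hc x hx => ?_
    rw [hτn K c hc x hx, hz _ fun h => hK (Finset.erase_subset _ _ h), map_zero]
  · rw [htr F hF x hx, hz F hzF, map_zero]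

/-- The normal trace on an edge is a polynomial. -/
theorem exists_normalTrace_eq {s : ℕ} {τ : T.VectorField} (hτ : T.RT s τ) {F : Finset Plane}
    (hF : F ∈ T.edges) : ∃ p ∈ PolyLE s, ∀ x ∈ hull F, normalTrace τ F x = eval x.ofLp p := by
  obtain ⟨K, hK⟩ := exists_triangle_of_face (mem_edges.1 hF).1
  obtain ⟨p, hp, h⟩ := exists_normal_polyLE (hτ.2 K) hF
  exact ⟨p, hp, fun x hx => (normalComp_eq_normalTrace hτ.1 hF hK hx).symm.trans (h x hx)⟩

/-- The normal trace is itself a polynomial p of degree at most s, so p - q is an admissible test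
function. -/
theorem normalTrace_eq_of_moments {s : ℕ} {τ : T.VectorField} (hτ : T.RT s τ) {F : Finset Plane}
    (hF : F ∈ T.edges) {q : MvPolynomial (Fin 2) ℝ} (hq : q ∈ PolyLE s)
    (h : ∀ p ∈ PolyLE s, edgeIntegral F (fun x => normalTrace τ F x * eval x.ofLp p)
      = edgeIntegral F (fun x => eval x.ofLp q * eval x.ofLp p)) :
    ∀ x ∈ hull F, normalTrace τ F x = eval x.ofLp q := by
  obtain ⟨p, hp, hpt⟩ := exists_normalTrace_eq hτ hF
  have hFc := (mem_edges.1 hF).2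
  have h1 := h (p - q) (Submodule.sub_mem _ hp hq)
  rw [edgeIntegral_congr (h' := fun x => eval x.ofLp p * eval x.ofLp (p - q))
    fun x hx => by rw [hpt x hx], ← sub_eq_zero, ← edgeIntegral_sub hFc (by fun_prop)
    (by fun_prop)] at h1
  have h2 := eqOn_zero_of_edgeIntegral_eq_zero hFc (by fun_prop)
    (fun x _ => by rw [← sub_mul, ← map_sub]; exact mul_self_nonneg _) h1
  intro x hx
  have h3 := h2 x hx
  rw [← sub_mul, ← map_sub] at h3
  rw [hpt x hx, ← sub_eq_zero, ← map_sub]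
  exact mul_self_eq_zero.1 h3

end Mesh

namespace Mesh

variable {T : Mesh}

/-! ### Edge moments -/

/-- The `L²` inner product of polynomials on an edge. -/
def edgeForm (F : Finset Plane) (hF : F.card = 2) :
    MvPolynomial (Fin 2) ℝ →ₗ[ℝ] MvPolynomial (Fin 2) ℝ →ₗ[ℝ] ℝ :=
  LinearMap.mk₂ ℝ (fun p q => edgeIntegral F fun x => eval x.ofLp p * eval x.ofLp q)
    (fun p p' q => by
      rw [← edgeIntegral_add hF (by fun_prop) (by fun_prop)]
      simp only [map_add, add_mul])
    (fun c p q => by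
      rw [smul_eq_mul, ← edgeIntegral_const_mul]
      simp only [smul_eval, mul_assoc])
    (fun p q q' => by
      rw [← edgeIntegral_add hF (by fun_prop) (by fun_prop)]
      simp only [map_add, mul_add])
    (fun c p q => by
      rw [smul_eq_mul, ← edgeIntegral_const_mul]
      simp only [smul_eval, mul_left_comm])

/-- The evaluation at a vertex of an edge is represented by a polynomial. -/
theorem exists_vertex_polynomial {F : Finset Plane} (hF : F.card = 2) {z : Plane} (hz : z ∈ F)
    (s : ℕ) : ∃ e ∈ PolyLE s, ∀ p ∈ PolyLE s,
      edgeIntegral F (fun x => eval x.ofLp e * eval x.ofLp p) = eval z.ofLp p := by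
  let B : PolyLE s →ₗ[ℝ] PolyLE s →ₗ[ℝ] ℝ := (edgeForm F hF).compl₁₂ (PolyLE s).subtype
    (PolyLE s).subtype
  have hB : ∀ p q, B p q = edgeIntegral F fun x => eval x.ofLp p.1 * eval x.ofLp q.1 :=
    fun _ _ => rfl
  let l : PolyLE s →ₗ[ℝ] ℝ := (aeval z.ofLp : _ →ₐ[ℝ] ℝ).toLinearMap ∘ₗ (PolyLE s).subtype
  have hl : ∀ p, l p = eval z.ofLp p.1 := fun p => rfl
  -- The edge form is degenerate on polynomials in the plane, but its null vectors vanish on the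
  -- edge and so at z, which is all the Fredholm alternative needs.
  obtain ⟨e, he⟩ := exists_eq_of_annihilates B l fun q hq => by
    have h1 := hq q
    rw [hB] at h1
    rw [hl]
    exact mul_self_eq_zero.1 (eqOn_zero_of_edgeIntegral_eq_zero hF (by fun_prop)
      (fun x _ => mul_self_nonneg _) h1 z (subset_convexHull ℝ _ hz))
  exact ⟨e.1, e.2, fun p hp => by rw [← hB e ⟨p, hp⟩, he, hl]⟩

/-! ### The orientation of the edges at a vertex -/

/-- Rotation by a right angle. -/
def rot (w : Plane) : Plane := !₂[-w 1, w 0]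

theorem inner_plane (v w : Plane) : ⟪v, w⟫ = v 0 * w 0 + v 1 * w 1 := by
  simp [PiLp.inner_apply, Fin.sum_univ_two, mul_comm]

theorem inner_rot_comm (v w : Plane) : ⟪v, rot w⟫ = -⟪w, rot v⟫ := by
  simp only [inner_plane, rot]
  simp
  ring

theorem inner_rot_self (v : Plane) : ⟪v, rot v⟫ = 0 := by
  simp only [inner_plane, rot]
  simp
  ring

theorem inner_rot_rot (v : Plane) : ⟪rot v, rot v⟫ = ⟪v, v⟫ := by
  simp only [inner_plane, rot]
  simp
  ring

variable (T) in
/-- The sign that makes the normal of the edge `F` turn counterclockwise around its vertex `z`. -/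
def orient (z : Plane) (F : Finset Plane) : ℝ :=
  SignType.sign (∑ y ∈ F, ⟪T.normal F, rot (y - z)⟫)

open Classical in
-- The sign of the coordinate of b at z + rot (a - z) tells whether a counterclockwise turn about z,
-- starting on the edge za, enters K. The second part identifies it with the sign of ⟪b - z, rot (a
-- - z)⟫, which is antisymmetric in a and b.
theorem sgn_mul_orient {K : T.triangles} {z a b : Plane} (hz : z ∈ K.1) (ha : a ∈ K.1)
    (hb : b ∈ K.1) (haz : a ≠ z) (hbz : b ≠ z) (hab : a ≠ b) :
    T.sgn (K.1.erase b) K.1 * T.orient z (K.1.erase b)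
      = -SignType.sign (T.bary K b (z + rot (a - z))) ∧
    0 < T.bary K b (z + rot (a - z)) * ⟪b - z, rot (a - z)⟫ := by
  have hK : K.1 = {z, a, b} := by
    refine (Finset.eq_of_subset_of_card_le (fun x hx => ?_) ?_).symm
    · simp only [Finset.mem_insert, Finset.mem_singleton] at hx
      rcases hx with rfl | rfl | rfl <;> assumption
    · rw [T.card_triangle K, Finset.card_eq_three.2 ⟨z, a, b, haz.symm, hbz.symm, hab, rfl⟩]
  have hE : K.1.erase b = {z, a} := by
    rw [hK]; ext x; simp only [Finset.mem_erase, Finset.mem_insert, Finset.mem_singleton]; grind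
  set w := rot (a - z) with hw
  have hsum : ∑ y ∈ K.1.erase b, ⟪T.normal (K.1.erase b), rot (y - z)⟫
      = ⟪T.normal (K.1.erase b), w⟫ := by
    conv_lhs => rw [show ∑ y ∈ K.1.erase b, ⟪T.normal (K.1.erase b), rot (y - z)⟫
      = ∑ y ∈ ({z, a} : Finset Plane), ⟪T.normal (K.1.erase b), rot (y - z)⟫ by rw [hE]]
    rw [Finset.sum_pair haz.symm]
    have : ⟪T.normal (K.1.erase b), rot (z - z)⟫ = 0 := by
      rw [sub_self, inner_plane]; simp [rot]
    rw [this, zero_add]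
  have hexp : w = T.bary K a (z + w) • (a - z) + T.bary K b (z + w) • (b - z) := by
    have h3 : w = ∑ y ∈ K.1, T.bary K y (z + w) • (y - z) := by
      simp only [smul_sub, Finset.sum_sub_distrib]
      rw [sum_bary_smul, ← Finset.sum_smul, sum_bary, one_smul, add_sub_cancel_left]
    have hS : ∀ f : Plane → Plane, ∑ y ∈ K.1, f y = f z + f a + f b := fun f => by
      rw [hK, Finset.sum_insert (by simp [haz.symm, hbz.symm]), Finset.sum_insert (by simp [hab]),
        Finset.sum_singleton, add_assoc]
    conv_lhs => rw [h3]
    rw [hS]; simp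
  have hpos : 0 < T.bary K b (z + w) * ⟪b - z, w⟫ := by
    have h1 : ⟪w, w⟫ = T.bary K b (z + w) * ⟪b - z, w⟫ := by
      conv_lhs => enter [2]; rw [hexp]
      rw [inner_add_left, inner_smul_left, inner_smul_left, hw, inner_rot_self]
      simp
    rw [← h1, hw, inner_rot_rot]
    exact real_inner_self_pos.2 (sub_ne_zero.2 haz)
  refine ⟨?_, hpos⟩
  obtain ⟨κ, hκ, hh⟩ := exists_height K hb
  have h1 := hh (z + w) z (Finset.mem_erase.2 ⟨hbz.symm, hz⟩)
  rw [add_sub_cancel_left] at h1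
  rw [orient, hsum, h1, neg_mul, Left.sign_neg, sign_mul, sign_mul, sign_pos hκ, mul_one]
  have h2 : ((SignType.sign (T.sgn (K.1.erase b) K.1) : SignType) : ℝ)
      = T.sgn (K.1.erase b) K.1 := by
    unfold sgn; split_ifs <;> simp
  rw [SignType.coe_neg, SignType.coe_mul, h2]
  linear_combination
    (-(SignType.sign (T.bary K b (z + w)) : ℝ)) * sgn_mul_self (T := T) (K.1.erase b) K.1

open Classical in
/-- The two oriented edges of a triangle at a vertex enter and leave it, respectively. -/
theorem sgn_mul_orient_add {K : T.triangles} {z a b : Plane} (hz : z ∈ K.1) (ha : a ∈ K.1)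
    (hb : b ∈ K.1) (haz : a ≠ z) (hbz : b ≠ z) (hab : a ≠ b) :
    T.sgn (K.1.erase a) K.1 * T.orient z (K.1.erase a)
      + T.sgn (K.1.erase b) K.1 * T.orient z (K.1.erase b) = 0 := by
  obtain ⟨h1, p1⟩ := sgn_mul_orient hz ha hb haz hbz hab
  obtain ⟨h2, p2⟩ := sgn_mul_orient hz hb ha hbz haz hab.symm
  rw [h1, h2]
  rw [inner_rot_comm] at p2
  rcases lt_trichotomy 0 (T.bary K b (z + rot (a - z))) with h | h | h
  · have : T.bary K a (z + rot (b - z)) < 0 := by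
      have := pos_of_mul_pos_right p1 h.le
      nlinarith
    rw [sign_pos h, sign_neg this]; simp
  · rw [← h] at p1; simp at p1
  · have hX : ⟪b - z, rot (a - z)⟫ < 0 := by
      by_contra hcon
      exact absurd p1 (not_lt.2 (mul_nonpos_of_nonpos_of_nonneg h.le (not_lt.1 hcon)))
    have : 0 < T.bary K a (z + rot (b - z)) := by
      by_contra hcon
      nlinarith
    rw [sign_neg h, sign_pos this]; simp

theorem orient_mul_self {z : Plane} {F : Finset Plane} (hF : F ∈ T.edges) (hz : z ∈ F) :
    T.orient z F * T.orient z F = 1 := by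
  classical
  obtain ⟨K, hK⟩ := exists_triangle_of_face (mem_edges.1 hF).1
  obtain ⟨b, hb, rfl⟩ := exists_eq_erase hF hK
  obtain ⟨hzb, hzK⟩ := Finset.mem_erase.1 hz
  obtain ⟨a, ha, haz⟩ := Finset.exists_mem_ne (s := K.1.erase b)
    (by rw [card_erase_triangle K hb]; norm_num) z
  obtain ⟨hab, haK⟩ := Finset.mem_erase.1 ha
  obtain ⟨h1, h2⟩ := sgn_mul_orient hzK haK hb haz hzb.symm hab
  have h3 : T.bary K b (z + rot (a - z)) ≠ 0 := fun h => by rw [h] at h2; simp at h2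
  have h4 : ((SignType.sign (T.bary K b (z + rot (a - z))) : SignType) : ℝ)
      * SignType.sign (T.bary K b (z + rot (a - z))) = 1 := by
    rcases lt_or_gt_of_ne h3 with h | h
    · rw [sign_neg h]; norm_num
    · rw [sign_pos h]; norm_num
  have h5 := sgn_mul_self (T := T) (K.1.erase b) K.1
  calc T.orient z (K.1.erase b) * T.orient z (K.1.erase b)
      = (T.sgn (K.1.erase b) K.1 * T.sgn (K.1.erase b) K.1)
        * (T.orient z (K.1.erase b) * T.orient z (K.1.erase b)) := by rw [h5, one_mul]
    _ = (T.sgn (K.1.erase b) K.1 * T.orient z (K.1.erase b))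
        * (T.sgn (K.1.erase b) K.1 * T.orient z (K.1.erase b)) := by ring
    _ = 1 := by rw [h1, neg_mul_neg, h4]

/-! ### The patch form, triangle by triangle -/

theorem mem_activeEdges {F : Finset Plane} :
    F ∈ T.activeEdges ↔ F ∈ T.edges ∧ F ∉ T.neumannEdges := by
  simp [activeEdges]

open Classical in
theorem sum_erase_at (K : T.triangles) (z : Plane) (h : Finset Plane → ℝ) :
    ∑ F ∈ T.edges.filter (fun F => z ∈ F), (if F ⊆ K.1 then h F else 0)
      = if z ∈ K.1 then ∑ c ∈ K.1.erase z, h (K.1.erase c) else 0 := by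
  split_ifs with hz
  · have h1 := sum_erase K fun F => if z ∈ F then h F else 0
    rw [← Finset.add_sum_erase _ _ hz, if_neg (Finset.notMem_erase z K.1), zero_add,
      Finset.sum_filter] at h1
    rw [Finset.sum_filter]
    refine Eq.trans (Finset.sum_congr rfl fun F _ => ?_) (h1.symm.trans
      (Finset.sum_congr rfl fun c hc => if_pos ?_))
    · by_cases h2 : z ∈ F <;> by_cases h3 : F ⊆ K.1 <;> simp [h2, h3]
    · exact Finset.mem_erase.2 ⟨(Finset.mem_erase.1 hc).1.symm, hz⟩
  · exact Finset.sum_eq_zero fun F hF => if_neg fun h => hz (h (Finset.mem_filter.1 hF).2)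

open Classical in
theorem edgeIntegral_mul_jump (τ : T.VectorField) (v : T.Broken) {F : Finset Plane}
    (hF : F ∈ T.edges) : edgeIntegral F (fun x => normalTrace τ F x * jump v F x)
      = ∑ K : T.triangles, if F ⊆ K.1 then
          T.sgn F K.1 * edgeIntegral F (fun x => normalTrace τ F x * eval x.ofLp (v K)) else 0 := by
  have h1 : ∀ x, normalTrace τ F x * jump v F x = ∑ K : T.triangles, if F ⊆ K.1 then
      T.sgn F K.1 * (normalTrace τ F x * eval x.ofLp (v K)) else 0 := by
    intro x
    rw [jump_eq_sum, Finset.mul_sum]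
    refine Finset.sum_congr rfl fun K _ => ?_
    split_ifs
    · ring
    · rw [mul_zero]
  have hc := continuous_normalTrace τ F
  simp only [h1]
  rw [edgeIntegral_sum (mem_edges.1 hF).2]
  · refine Finset.sum_congr rfl fun K _ => ?_
    split_ifs
    · rw [edgeIntegral_const_mul]
    · rw [edgeIntegral_zero]
  · intro K
    split_ifs
    · fun_prop
    · fun_prop

open Classical in
-- Neumann edges may be included, since the normal traces of the correction space vanish on them.
theorem patchForm_eq {s : ℕ} (z : Plane) {τ : T.VectorField} (hτ : T.RTRing s τ) (v : T.Broken) :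
    patchForm z τ v = ∑ F ∈ T.edges.filter (fun F => z ∈ F),
      edgeIntegral F fun x => normalTrace τ F x * jump v F x := by
  refine Finset.sum_subset (fun F hF => ?_) fun F hF hF' => ?_
  · obtain ⟨h1, h2⟩ := Finset.mem_filter.1 hF
    exact Finset.mem_filter.2 ⟨(mem_activeEdges.1 h1).1, h2⟩
  · obtain ⟨h1, h2⟩ := Finset.mem_filter.1 hF
    have hN : F ∈ T.neumannEdges := by
      by_contra h
      exact hF' (Finset.mem_filter.2 ⟨mem_activeEdges.2 ⟨h1, h⟩, h2⟩)
    rw [edgeIntegral_congr (h' := fun _ => 0), edgeIntegral_zero]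
    intro x hx
    rw [hτ.2.2 F hN x hx, zero_mul]

open Classical in
-- Broken test functions are independent on different triangles, so this form of the sum decouples
-- the patch equations.
theorem patchForm_eq_sum {s : ℕ} (z : Plane) {τ : T.VectorField} (hτ : T.RTRing s τ)
    (v : T.Broken) :
    patchForm z τ v = ∑ K : T.triangles, if z ∈ K.1 then ∑ c ∈ K.1.erase z,
      T.sgn (K.1.erase c) K.1 * edgeIntegral (K.1.erase c)
        (fun x => normalTrace τ (K.1.erase c) x * eval x.ofLp (v K)) else 0 := by
  rw [patchForm_eq z hτ, Finset.sum_congr rfl fun F hF =>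
    edgeIntegral_mul_jump τ v (Finset.mem_filter.1 hF).1, Finset.sum_comm]
  exact Finset.sum_congr rfl fun K _ => sum_erase_at K z fun F =>
    T.sgn F K.1 * edgeIntegral F (fun x => normalTrace τ F x * eval x.ofLp (v K))

/-! ### The kernel of the patch problem -/

open Classical in
theorem kernel_triangle {z : Plane} {s : ℕ} {τ : T.VectorField} (hτ : T.IsPatchKernel z s τ)
    {K : T.triangles} (hz : z ∈ K.1) {p : MvPolynomial (Fin 2) ℝ} (hp : p ∈ PolyLE s) :
    ∑ c ∈ K.1.erase z, T.sgn (K.1.erase c) K.1 * edgeIntegral (K.1.erase c)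
        (fun x => normalTrace τ (K.1.erase c) x * eval x.ofLp p) = 0 := by
  have h1 := hτ.2 (Pi.single K p) ⟨fun K' => ?_, fun K' hK' => ?_⟩
  · rw [patchForm_eq_sum z hτ.1.1, Finset.sum_eq_single K] at h1
    · simpa [hz] using h1
    · intro K' _ hne
      simp [Pi.single_eq_of_ne hne, edgeIntegral_zero]
    · simp
  · by_cases h : K' = K
    · subst h; rw [Pi.single_eq_same]; exact hp
    · rw [Pi.single_eq_of_ne h]; exact Submodule.zero_mem _
  · exact Pi.single_eq_of_ne (fun h : K' = K => hK' (by rw [h]; exact hz)) _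

open Classical in
-- Instead of p one tests with p composed with x ↦ x - λ_b(x)(b - z). This projection fixes the side
-- `K.1.erase b` and collapses `K.1.erase a` to z, so on the latter only the value of p at z
-- remains.
theorem kernel_pair {z : Plane} {s : ℕ} {τ : T.VectorField} (hτ : T.IsPatchKernel z s τ)
    {K : T.triangles} {a b : Plane} (hz : z ∈ K.1) (ha : a ∈ K.1)
    (hb : b ∈ K.1) (haz : a ≠ z) (hbz : b ≠ z) (hab : a ≠ b) {p : MvPolynomial (Fin 2) ℝ}
    (hp : p ∈ PolyLE s) :
    T.sgn (K.1.erase b) K.1 * edgeIntegral (K.1.erase b)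
        (fun x => normalTrace τ (K.1.erase b) x * eval x.ofLp p)
      = -(T.sgn (K.1.erase a) K.1 * edgeIntegral (K.1.erase a)
        (fun x => normalTrace τ (K.1.erase a) x)) * eval z.ofLp p := by
  have hE : K.1.erase z = {a, b} := by
    refine (Finset.eq_of_subset_of_card_le (fun x hx => ?_) ?_).symm
    · simp only [Finset.mem_insert, Finset.mem_singleton] at hx
      rcases hx with rfl | rfl
      · exact Finset.mem_erase.2 ⟨haz, ha⟩
      · exact Finset.mem_erase.2 ⟨hbz, hb⟩
    · rw [card_erase_triangle K hz, Finset.card_pair hab]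
  have hsub : ∀ c, hull (K.1.erase c) ⊆ hull K.1 := fun c =>
    convexHull_mono (Finset.coe_subset.2 (Finset.erase_subset _ _))
  have h1 := kernel_triangle hτ hz (aeval_mem_polyLE hp fun i => proj_mem_polyLE K b z i)
  have hS : ∀ f : Plane → ℝ, ∑ c ∈ K.1.erase z, f c = f a + f b := fun f => by
    rw [hE, Finset.sum_pair hab]
  rw [hS] at h1
  have hFb : ∀ x ∈ hull (K.1.erase b), eval x.ofLp (aeval (proj K b z) p) = eval x.ofLp p := by
    intro x hx
    rw [eval_aeval_proj, (mem_hull_subset_iff (Finset.erase_subset _ _) (hsub b hx)).1 hx b hb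
      (Finset.notMem_erase _ _), zero_smul, sub_zero]
  have hFa : ∀ x ∈ hull (K.1.erase a), eval x.ofLp (aeval (proj K b z) p) = eval z.ofLp p := by
    intro x hx
    rw [eval_aeval_proj]
    have h0 := (mem_hull_subset_iff (Finset.erase_subset _ _) (hsub a hx)).1 hx a ha
      (Finset.notMem_erase _ _)
    have hsum := sum_bary K x
    have hvec := sum_bary_smul K x
    have hS' : ∀ f : Plane → Plane, ∑ c ∈ K.1.erase z, f c = f a + f b := fun f => by
      rw [hE, Finset.sum_pair hab]
    rw [← Finset.add_sum_erase _ _ hz, hS, h0, zero_add] at hsum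
    rw [← Finset.add_sum_erase _ _ hz, hS', h0, zero_smul, zero_add] at hvec
    have : x - T.bary K b x • (b - z) = z := by
      have e : T.bary K z x = 1 - T.bary K b x := by linarith
      rw [e] at hvec
      conv_lhs => enter [1]; rw [← hvec]
      module
    rw [this]
  rw [edgeIntegral_congr (F := K.1.erase b) fun x hx => by rw [hFb x hx],
    edgeIntegral_congr (F := K.1.erase a)
      (h' := fun x => eval z.ofLp p * normalTrace τ (K.1.erase a) x)
      fun x hx => by rw [hFa x hx, mul_comm], edgeIntegral_const_mul] at h1
  linear_combination h1

open Classical in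
theorem exists_triangle_at {z : Plane} {F : Finset Plane} (hF : F ∈ T.edges) (hz : z ∈ F) :
    ∃ (K : T.triangles) (a b : Plane), z ∈ K.1 ∧ a ∈ K.1 ∧ b ∈ K.1 ∧ a ≠ z ∧ b ≠ z ∧ a ≠ b ∧
      F = K.1.erase b := by
  obtain ⟨K, hK⟩ := exists_triangle_of_face (mem_edges.1 hF).1
  obtain ⟨b, hb, rfl⟩ := exists_eq_erase hF hK
  obtain ⟨hzb, hzK⟩ := Finset.mem_erase.1 hz
  obtain ⟨a, ha, haz⟩ := Finset.exists_mem_ne (s := K.1.erase b)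
    (by rw [card_erase_triangle K hb]; norm_num) z
  obtain ⟨hab, haK⟩ := Finset.mem_erase.1 ha
  exact ⟨K, a, b, hzK, haK, hb, haz, hzb.symm, hab, rfl⟩

/-- On an edge at `z`, the normal trace of a kernel element is a multiple of the polynomial that
represents the evaluation at `z`. -/
theorem kernel_edge {z : Plane} {s : ℕ} {τ : T.VectorField} (hτ : T.IsPatchKernel z s τ)
    {F : Finset Plane} (hF : F ∈ T.edges) (hz : z ∈ F) {p : MvPolynomial (Fin 2) ℝ}
    (hp : p ∈ PolyLE s) :
    edgeIntegral F (fun x => normalTrace τ F x * eval x.ofLp p)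
      = edgeIntegral F (fun x => normalTrace τ F x) * eval z.ofLp p := by
  classical
  obtain ⟨K, a, b, hzK, ha, hb, haz, hbz, hab, rfl⟩ := exists_triangle_at hF hz
  have h1 := kernel_pair hτ hzK ha hb haz hbz hab hp
  -- The choice p = 1 identifies the factor of the value at z with the total flux.
  have h2 := kernel_pair hτ hzK ha hb haz hbz hab (one_mem_polyLE s)
  simp only [map_one, mul_one] at h2
  rw [← h2, mul_assoc] at h1
  exact mul_left_cancel₀ (sgn_ne_zero _ _) h1

/-- The oriented total fluxes of a kernel element through the edges at `z` coincide. -/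
theorem kernel_flux {z : Plane} {s : ℕ} {τ : T.VectorField} (hτ : T.IsPatchKernel z s τ)
    {F F' : Finset Plane} (hF : F ∈ T.edges) (hz : z ∈ F) (hF' : F' ∈ T.edges) (hz' : z ∈ F') :
    T.orient z F * edgeIntegral F (fun x => normalTrace τ F x)
      = T.orient z F' * edgeIntegral F' (fun x => normalTrace τ F' x) := by
  classical
  -- Within one triangle the outward total fluxes of its two sides at z cancel, and so do the
  -- outward signs of the orientation.
  have htri : ∀ K : T.triangles, ∀ F ∈ T.edges, z ∈ F → F ⊆ K.1 → ∀ F' ∈ T.edges, z ∈ F' →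
      F' ⊆ K.1 → T.orient z F * edgeIntegral F (fun x => normalTrace τ F x)
        = T.orient z F' * edgeIntegral F' (fun x => normalTrace τ F' x) := by
    intro K F hF hz hK F' hF' hz' hK'
    obtain ⟨b, hb, rfl⟩ := exists_eq_erase hF hK
    obtain ⟨a, ha, rfl⟩ := exists_eq_erase hF' hK'
    by_cases hab : a = b
    · rw [hab]
    obtain ⟨hzb, hzK⟩ := Finset.mem_erase.1 hz
    obtain ⟨hza, -⟩ := Finset.mem_erase.1 hz'
    have h1 := kernel_pair hτ hzK ha hb hza.symm hzb.symm hab (one_mem_polyLE s)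
    have h2 := sgn_mul_orient_add hzK ha hb hza.symm hzb.symm hab
    simp only [map_one, mul_one] at h1
    have h3 := sgn_mul_self (T := T) (K.1.erase a) K.1
    have h4 := sgn_mul_self (T := T) (K.1.erase b) K.1
    have e1 : T.orient z (K.1.erase b) = -(T.sgn (K.1.erase b) K.1 *
        (T.sgn (K.1.erase a) K.1 * T.orient z (K.1.erase a))) := by
      linear_combination T.sgn (K.1.erase b) K.1 * h2 - T.orient z (K.1.erase b) * h4
    generalize edgeIntegral (K.1.erase b) (fun x => normalTrace τ (K.1.erase b) x) = cb at *
    generalize edgeIntegral (K.1.erase a) (fun x => normalTrace τ (K.1.erase a) x) = ca at *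
    rw [e1]
    linear_combination (-T.sgn (K.1.erase a) K.1 * T.orient z (K.1.erase a)) * h1
      + T.orient z (K.1.erase a) * ca * h3
  obtain ⟨K, hK⟩ := exists_triangle_of_face (mem_edges.1 hF).1
  obtain ⟨K', hK'⟩ := exists_triangle_of_face (mem_edges.1 hF').1
  -- The equality is carried from triangle to triangle across the edges at z.
  have := star_induction (z := z) (p := fun K => ∀ F'' ∈ T.edges, z ∈ F'' → F'' ⊆ K.1 →
      T.orient z F * edgeIntegral F (fun x => normalTrace τ F x)
        = T.orient z F'' * edgeIntegral F'' (fun x => normalTrace τ F'' x))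
    (fun K₁ K₂ E hE hzE h1 h2 h3 E' hE' hzE' h4 => (h3 E hE hzE h1).trans
      (htri K₂ E hE hzE h2 E' hE' hzE' h4))
    (hK hz) (hK' hz') (htri K F hF hz hK)
  exact this F' hF' hz' hK'

/-- One vanishing flux makes all fluxes at z vanish, and with them all moments of the normal traces.
-/
theorem kernel_eq_zero {z : Plane} {s : ℕ} {τ : T.VectorField} (hτ : T.IsPatchKernel z s τ)
    {F : Finset Plane} (hF : F ∈ T.edges) (hz : z ∈ F)
    (h0 : edgeIntegral F (fun x => normalTrace τ F x) = 0) : τ = 0 := by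
  refine eq_zero_of_normalTrace hτ.1.1 fun F' hF' x hx => ?_
  by_cases hz' : z ∈ F'
  · have h1 := kernel_flux hτ hF hz hF' hz'
    rw [h0, mul_zero, eq_comm] at h1
    have h2 : edgeIntegral F' (fun x => normalTrace τ F' x) = 0 :=
      (mul_eq_zero.1 h1).resolve_left fun h => by
        have := orient_mul_self hF' hz'
        rw [h, mul_zero] at this
        exact zero_ne_one this
    have h3 := normalTrace_eq_of_moments hτ.1.1.1 hF' (Submodule.zero_mem _) (fun p hp => by
      rw [kernel_edge hτ hF' hz' hp, h2, zero_mul]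
      simp [edgeIntegral_zero]) x hx
    rw [h3, map_zero]
  · exact hτ.1.2.2 F' hF' hz' x hx

theorem exists_edge_at {K : T.triangles} {z : Plane} (hz : z ∈ K.1) : ∃ F ∈ T.edges, z ∈ F := by
  classical
  obtain ⟨a, ha, haz⟩ := exists_ne_mem (K := K) z
  exact ⟨_, erase_mem_edges K ha, Finset.mem_erase.2 ⟨haz.symm, hz⟩⟩

/-- If there is no Neumann edge at `z`, the kernel contains an element of unit flux. -/
theorem exists_kernel {z : Plane} (s : ℕ) (hN : ∀ F ∈ T.neumannEdges, z ∉ F) :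
    ∃ τ, T.IsPatchKernel z s τ ∧ ∀ F ∈ T.edges, z ∈ F →
      edgeIntegral F (fun x => normalTrace τ F x) = T.orient z F := by
  classical
  have hex : ∀ F : Finset Plane, ∃ e ∈ PolyLE s, F ∈ T.edges → z ∈ F → ∀ p ∈ PolyLE s,
      edgeIntegral F (fun x => eval x.ofLp e * eval x.ofLp p) = eval z.ofLp p := by
    intro F
    by_cases h : F ∈ T.edges ∧ z ∈ F
    · obtain ⟨e, he, h1⟩ := exists_vertex_polynomial (mem_edges.1 h.1).2 h.2 s
      exact ⟨e, he, fun _ _ => h1⟩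
    · exact ⟨0, Submodule.zero_mem _, fun h1 h2 => absurd ⟨h1, h2⟩ h⟩
  choose e he hev using hex
  -- The description of kernel elements leaves this choice: on each edge the representer of
  -- evaluation at z, with the sign of the counterclockwise orientation.
  obtain ⟨τ, hτ, htr⟩ := exists_patchRT (T := T) (z := z) (s := s)
    (fun F => if z ∈ F then T.orient z F • e F else 0)
    (fun F => by
      split_ifs
      · exact Submodule.smul_mem _ _ (he F)
      · exact Submodule.zero_mem _)
    (fun F hF => if_neg hF) (fun F hF => if_neg (hN F hF))
  have hmom : ∀ F ∈ T.edges, z ∈ F → ∀ p ∈ PolyLE s,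
      edgeIntegral F (fun x => normalTrace τ F x * eval x.ofLp p)
        = T.orient z F * eval z.ofLp p := by
    intro F hF hz p hp
    rw [edgeIntegral_congr (h' := fun x => T.orient z F * (eval x.ofLp (e F) * eval x.ofLp p))
      fun x hx => by rw [htr F hF x hx, if_pos hz, smul_eval, mul_assoc],
      edgeIntegral_const_mul, hev F hF hz p hp]
  refine ⟨τ, ⟨hτ, fun v hv => ?_⟩, fun F hF hz => ?_⟩
  · rw [patchForm_eq_sum z hτ.1]
    refine Finset.sum_eq_zero fun K _ => ?_
    split_ifs with hz
    · obtain ⟨a, b, hab, hE⟩ := Finset.card_eq_two.1 (card_erase_triangle K hz)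
      have ha : a ∈ K.1.erase z := by simp [hE]
      have hb : b ∈ K.1.erase z := by simp [hE]
      rw [hE, Finset.sum_pair hab]
      rw [Finset.mem_erase] at ha hb
      rw [hmom _ (erase_mem_edges K ha.2) (Finset.mem_erase.2 ⟨ha.1.symm, hz⟩) _ (hv.1 K),
        hmom _ (erase_mem_edges K hb.2) (Finset.mem_erase.2 ⟨hb.1.symm, hz⟩) _ (hv.1 K)]
      linear_combination eval z.ofLp (v K) * sgn_mul_orient_add hz ha.2 hb.2 ha.1 hb.1 hab
    · rfl
  · have := hmom F hF hz 1 (one_mem_polyLE s)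
    simpa using this

/-- The pairing of normal traces and jumps over a set of edges. -/
def fluxForm (S : Finset (Finset Plane)) (hS : S ⊆ T.edges) :
    T.VectorField →ₗ[ℝ] T.Broken →ₗ[ℝ] ℝ :=
  LinearMap.mk₂ ℝ (fun τ v => ∑ F ∈ S, edgeIntegral F fun x => normalTrace τ F x * jump v F x)
    (fun τ τ' v => by
      rw [← Finset.sum_add_distrib]
      refine Finset.sum_congr rfl fun F hF => ?_
      rw [← edgeIntegral_add (h := fun x => normalTrace τ F x * jump v F x)
        (h' := fun x => normalTrace τ' F x * jump v F x) (mem_edges.1 (hS hF)).2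
        ((continuous_normalTrace τ F).mul (continuous_jump v F))
        ((continuous_normalTrace τ' F).mul (continuous_jump v F))]
      simp only [normalTrace_add, add_mul])
    (fun c τ v => by
      rw [smul_eq_mul, Finset.mul_sum]
      refine Finset.sum_congr rfl fun F hF => ?_
      rw [← edgeIntegral_const_mul]
      simp only [normalTrace_smul, mul_assoc])
    (fun τ v v' => by
      rw [← Finset.sum_add_distrib]
      refine Finset.sum_congr rfl fun F hF => ?_
      rw [← edgeIntegral_add (h := fun x => normalTrace τ F x * jump v F x)
        (h' := fun x => normalTrace τ F x * jump v' F x) (mem_edges.1 (hS hF)).2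
        ((continuous_normalTrace τ F).mul (continuous_jump v F))
        ((continuous_normalTrace τ F).mul (continuous_jump v' F))]
      simp only [jump_add, mul_add])
    (fun c τ v => by
      rw [smul_eq_mul, Finset.mul_sum]
      refine Finset.sum_congr rfl fun F hF => ?_
      rw [← edgeIntegral_const_mul]
      simp only [jump_smul, mul_left_comm])

theorem activeEdges_subset : T.activeEdges ⊆ T.edges := fun _ h => (mem_activeEdges.1 h).1

variable (T) in
open Classical in
def patchBilin (z : Plane) : T.VectorField →ₗ[ℝ] T.Broken →ₗ[ℝ] ℝ :=
  fluxForm (T.activeEdges.filter (fun F => z ∈ F))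
    ((Finset.filter_subset _ _).trans activeEdges_subset)

theorem patchBilin_apply (z : Plane) (τ : T.VectorField) (v : T.Broken) :
    T.patchBilin z τ v = patchForm z τ v := rfl

variable (T) in
def kernelSpace (z : Plane) (s : ℕ) : Submodule ℝ T.VectorField where
  carrier := {τ | T.IsPatchKernel z s τ}
  zero_mem' := ⟨(T.patchRTSpace z s).zero_mem, fun v _ => by
    rw [← patchBilin_apply, map_zero, LinearMap.zero_apply]⟩
  add_mem' {τ τ'} h h' := ⟨(T.patchRTSpace z s).add_mem h.1 h'.1, fun v hv => by
    rw [← patchBilin_apply, map_add, LinearMap.add_apply, patchBilin_apply, patchBilin_apply,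
      h.2 v hv, h'.2 v hv, add_zero]⟩
  smul_mem' c τ h := ⟨(T.patchRTSpace z s).smul_mem c h.1, fun v hv => by
    rw [← patchBilin_apply, map_smul, LinearMap.smul_apply, patchBilin_apply, h.2 v hv,
      smul_zero]⟩

/-! ### Neumann edges and the two classes of vertices -/

theorem mem_vertices {z : Plane} : z ∈ T.vertices ↔ ∃ K : T.triangles, z ∈ K.1 := by
  simp [vertices]

theorem mem_dirichletEdges {F : Finset Plane} : F ∈ T.dirichletEdges ↔
    F ∈ T.edges ∧ T.IsBoundaryEdge F ∧ intrinsicInterior ℝ (hull F) ⊆ T.ΓD := by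
  simp [dirichletEdges]

theorem mem_neumannEdges {F : Finset Plane} : F ∈ T.neumannEdges ↔
    F ∈ T.edges ∧ T.IsBoundaryEdge F ∧ intrinsicInterior ℝ (hull F) ⊆ T.ΓN := by
  simp [neumannEdges]

theorem dirichlet_or_neumann {F : Finset Plane} (hF : F ∈ T.edges) (hb : T.IsBoundaryEdge F) :
    F ∈ T.dirichletEdges ∨ F ∈ T.neumannEdges := by
  rcases T.resolves F (mem_edges.1 hF).1 (mem_edges.1 hF).2 hb with h | h
  · exact Or.inl (mem_dirichletEdges.2 ⟨hF, hb, h⟩)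
  · exact Or.inr (mem_neumannEdges.2 ⟨hF, hb, h⟩)

theorem notMem_neumannEdges {F : Finset Plane} (hF : F ∈ T.dirichletEdges) :
    F ∉ T.neumannEdges := fun hN => by
  obtain ⟨x, hx⟩ : (intrinsicInterior ℝ (hull F)).Nonempty :=
    Set.Nonempty.intrinsicInterior (convex_convexHull ℝ _) (by
      rw [convexHull_nonempty_iff]
      exact Finset.card_pos.1 (by
        rw [(mem_edges.1 (mem_dirichletEdges.1 hF).1).2]; norm_num))
  exact Set.disjoint_left.1 T.disjoint ((mem_dirichletEdges.1 hF).2.2 hx)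
    ((mem_neumannEdges.1 hN).2.2 hx)

/-- A Neumann edge would be a third boundary edge next to the two Dirichlet edges. -/
theorem notMem_of_mem_neumannEdges {z : Plane} (hz : z ∈ T.starVertices) {F : Finset Plane}
    (hF : F ∈ T.neumannEdges) : z ∉ F := by
  classical
  intro hzF
  obtain ⟨hFe, hFb, -⟩ := mem_neumannEdges.1 hF
  have hzΩ : z ∉ T.Ω := notMem_domain_of_mem_frontier (hFb (subset_convexHull ℝ _ hzF))
  obtain ⟨hv, h⟩ := Finset.mem_filter.1 hz
  obtain ⟨D, hD, D', hD', hne, hzD, hzD'⟩ := h.resolve_left hzΩ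
  obtain ⟨K, hK⟩ := mem_vertices.1 hv
  have h2 := card_boundaryEdges_at hK hzΩ
  have hsub : {D, D', F} ⊆ T.edges.filter fun F => z ∈ F ∧ T.IsBoundaryEdge F := by
    intro E hE
    simp only [Finset.mem_insert, Finset.mem_singleton] at hE
    rw [Finset.mem_filter]
    have hD1 := mem_dirichletEdges.1 hD
    have hD2 := mem_dirichletEdges.1 hD'
    rcases hE with rfl | rfl | rfl
    · exact ⟨hD1.1, hzD, hD1.2.1⟩
    · exact ⟨hD2.1, hzD', hD2.2.1⟩
    · exact ⟨hFe, hzF, hFb⟩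
  have h3 := Finset.card_le_card hsub
  rw [h2, Finset.card_eq_three.2 ⟨D, D', F, hne, fun h => notMem_neumannEdges hD (h ▸ hF),
    fun h => notMem_neumannEdges hD' (h ▸ hF), rfl⟩] at h3
  omega

/-- One of the two boundary edges at z is not Dirichlet, and boundary edges are of one kind or the
other. -/
theorem exists_neumannEdge {z : Plane} (hz : z ∈ T.vertices) (hzs : z ∉ T.starVertices) :
    ∃ F ∈ T.neumannEdges, z ∈ F := by
  classical
  obtain ⟨K, hK⟩ := mem_vertices.1 hz
  have hzΩ : z ∉ T.Ω := fun h => hzs (Finset.mem_filter.2 ⟨hz, Or.inl h⟩)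
  obtain ⟨F, F', hne, hE⟩ := Finset.card_eq_two.1 (card_boundaryEdges_at hK hzΩ)
  obtain ⟨hF, hzF, hb⟩ := Finset.mem_filter.1
    (show F ∈ T.edges.filter fun F => z ∈ F ∧ T.IsBoundaryEdge F by simp [hE])
  obtain ⟨hF', hzF', hb'⟩ := Finset.mem_filter.1
    (show F' ∈ T.edges.filter fun F => z ∈ F ∧ T.IsBoundaryEdge F by simp [hE])
  rcases dirichlet_or_neumann hF hb with h | h
  · rcases dirichlet_or_neumann hF' hb' with h' | h'
    · exact absurd (Finset.mem_filter.2 ⟨hz, Or.inr ⟨F, h, F', h', hne, hzF, hzF'⟩⟩) hzs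
    · exact ⟨F', h', hzF'⟩
  · exact ⟨F, h, hzF⟩

theorem kernel_eq_span {z : Plane} (hz : z ∈ T.starVertices) (s : ℕ) :
    ∃ τ₀ : T.VectorField, τ₀ ≠ 0 ∧
      {τ | T.IsPatchKernel z s τ} = (Submodule.span ℝ {τ₀} : Set T.VectorField) := by
  classical
  obtain ⟨K, hK⟩ := mem_vertices.1 (Finset.mem_filter.1 hz).1
  obtain ⟨F, hF, hzF⟩ := exists_edge_at hK
  obtain ⟨τ₀, h0, hflux⟩ := exists_kernel s fun F hF => notMem_of_mem_neumannEdges hz hF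
  have ho := orient_mul_self hF hzF
  refine ⟨τ₀, ?_, Set.Subset.antisymm (fun τ hτ => ?_) ?_⟩
  · rintro rfl
    have h1 := hflux F hF hzF
    simp only [normalTrace_zero, edgeIntegral_zero] at h1
    rw [← h1, mul_zero] at ho
    exact zero_ne_one ho
  -- The oriented flux d is the coordinate of τ along τ₀: the difference τ - d τ₀ has no flux
  -- through F.
  · set d := T.orient z F * edgeIntegral F (fun x => normalTrace τ F x) with hd
    have hker : T.IsPatchKernel z s (τ + (-d) • τ₀) :=
      (T.kernelSpace z s).add_mem hτ ((T.kernelSpace z s).smul_mem _ h0)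
    have h1 := kernel_eq_zero hker hF hzF (by
      simp only [normalTrace_add, normalTrace_smul]
      rw [edgeIntegral_add (h' := fun x => -d * normalTrace τ₀ F x) (mem_edges.1 hF).2
        (continuous_normalTrace τ F) (continuous_const.mul (continuous_normalTrace τ₀ F)), edgeIntegral_const_mul,
        hflux F hF hzF, hd]
      linear_combination (-edgeIntegral F (fun x => normalTrace τ F x)) * ho)
    rw [neg_smul, ← sub_eq_add_neg, sub_eq_zero] at h1
    exact Submodule.mem_span_singleton.2 ⟨d, h1.symm⟩
  · intro τ hτ
    obtain ⟨d, rfl⟩ := Submodule.mem_span_singleton.1 hτ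
    exact (T.kernelSpace z s).smul_mem d h0

theorem kernel_eq_singleton_zero {z : Plane} (hz : z ∈ T.vertices) (hzs : z ∉ T.starVertices)
    (s : ℕ) : {τ | T.IsPatchKernel z s τ} = {0} := by
  obtain ⟨F, hF, hzF⟩ := exists_neumannEdge hz hzs
  refine Set.Subset.antisymm (fun τ hτ => ?_) ?_
  · refine kernel_eq_zero hτ (mem_neumannEdges.1 hF).1 hzF ?_
    rw [edgeIntegral_congr (h' := fun _ => 0) fun x hx => hτ.1.1.2.2 F hF x hx, edgeIntegral_zero]
  · rintro _ rfl
    exact (T.kernelSpace z s).zero_mem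

end Mesh

namespace Mesh

variable {T : Mesh}

/-! ### The load and the residual -/

/-- The datum f is controlled only on the open set Ω, which contains the interior of the triangle;
the boundary of the triangle is a null set. -/
theorem integrableOn_mul_eval {f : Plane → ℝ} (hf : MemLp f 2 (volume.restrict T.Ω))
    (K : T.triangles) (p : MvPolynomial (Fin 2) ℝ) :
    IntegrableOn (fun x => f x * eval x.ofLp p) (hull K.1) := by
  have hae : interior (hull K.1) =ᵐ[volume] hull K.1 :=
    interior_ae_eq_of_null_frontier ((convex_convexHull ℝ _).addHaar_frontier volume)
  have h1 : MemLp f 2 (volume.restrict (hull K.1)) := by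
    rw [← Measure.restrict_congr_set hae]
    exact hf.mono_measure (Measure.restrict_mono (interior_hull_subset K) le_rfl)
  have : IsFiniteMeasure (volume.restrict (hull K.1)) :=
    isFiniteMeasure_restrict.2 (isCompact_hull _).measure_ne_top
  have h2 : IntegrableOn f (hull K.1) := h1.integrable (by norm_num)
  exact h2.mul_continuousOn (continuous_eval_ofLp p).continuousOn (isCompact_hull _)

theorem integrableOn_sub_mul_eval {f : Plane → ℝ} (hf : MemLp f 2 (volume.restrict T.Ω))
    (K : T.triangles) (q p : MvPolynomial (Fin 2) ℝ) :
    IntegrableOn (fun x => (f x - eval x.ofLp q) * eval x.ofLp p) (hull K.1) := by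
  simp only [sub_mul]
  exact (integrableOn_mul_eval hf K p).sub (integrableOn_hull _ (by fun_prop))

theorem residual_eq {f : Plane → ℝ} (hf : MemLp f 2 (volume.restrict T.Ω)) (σ : T.VectorField)
    (v : T.Broken) : residual f σ v = load f v - pairing (div σ) v := by
  unfold residual load pairing
  rw [← Finset.sum_sub_distrib]
  refine Finset.sum_congr rfl fun K _ => ?_
  rw [← integral_sub (integrableOn_mul_eval hf K _) (integrableOn_hull _ (by fun_prop))]
  simp only [sub_mul]

/-- The residual as a linear functional. -/
def residualForm {f : Plane → ℝ} (hf : MemLp f 2 (volume.restrict T.Ω)) (σ : T.VectorField) :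
    T.Broken →ₗ[ℝ] ℝ where
  toFun := residual f σ
  map_add' v w := by
    unfold residual
    rw [← Finset.sum_add_distrib]
    refine Finset.sum_congr rfl fun K _ => ?_
    rw [← integral_add (integrableOn_sub_mul_eval hf K _ _) (integrableOn_sub_mul_eval hf K _ _)]
    simp only [Pi.add_apply, map_add, mul_add]
  map_smul' c v := by
    unfold residual
    rw [RingHom.id_apply, smul_eq_mul, Finset.mul_sum]
    refine Finset.sum_congr rfl fun K _ => ?_
    rw [← integral_const_mul]
    simp only [Pi.smul_apply, smul_eval, mul_left_comm]

theorem jump_of_isBoundaryEdge {F : Finset Plane} (hF : F ∈ T.edges) (hb : T.IsBoundaryEdge F)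
    (v : T.Broken) (x : Plane) : jump v F x = T.minus F (fun K => eval x.ofLp (v K)) := by
  obtain ⟨K, -, -, -, -, hp⟩ := minus_plus_of_isBoundaryEdge hF hb
  rw [jump, hp, sub_zero]

theorem exists_jump_eq {m : ℕ} {v : T.Broken} (hv : T.DG m v) (F : Finset Plane) :
    ∃ q ∈ PolyLE m, ∀ x, jump v F x = eval x.ofLp q := by
  classical
  refine ⟨∑ K : T.triangles, if F ⊆ K.1 then C (T.sgn F K.1) * v K else 0,
    Submodule.sum_mem _ fun K _ => ?_, fun x => ?_⟩
  · split_ifs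
    · exact C_mul_mem_polyLE _ (hv K)
    · exact Submodule.zero_mem _
  · rw [jump_eq_sum, map_sum]
    refine Finset.sum_congr rfl fun K _ => ?_
    split_ifs <;> simp

theorem sum_edges (h : Finset Plane → ℝ) :
    ∑ F ∈ T.edges, h F = ∑ F ∈ T.activeEdges, h F + ∑ F ∈ T.neumannEdges, h F := by
  classical
  exact (Finset.sum_sdiff (Finset.filter_subset _ _)).symm

/-- For m = 0 there is no moment condition, but then the gradient is zero. -/
theorem innerForm_grad_eq {A : T.Coeff} {g : Finset Plane → MvPolynomial (Fin 2) ℝ} {u : T.Broken}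
    {m : ℕ} {σ : T.VectorField} (hσ : T.IsAveragedFlux A g u m σ) {v : T.Broken} (hv : T.DG m v)
    (K : T.triangles) :
    innerForm K (σ K) (grad v K) = -innerForm K (coeffGrad A u K) (grad v K) := by
  rcases m with _ | m
  · have : grad v K = 0 := funext fun i => pderiv_eq_zero_of_mem_polyLE (hv K) i
    rw [this, map_zero, map_zero, neg_zero]
  · exact hσ.2.2.2 (Nat.le_add_left _ _) K _ fun i => pderiv_mem_polyLE (hv K) i

/-- The residual of an averaged flux, tested with a broken polynomial of its degree. -/
theorem residual_averagedFlux {f : Plane → ℝ} (hf : MemLp f 2 (volume.restrict T.Ω))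
    {A : T.Coeff} {g : Finset Plane → MvPolynomial (Fin 2) ℝ} {u : T.Broken}
    {m : ℕ} {σ : T.VectorField} (hσ : T.IsAveragedFlux A g u m σ) {v : T.Broken} (hv : T.DG m v) :
    residual f σ v = load f v - ∑ K : T.triangles, innerForm K (coeffGrad A u K) (grad v K)
      + ∑ F ∈ T.activeEdges,
          edgeIntegral F (fun x => weightedAverage A (coeffGrad A u) F x * jump v F x)
      - ∑ F ∈ T.neumannEdges, edgeIntegral F (fun x => eval x.ofLp (g F) * jump v F x) := by
  -- After integration by parts the flux is tested only with the gradient of v inside triangles and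
  -- with jumps on edges. Both are admissible in its defining moments, so σ and its index drop out
  -- of the result.
  have h1 := by_parts hσ.1.1 v
  have h2 : ∑ K : T.triangles, innerForm K (σ K) (grad v K)
      = -∑ K : T.triangles, innerForm K (coeffGrad A u K) (grad v K) := by
    rw [← Finset.sum_neg_distrib]
    exact Finset.sum_congr rfl fun K _ => innerForm_grad_eq hσ hv K
  have h3 : ∑ F ∈ T.activeEdges, edgeIntegral F (fun x => normalTrace σ F x * jump v F x)
      = -∑ F ∈ T.activeEdges,
          edgeIntegral F (fun x => weightedAverage A (coeffGrad A u) F x * jump v F x) := by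
    rw [← Finset.sum_neg_distrib]
    refine Finset.sum_congr rfl fun F hF => ?_
    obtain ⟨q, hq, hqj⟩ := exists_jump_eq hv F
    simp only [hqj]
    exact hσ.2.1 F hF q hq
  have h4 : ∑ F ∈ T.neumannEdges, edgeIntegral F (fun x => normalTrace σ F x * jump v F x)
      = ∑ F ∈ T.neumannEdges, edgeIntegral F (fun x => eval x.ofLp (g F) * jump v F x) := by
    refine Finset.sum_congr rfl fun F hF => ?_
    obtain ⟨q, hq, hqj⟩ := exists_jump_eq hv F
    simp only [hqj]
    exact hσ.2.2.1 F hF q hq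
  simp only [← innerForm_apply] at h1
  rw [sum_edges, h2, h3, h4] at h1
  rw [residual_eq hf]
  linarith

/-! ### Solvability of the patch problems -/

/-- The hat functions are continuous across edges, hence multiplication by them also multiplies
jumps. -/
theorem bary_eq_of_mem_hull {F : Finset Plane} {K K' : T.triangles} (hK : F ⊆ K.1) (hK' : F ⊆ K'.1)
    (z : Plane) {x : Plane} (hx : x ∈ hull F) : T.bary K z x = T.bary K' z x := by
  have hc : Convex ℝ ((T.bary K z - T.bary K' z) ⁻¹' {0}) :=
    (convex_singleton (0 : ℝ)).affine_preimage _
  have hsub : (F : Set Plane) ⊆ (T.bary K z - T.bary K' z) ⁻¹' {0} := fun y hy => by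
    have h1 : T.bary K z y = T.bary K' z y := by
      by_cases h : y = z
      · subst h
        rw [bary_self (hK hy), bary_self (hK' hy)]
      · rw [bary_of_ne (hK hy) h, bary_of_ne (hK' hy) h]
    exact sub_eq_zero.2 h1
  exact sub_eq_zero.1 (convexHull_min hsub hc hx)

theorem bary_eq_zero_of_mem_hull {F : Finset Plane} {K : T.triangles} (hK : F ⊆ K.1)
    {z : Plane} (hz : z ∉ F) {x : Plane} (hx : x ∈ hull F) : T.bary K z x = 0 := by
  have hc : Convex ℝ (T.bary K z ⁻¹' {0}) := (convex_singleton (0 : ℝ)).affine_preimage _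
  exact convexHull_min (fun y hy => bary_of_ne (hK hy) fun h : y = z => hz (h ▸ hy)) hc hx

theorem jump_mul_hat {F : Finset Plane} {K : T.triangles} (hK : F ⊆ K.1) (v : T.Broken)
    (z : Plane) {x : Plane} (hx : x ∈ hull F) :
    jump (v * T.hat z) F x = jump v F x * T.bary K z x := by
  classical
  rw [jump_eq_sum, jump_eq_sum, Finset.sum_mul]
  refine Finset.sum_congr rfl fun K' _ => ?_
  split_ifs with h
  · rw [Pi.mul_apply, map_mul, eval_hat, bary_eq_of_mem_hull h hK z hx, mul_assoc]
  · rw [zero_mul]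

/-- A broken polynomial without jumps in the interior of the domain belongs to `H¹`. -/
theorem isH1_of_jump {v : T.Broken} (h : ∀ F ∈ T.edges, ¬ T.IsBoundaryEdge F → ∀ x ∈ hull F,
    jump v F x = 0) : T.IsH1 v := by
  intro φ hφ i
  -- The criterion for H(div) is applied to v times the i-th unit vector, whose divergence is the
  -- i-th partial derivative of v.
  have h1 : T.IsHdiv (fun K => Pi.single i (v K)) := by
    refine (isHdiv_iff _).2 fun F hF hb x hx => ?_
    have hj := h F hF hb x hx
    obtain ⟨K, K', -, -, -, -, hm, hp⟩ := minus_plus_of_not_isBoundaryEdge hF hb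
    rw [jump, hm, hp, sub_eq_zero] at hj
    rw [hm, hp]
    unfold normalComp
    refine Finset.sum_congr rfl fun j _ => ?_
    by_cases hji : j = i
    · subst hji; simp only [Pi.single_eq_same]; rw [hj]
    · simp only [Pi.single_eq_of_ne hji]
  have h2 := h1 φ hφ
  have e1 : ∀ (K : T.triangles) (x : Plane), ∑ j, eval x.ofLp ((Pi.single i (v K) :
      Fin 2 → MvPolynomial (Fin 2) ℝ) j) * fderiv ℝ φ x (EuclideanSpace.single j 1)
      = eval x.ofLp (v K) * fderiv ℝ φ x (EuclideanSpace.single i 1) := fun K x => by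
    rw [Finset.sum_eq_single i (fun j _ hj => by simp [Pi.single_eq_of_ne hj]) (by simp),
      Pi.single_eq_same]
  have e2 : ∀ K : T.triangles, div (fun K : T.triangles => Pi.single i (v K)) K = grad v K i :=
    fun K => by
      unfold div grad
      rw [Finset.sum_eq_single i (fun j _ hj => by simp [Pi.single_eq_of_ne hj]) (by simp)]
      simp only [Pi.single_eq_same]
  simpa only [e1, e2] using h2

/-- The jump is itself an admissible normal trace. The patch flux with this trace on F and zero on
the other edges gives a vanishing integral of the squared jump. -/
theorem jump_eq_zero_of_annihilates {z : Plane} {s : ℕ} {v : T.Broken} (hv : T.DG s v)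
    (h : ∀ τ, T.PatchRT z s τ → patchForm z τ v = 0) {F : Finset Plane}
    (hF : F ∈ T.activeEdges) (hz : z ∈ F) : ∀ x ∈ hull F, jump v F x = 0 := by
  classical
  obtain ⟨q, hq, hqj⟩ := exists_jump_eq hv F
  obtain ⟨hFe, hFN⟩ := mem_activeEdges.1 hF
  obtain ⟨τ, hτ, htr⟩ := exists_patchRT (T := T) (z := z) (Pi.single F q)
    (fun F' => by
      by_cases hne : F' = F
      · subst hne; rwa [Pi.single_eq_same]
      · rw [Pi.single_eq_of_ne hne]; exact Submodule.zero_mem _)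
    (fun F' hz' => Pi.single_eq_of_ne (fun e : F' = F => hz' (e ▸ hz)) _)
    (fun F' hN => Pi.single_eq_of_ne (fun e : F' = F => hFN (e ▸ hN)) _)
  have h1 := h τ hτ
  rw [patchForm_eq z hτ.1, Finset.sum_eq_single F] at h1
  · rw [edgeIntegral_congr (h' := fun x => eval x.ofLp q * eval x.ofLp q) fun x hx => by
      rw [htr F hFe x hx, hqj, Pi.single_eq_same]] at h1
    intro x hx
    rw [hqj]
    exact mul_self_eq_zero.1 (eqOn_zero_of_edgeIntegral_eq_zero (mem_edges.1 hFe).2 (by fun_prop)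
      (fun x _ => mul_self_nonneg _) h1 x hx)
  · intro F' hF' hne
    rw [edgeIntegral_congr (h' := fun _ => 0) fun x hx => by
      rw [htr F' (Finset.mem_filter.1 hF').1 x hx, Pi.single_eq_of_ne hne, map_zero, zero_mul],
      edgeIntegral_zero]
  · exact fun hn => absurd (Finset.mem_filter.2 ⟨hFe, hz⟩) hn

theorem cg₀_of_jump {k : ℕ} {v : T.Broken} (hv : T.DG k v)
    (h : ∀ F ∈ T.activeEdges, ∀ x ∈ hull F, jump v F x = 0) : T.CG₀ k v := by
  refine ⟨hv, isH1_of_jump fun F hF hb => h F (mem_activeEdges.2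
    ⟨hF, fun hN => hb (mem_neumannEdges.1 hN).2.1⟩), fun F hF x hx => ?_⟩
  obtain ⟨hFe, hb, -⟩ := mem_dirichletEdges.1 hF
  rw [← jump_of_isBoundaryEdge hFe hb]
  exact h F (mem_activeEdges.2 ⟨hFe, notMem_neumannEdges hF⟩) x hx

/-- Galerkin orthogonality for the residual of an averaged flux. -/
theorem residual_eq_zero {f : Plane → ℝ} (hf : MemLp f 2 (volume.restrict T.Ω))
    {A : T.Coeff} {g : Finset Plane → MvPolynomial (Fin 2) ℝ} {k : ℕ} {u : T.Broken}
    (hu : T.IsCGSolution A f g k u) {m : ℕ} (hmk : m ≤ k) {ρ : T.VectorField}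
    (hρ : T.IsAveragedFlux A g u m ρ) {w : T.Broken} (hw : T.DG m w)
    (h : ∀ F ∈ T.activeEdges, ∀ x ∈ hull F, jump w F x = 0) : residual f ρ w = 0 := by
  have h1 := hu.2 w (cg₀_of_jump (fun K => polyLE_mono hmk (hw K)) h)
  simp only [← innerForm_apply] at h1
  have h2 : ∑ F ∈ T.activeEdges,
      edgeIntegral F (fun x => weightedAverage A (coeffGrad A u) F x * jump w F x) = 0 :=
    Finset.sum_eq_zero fun F hF => by
      rw [edgeIntegral_congr (h' := fun _ => 0) fun x hx => by rw [h F hF x hx, mul_zero],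
        edgeIntegral_zero]
  have h3 : ∑ F ∈ T.neumannEdges, edgeIntegral F (fun x => eval x.ofLp (g F) * jump w F x)
      = ∑ F ∈ T.neumannEdges, edgeIntegral F fun x =>
          eval x.ofLp (g F) * T.minus F (fun K => eval x.ofLp (w K)) :=
    Finset.sum_congr rfl fun F hF => by
      obtain ⟨hFe, hb, -⟩ := mem_neumannEdges.1 hF
      simp only [jump_of_isBoundaryEdge hFe hb]
  rw [residual_averagedFlux hf hρ hw, h1, h2, h3]
  ring

/-- The patch problems are solvable. -/
theorem exists_isPatchSolution {f : Plane → ℝ} (hf : MemLp f 2 (volume.restrict T.Ω))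
    {A : T.Coeff} {g : Finset Plane → MvPolynomial (Fin 2) ℝ} {k : ℕ} {u : T.Broken}
    (hu : T.IsCGSolution A f g k u) {s m : ℕ} (hs : s + 1 ≤ m) (hmk : m ≤ k) {ρ : T.VectorField}
    (hρ : T.IsAveragedFlux A g u m ρ) (z : Plane) : ∃ σ, T.IsPatchSolution f ρ z s σ := by
  obtain ⟨σ, hσ⟩ := exists_eq_of_annihilates
    ((T.patchBilin z).compl₁₂ (T.patchRTSpace z s).subtype (T.patchDGSpace z s).subtype)
    (residualForm hf ρ ∘ₗ LinearMap.mulRight ℝ (T.hat z) ∘ₗ (T.patchDGSpace z s).subtype)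
    (by
      rintro ⟨v, hv⟩ h
      -- The product with the hat function has degree s + 1, whence the condition on the index. On
      -- edges without z the hat function removes the jump; on the active edges at z the jump of v
      -- is already zero.
      refine residual_eq_zero hf hu hmk hρ (w := v * T.hat z)
        (fun K => polyLE_mono hs (mul_mem_polyLE (hv.1 K) (hat_mem_polyLE K z)))
        fun F hF x hx => ?_
      obtain ⟨K, hK⟩ := exists_triangle_of_face (mem_edges.1 (mem_activeEdges.1 hF).1).1
      rw [jump_mul_hat hK v z hx]
      by_cases hz : z ∈ F
      · rw [jump_eq_zero_of_annihilates hv.1 (fun τ hτ => h ⟨τ, hτ⟩) hF hz x hx, zero_mul]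
      · rw [bary_eq_zero_of_mem_hull hK hz hx, mul_zero])
  exact ⟨σ.1, σ.2, fun v hv => LinearMap.congr_fun hσ ⟨v, hv⟩⟩

end Mesh

namespace Mesh

variable {T : Mesh}

/-! ### The energy and its minimization -/

theorem continuous_mulVec_dotProduct (M : Matrix (Fin 2) (Fin 2) ℝ)
    (p q : Fin 2 → MvPolynomial (Fin 2) ℝ) :
    Continuous fun x : Plane =>
      (M *ᵥ fun i => eval x.ofLp (p i)) ⬝ᵥ fun i => eval x.ofLp (q i) := by
  simp only [dotProduct, Matrix.mulVec]
  fun_prop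

open Classical in
/-- The energy inner product on the star patch of `z`. -/
def energyForm (A : T.Coeff) (z : Plane) : T.VectorField →ₗ[ℝ] T.VectorField →ₗ[ℝ] ℝ :=
  LinearMap.mk₂ ℝ (energy A z)
    (fun σ σ' τ => by
      unfold energy
      rw [← Finset.sum_add_distrib]
      refine Finset.sum_congr rfl fun K _ => ?_
      split_ifs
      · rw [← integral_add (integrableOn_hull _ (continuous_mulVec_dotProduct _ _ _))
          (integrableOn_hull _ (continuous_mulVec_dotProduct _ _ _))]
        refine integral_congr_ae (.of_forall fun x => ?_)
        simp only [Pi.add_apply, map_add, ← add_dotProduct, ← Matrix.mulVec_add]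
        rfl
      · rw [add_zero])
    (fun c σ τ => by
      unfold energy
      rw [smul_eq_mul, Finset.mul_sum]
      refine Finset.sum_congr rfl fun K _ => ?_
      split_ifs
      · rw [← integral_const_mul]
        refine integral_congr_ae (.of_forall fun x => ?_)
        simp only [Pi.smul_apply, smul_eval, ← smul_eq_mul, ← smul_dotProduct,
          ← Matrix.mulVec_smul]
        rfl
      · rw [mul_zero])
    (fun σ τ τ' => by
      unfold energy
      rw [← Finset.sum_add_distrib]
      refine Finset.sum_congr rfl fun K _ => ?_
      split_ifs
      · rw [← integral_add (integrableOn_hull _ (continuous_mulVec_dotProduct _ _ _))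
          (integrableOn_hull _ (continuous_mulVec_dotProduct _ _ _))]
        refine integral_congr_ae (.of_forall fun x => ?_)
        simp only [Pi.add_apply, map_add, ← dotProduct_add]
        rfl
      · rw [add_zero])
    (fun c σ τ => by
      unfold energy
      rw [smul_eq_mul, Finset.mul_sum]
      refine Finset.sum_congr rfl fun K _ => ?_
      split_ifs
      · rw [← integral_const_mul]
        refine integral_congr_ae (.of_forall fun x => ?_)
        simp only [Pi.smul_apply, smul_eval, ← smul_eq_mul, ← dotProduct_smul]
        rfl
      · rw [mul_zero])

theorem energy_comm {A : T.Coeff} (hA : ∀ K, (A K).PosDef) (z : Plane) (σ τ : T.VectorField) :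
    energy A z σ τ = energy A z τ σ := by
  unfold energy
  refine Finset.sum_congr rfl fun K _ => ?_
  split_ifs
  · refine integral_congr_ae (.of_forall fun x => ?_)
    have h1 : ((A K)⁻¹)ᵀ = (A K)⁻¹ := by
      simpa [Matrix.IsHermitian, Matrix.conjTranspose_eq_transpose_of_trivial]
        using (hA K).inv.isHermitian
    simp only
    rw [dotProduct_comm, Matrix.dotProduct_mulVec, ← Matrix.mulVec_transpose, h1]
  · rfl

theorem energy_self_nonneg {A : T.Coeff} (hA : ∀ K, (A K).PosDef) (z : Plane)
    (σ : T.VectorField) : 0 ≤ energy A z σ σ := by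
  refine Finset.sum_nonneg fun K _ => ?_
  split_ifs
  · refine integral_nonneg fun x => ?_
    have := (hA K).inv.posSemidef.dotProduct_mulVec_nonneg fun i => eval x.ofLp (σ K i)
    rw [dotProduct_comm]
    simpa using this
  · rfl

/-- The projection coefficient is the unique minimizer of the energy norm along a unit vector. -/
theorem energyNorm_lt {A : T.Coeff} (hA : ∀ K, (A K).PosDef) {z : Plane} {σ τ : T.VectorField}
    (hτ : energyNorm A z τ = 1) {t : ℝ} (ht : t ≠ energy A z σ τ) :
    energyNorm A z (σ - energy A z σ τ • τ) < energyNorm A z (σ - t • τ) := by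
  have h1 : energy A z τ τ = 1 := Real.sqrt_eq_one.1 hτ
  -- As τ has unit energy, this quadratic exceeds its minimum by the square of r - `energy A z σ τ`.
  have h2 : ∀ r : ℝ, energy A z (σ - r • τ) (σ - r • τ)
      = energy A z σ σ - 2 * r * energy A z σ τ + r ^ 2 := by
    intro r
    have : energyForm A z (σ - r • τ) (σ - r • τ) = energyForm A z σ σ - r * energyForm A z σ τ
        - r * energyForm A z τ σ + r ^ 2 * energyForm A z τ τ := by
      simp only [map_sub, map_smul, LinearMap.sub_apply, LinearMap.smul_apply, smul_eq_mul]
      ring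
    simp only [energyForm, LinearMap.mk₂_apply] at this
    rw [this, energy_comm hA z τ σ, h1]
    ring
  refine Real.sqrt_lt_sqrt (energy_self_nonneg hA z _) ?_
  rw [h2, h2]
  have := sq_pos_of_ne_zero (sub_ne_zero.2 ht)
  linarith

/-! ### The assembled flux -/

theorem IsPatchSolution.sub_smul {f : Plane → ℝ} {ρ : T.VectorField} {z : Plane} {s : ℕ}
    {σ τ : T.VectorField} (hσ : T.IsPatchSolution f ρ z s σ) (hτ : T.IsPatchKernel z s τ) (c : ℝ) :
    T.IsPatchSolution f ρ z s (σ - c • τ) :=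
  ⟨(T.patchRTSpace z s).sub_mem hσ.1 ((T.patchRTSpace z s).smul_mem c hτ.1), fun v hv => by
    rw [← patchBilin_apply, map_sub, map_smul, LinearMap.sub_apply, LinearMap.smul_apply,
      patchBilin_apply, patchBilin_apply, hσ.2 v hv, hτ.2 v hv, smul_zero, sub_zero]⟩

open Classical in
theorem assembledFlux_eq (A : T.Coeff) (S N : Plane → T.VectorField) :
    assembledFlux A S N = ∑ z ∈ T.vertices,
      if z ∈ T.starVertices then correctedFlux A S N z else S z := by
  unfold assembledFlux
  rw [← Finset.sum_sdiff (Finset.filter_subset _ _ : T.starVertices ⊆ T.vertices), add_comm]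
  congr 1
  · exact Finset.sum_congr rfl fun z hz => (if_neg (Finset.mem_sdiff.1 hz).2).symm
  · exact Finset.sum_congr rfl fun z hz => (if_pos hz).symm

variable (T) in
/-- The pairing of normal traces and jumps over the edges that are not Neumann edges. -/
def bilin : T.VectorField →ₗ[ℝ] T.Broken →ₗ[ℝ] ℝ := fluxForm T.activeEdges activeEdges_subset

theorem bilin_apply (τ : T.VectorField) (v : T.Broken) : T.bilin τ v = bform τ v := rfl

/-- Patch fluxes have no normal trace on edges away from z, so the global form does not see those
edges. -/
theorem bform_eq_patchForm {z : Plane} {s : ℕ} {τ : T.VectorField} (hτ : T.PatchRT z s τ)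
    (v : T.Broken) : bform τ v = patchForm z τ v := by
  classical
  unfold bform patchForm
  rw [Finset.sum_filter]
  refine Finset.sum_congr rfl fun F hF => ?_
  split_ifs with h
  · rfl
  · rw [edgeIntegral_congr (h' := fun _ => 0) fun x hx => by
      rw [hτ.2.2 F (mem_activeEdges.1 hF).1 h x hx, zero_mul], edgeIntegral_zero]

theorem sum_hat : ∑ z ∈ T.vertices, T.hat z = 1 := by
  classical
  funext K
  refine MvPolynomial.funext fun x => ?_
  rw [Finset.sum_apply, map_sum, Pi.one_apply, map_one, ← sum_bary K (WithLp.toLp 2 x)]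
  have h1 : K.1 ⊆ T.vertices := fun z hz => mem_vertices.2 ⟨K, hz⟩
  rw [← Finset.sum_subset h1 fun z _ hz => by rw [hat_of_notMem hz, map_zero]]
  exact Finset.sum_congr rfl fun z _ => eval_hat K z (WithLp.toLp 2 x)

/-- The sum of solutions of the patch problems solves the global problem. -/
theorem bform_sum {f : Plane → ℝ} (hf : MemLp f 2 (volume.restrict T.Ω)) {ρ : T.VectorField}
    {s : ℕ} {c : Plane → T.VectorField} (hc : ∀ z ∈ T.vertices, T.IsPatchSolution f ρ z s (c z))
    {v : T.Broken} (hv : T.DG s v) : bform (∑ z ∈ T.vertices, c z) v = residual f ρ v := by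
  classical
  have h1 : ∀ z ∈ T.vertices, T.bilin (c z) v = residualForm hf ρ (v * T.hat z) := by
    intro z hz
    -- Restricting v to the patch makes it an admissible test function and changes neither the patch
    -- form nor the product with the hat function.
    let w : T.Broken := fun K => if z ∈ K.1 then v K else 0
    have hw : T.PatchDG z s w := ⟨fun K => by
      by_cases h : z ∈ K.1
      · simp only [w, if_pos h]; exact hv K
      · simp only [w, if_neg h]; exact Submodule.zero_mem _, fun K hK => if_neg hK⟩
    have h2 : patchForm z (c z) v = patchForm z (c z) w := by
      rw [patchForm_eq_sum z (hc z hz).1.1, patchForm_eq_sum z (hc z hz).1.1]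
      refine Finset.sum_congr rfl fun K _ => ?_
      by_cases h : z ∈ K.1
      · simp only [w, if_pos h]
      · simp only [if_neg h]
    have h3 : v * T.hat z = w * T.hat z := by
      funext K
      by_cases h : z ∈ K.1
      · simp only [Pi.mul_apply, w, if_pos h]
      · simp only [Pi.mul_apply, hat_of_notMem h, mul_zero]
    rw [bilin_apply, bform_eq_patchForm (hc z hz).1, h2, (hc z hz).2 w hw, h3]
    rfl
  rw [← bilin_apply, map_sum, LinearMap.sum_apply, Finset.sum_congr rfl h1, ← map_sum,
    ← Finset.mul_sum, sum_hat, mul_one]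
  rfl

/-- On the correction space the edge pairing is the pairing with the divergence. -/
theorem bform_eq_pairing {s : ℕ} {τ : T.VectorField} (hτ : T.RTRing s τ) {v : T.Broken}
    (hv : T.DG s v) : bform τ v = pairing (div τ) v := by
  have h1 := by_parts hτ.1.1 v
  have h2 : ∑ K : T.triangles, innerForm K (τ K) (grad v K) = 0 := by
    refine Finset.sum_eq_zero fun K _ => ?_
    rcases s with _ | s
    · have : grad v K = 0 := funext fun i => pderiv_eq_zero_of_mem_polyLE (hv K) i
      rw [this, map_zero]
    · exact hτ.2.1 (Nat.le_add_left _ _) K _ fun i => pderiv_mem_polyLE (hv K) i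
  have h3 : ∑ F ∈ T.neumannEdges, edgeIntegral F (fun x => normalTrace τ F x * jump v F x) = 0 :=
    Finset.sum_eq_zero fun F hF => by
      rw [edgeIntegral_congr (h' := fun _ => 0) fun x hx => by
        rw [hτ.2.2 F hF x hx, zero_mul], edgeIntegral_zero]
  simp only [← innerForm_apply] at h1
  rw [sum_edges, h2, h3] at h1
  unfold bform
  linarith

theorem pairing_div_add (σ τ : T.VectorField) (v : T.Broken) :
    pairing (div (σ + τ)) v = pairing (div σ) v + pairing (div τ) v := by
  unfold pairing
  rw [← Finset.sum_add_distrib]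
  refine Finset.sum_congr rfl fun K _ => ?_
  rw [← integral_add (integrableOn_hull _ (by fun_prop)) (integrableOn_hull _ (by fun_prop))]
  simp only [div, Pi.add_apply, map_add, Finset.sum_add_distrib, add_mul]

/-- The residuals of two averaged fluxes agree on broken polynomials of low degree. -/
theorem residual_eq_residual {f : Plane → ℝ} (hf : MemLp f 2 (volume.restrict T.Ω))
    {A : T.Coeff} {g : Finset Plane → MvPolynomial (Fin 2) ℝ} {u : T.Broken} {s m m' : ℕ}
    (hm : s ≤ m) (hm' : s ≤ m') {σ ρ : T.VectorField} (hσ : T.IsAveragedFlux A g u m σ)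
    (hρ : T.IsAveragedFlux A g u m' ρ) {v : T.Broken} (hv : T.DG s v) :
    residual f ρ v = residual f σ v := by
  -- The expression obtained for the residual contains u and the data but not the flux or its index.
  rw [residual_averagedFlux hf hσ fun K => polyLE_mono hm (hv K),
    residual_averagedFlux hf hρ fun K => polyLE_mono hm' (hv K)]

end Mesh

end EARM

end

/-! ### Assembly of the theorem -/

theorem mainTheorem1 (T : EARM.Mesh)
    (A : T.Coeff) (hA : ∀ K, (A K).PosDef)
    (f : EARM.Plane → ℝ) (hf : MemLp f 2 (volume.restrict T.Ω))
    (k s l : ℕ) (hs : s + 1 ≤ k) (hl : l = k - 1 ∨ l = k)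
    (g : Finset EARM.Plane → MvPolynomial (Fin 2) ℝ)
    (hg : ∀ F ∈ T.neumannEdges, g F ∈ MvPolynomial.restrictTotalDegree (Fin 2) ℝ (k - 1))
    (u : T.Broken) (hu : T.IsCGSolution A f g k u)
    (σt ρ : T.VectorField)
    (hσt : T.IsAveragedFlux A g u (k - 1) σt) (hρ : T.IsAveragedFlux A g u l ρ) :
    -- the kernel of the patch problems
    (∀ z ∈ T.starVertices, ∃ τ₀ : T.VectorField, τ₀ ≠ 0 ∧
      {τ | T.IsPatchKernel z s τ} = (Submodule.span ℝ {τ₀} : Set T.VectorField)) ∧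
    (∀ z ∈ T.vertices, z ∉ T.starVertices → {τ | T.IsPatchKernel z s τ} = {0}) ∧
    -- solvability of the patch problems
    (s + 1 ≤ l → ∀ z ∈ T.vertices, ∃ σ, T.IsPatchSolution f ρ z s σ) ∧
    -- the corrected flux, for every choice of patch solutions and normalized kernel elements
    ∀ S N : EARM.Plane → T.VectorField,
      (∀ z ∈ T.vertices, T.IsPatchSolution f ρ z s (S z)) →
      (∀ z ∈ T.starVertices,
        T.IsPatchKernel z s (N z) ∧ EARM.Mesh.energyNorm A z (N z) = 1) →
      (∀ z ∈ T.starVertices, ∀ t : ℝ, t ≠ EARM.Mesh.energy A z (S z) (N z) →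
        EARM.Mesh.energyNorm A z (EARM.Mesh.correctedFlux A S N z)
          < EARM.Mesh.energyNorm A z (S z - t • N z)) ∧
      T.RTRing s (EARM.Mesh.assembledFlux A S N) ∧
      (∀ v, T.DG s v →
        EARM.Mesh.bform (EARM.Mesh.assembledFlux A S N) v = EARM.Mesh.residual f σt v) ∧
      T.RT (k - 1) (σt + EARM.Mesh.assembledFlux A S N) ∧
      (∀ v, T.DG s v →
        EARM.Mesh.pairing (EARM.Mesh.div (σt + EARM.Mesh.assembledFlux A S N)) v
          = EARM.Mesh.load f v) ∧
      (∀ F ∈ T.neumannEdges, ∀ x ∈ EARM.hull F,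
        EARM.Mesh.normalTrace (σt + EARM.Mesh.assembledFlux A S N) F x
          = MvPolynomial.eval x.ofLp (g F)) := by
  classical
  -- The patch problems use the residual of ρ, of index l, and the conclusion that of σt, of index k
  -- - 1. Both indices are at least s, so the residuals agree on the test functions.
  have hsl : s ≤ l := by omega
  have hsk : s ≤ k - 1 := by omega
  refine ⟨fun z hz => EARM.Mesh.kernel_eq_span hz s,
    fun z hz hzs => EARM.Mesh.kernel_eq_singleton_zero hz hzs s,
    fun hs z _ => EARM.Mesh.exists_isPatchSolution hf hu hs (by omega) hρ z,
    fun S N hS hN => ?_⟩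
  set c : EARM.Plane → T.VectorField := fun z =>
    if z ∈ T.starVertices then EARM.Mesh.correctedFlux A S N z else S z with hcdef
  have hc : ∀ z ∈ T.vertices, T.IsPatchSolution f ρ z s (c z) := by
    intro z hz
    by_cases h : z ∈ T.starVertices
    · simp only [hcdef, if_pos h]
      exact (hS z hz).sub_smul (hN z h).1 _
    · simp only [hcdef, if_neg h]
      exact hS z hz
  have hsum : EARM.Mesh.assembledFlux A S N = ∑ z ∈ T.vertices, c z :=
    EARM.Mesh.assembledFlux_eq A S N
  have hring : T.RTRing s (EARM.Mesh.assembledFlux A S N) := by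
    rw [hsum]
    exact (T.rtRingSpace s).sum_mem fun z hz => (hc z hz).1.1
  have hres : ∀ v, T.DG s v →
      EARM.Mesh.bform (EARM.Mesh.assembledFlux A S N) v = EARM.Mesh.residual f σt v := by
    intro v hv
    rw [hsum, EARM.Mesh.bform_sum hf hc hv,
      EARM.Mesh.residual_eq_residual hf hsk hsl hσt hρ hv]
  refine ⟨fun z hz t ht => EARM.Mesh.energyNorm_lt hA (hN z hz).2 ht, hring, hres, ?_,
    fun v hv => ?_, fun F hF x hx => ?_⟩
  · exact (T.rtSpace (k - 1)).add_mem hσt.1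
      ⟨hring.1.1, fun K => EARM.localRT_mono hsk (hring.1.2 K)⟩
  -- The divergence of the correction contributes exactly the residual (f - div σt, v).
  · rw [EARM.Mesh.pairing_div_add, ← EARM.Mesh.bform_eq_pairing hring hv, hres v hv,
      EARM.Mesh.residual_eq hf]
    ring
  · rw [EARM.Mesh.normalTrace_add, hring.2.2 F hF x hx, add_zero]
    -- The trace of σt and the datum g both have degree at most k - 1, so equality of moments up to
    -- that degree is pointwise equality.
    exact EARM.Mesh.normalTrace_eq_of_moments hσt.1 (EARM.Mesh.mem_neumannEdges.1 hF).1 (hg F hF)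
      (hσt.2.2.1 F hF) x hx
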